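/- Let $k$ be a commutative ring; gradings are cohomological. All ns (nonsymmetric) operads are filtered dg ns operads over $k$, with a decreasing filtration $F_0=\text{everything}\supseteq F_1\supseteq F_2\supseteq\cdots$ compatible with the partial compositions $\circ_i$ and the differential; *complete* means that each component is the limit of its quotients by the $F_p$. Morphisms preserve units, compositions, differentials and filtrations. *The operad $\mathrm{ncGerst}$.* $\mathrm{ncGerst}(0)=0$, and for $n\ge1$ the graded module $\mathrm{ncGerst}(n)$ is free on the bamboos with $n$ vertices, i.e. the subsets of the set of $n-1$ edges $(j,j+1)$ of the linear graph on $1,\dots,n$; the degree is the number of edges, the differential is zero, and $F_1=0$. The composite $\Gamma_1\circ_i\Gamma_2$ replaces the vertex $i$ of $\Gamma_1$ by $\Gamma_2$ (with the vertices relabelled from left to right), with sign $(-1)^{ab}$, where $a$ is the number of edges of $\Gamma_1$ to the right of the vertex $i$ and $b$ is the number of edges of $\Gamma_2$. The connected bamboo $m$ with two vertices satisfies $m\circ_1m+m\circ_2m=0$. *The twisted operad.* $\mathrm{Tw}\,\mathrm{ncGerst}$ is the complete coproduct $\mathrm{ncGerst}\,\hat\vee\,\alpha$, with $\alpha$ a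 free generator of arity $0$ and degree $0$ placed in $F_1$. Its elements of arity $n$ are the families, indexed by $j\ge0$, of finite linear combinations of bamboos with $n$ white vertices (the inputs) and $j$ black vertices (copies of $\alpha$). Its differential is $D+\mathrm{ad}_\mu$, where $D$ is the derivation with $D|_{\mathrm{ncGerst}}=0$ and $D(\alpha)=-m(\alpha,\alpha)$, where $\mu=m(\alpha,-)+m(-,\alpha)$, and $\mathrm{ad}_\mu(x)=\mu\star x-(-1)^{|x|}x\star\mu$ with $x\star y=\sum_i x\circ_iy$. Its cohomology $H(\mathrm{Tw}\,\mathrm{ncGerst})$ is an ns operad with the filtration induced on cocycles modulo coboundaries. *The operad $\mathcal S^{-1}\mathrm{As}^+$.* $\mathcal S^{-1}\mathrm{As}$ is zero in arity $0$, and for $n\ge1$ is free of rank one in arity $n$ on an element $\nu_n$ of degree $n-1$, with $\nu_m\circ_i\nu_n=(-1)^{(i-1)(n-1)}\nu_{m+n-1}$; it is generated by $b=\nu_2$, with relation $b\circ_1b=-b\circ_2b$. Its differential is zero and $F_1=0$. For $w\ge1$, let $\mathcal S^{-1}\mathrm{As}\,\hat\vee_w\,\gamma$ be the complete coproduct with a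 closed free generator $\gamma$ of arity $0$ and degree $0$ placed in $F_w$, and let $\mathcal S^{-1}\mathrm{As}^+_w$ be its quotient by the closed operadic ideal generated by $b(\gamma,-)$ and $b(-,\gamma)$, with the quotient filtration. For $w=1,2$ these differ only by the filtration level of $\gamma$. **Theorem.** The ns operads $\mathrm{Tw}\,\mathrm{ncGerst}$ and $H(\mathrm{Tw}\,\mathrm{ncGerst})$ are complete. For $w\in\{1,2\}$ the ns operads $\mathcal S^{-1}\mathrm{As}\,\hat\vee_w\,\gamma$ and $\mathcal S^{-1}\mathrm{As}^+_w$ are complete, and there is a unique morphism of complete dg ns operads $$\varphi:\ \mathcal S^{-1}\mathrm{As}\,\hat\vee_w\,\gamma\longrightarrow \mathrm{Tw}\,\mathrm{ncGerst}$$ that sends $b$ to the connected bamboo with two white vertices and $\gamma$ to the bamboo made of two disjoint black vertices. Its values are cocycles, and it induces a morphism $\Phi:\mathcal S^{-1}\mathrm{As}^+_w\to H(\mathrm{Tw}\,\mathrm{ncGerst})$, $[x]\mapsto[\varphi(x)]$, which is bijective in every arity and degree, with inverse continuous for the filtration topologies. For $w=2$ the inverse preserves the filtrations as well, so that $\Phi$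 is an isomorphism of complete ns operads $$\mathcal S^{-1}\mathrm{As}^+_2\;\cong\;H(\mathrm{Tw}\,\mathrm{ncGerst}).$$ -/

import Mathlib

universe u

namespace NSOp

/-- The sign `(-1) ^ d` as a scalar of `k`. -/
def sgn (k : Type u) [CommRing k] (d : ℤ) : k := ((d.negOnePow : ℤ) : k)

section sgn
variable {k : Type u} [CommRing k]

theorem sgn_add (a b : ℤ) : sgn k (a + b) = sgn k a * sgn k b := by
  simp [sgn, Int.negOnePow_add]

theorem sgn_mul_self (a : ℤ) : sgn k a * sgn k a = 1 := by
  rw [← sgn_add]; simp [sgn]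

@[simp] theorem sgn_zero : sgn k 0 = 1 := by simp [sgn]

@[simp] theorem sgn_one : sgn k 1 = -1 := by simp [sgn]

theorem sgn_eq_of_even_sub {a b : ℤ} (h : Even (a - b)) : sgn k a = sgn k b := by
  have : a = b + (a - b) := by ring
  rw [this, sgn_add]
  simp [sgn, Int.negOnePow_even _ h]

end sgn

/-- A filtered dg nonsymmetric operad over `k`, with cohomological grading: `obj n d` is the
component of arity `n` and degree `d`. Compositions are the partial compositions `x ∘ᵢ y`, where
the inputs of an operation of arity `m` are numbered `0, …, m - 1`. The resulting arity
`l = m + n - 1` and the resulting degree `f = d + e` are free indices pinned by equations, which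
avoids transports between propositionally equal components. -/
structure FDGOperad (k : Type u) [CommRing k] where
  obj : ℕ → ℤ → Type u
  [grp : ∀ n d, AddCommGroup (obj n d)]
  [mod : ∀ n d, Module k (obj n d)]
  /-- the decreasing filtration `F₀ ⊇ F₁ ⊇ F₂ ⊇ ⋯` -/
  fil : ∀ n d, ℕ → Submodule k (obj n d)
  fil_zero : ∀ n d, fil n d 0 = ⊤
  fil_anti : ∀ n d, Antitone (fil n d)
  one : obj 1 0
  comp : ∀ {m n l : ℕ} {d e f : ℤ}, l + 1 = m + n → d + e = f → ∀ i : ℕ, i < m →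
    (obj m d →ₗ[k] obj n e →ₗ[k] obj l f)
  comp_mem_fil : ∀ {m n l : ℕ} {d e f : ℤ} (hl : l + 1 = m + n) (hf : d + e = f) (i : ℕ)
    (hi : i < m) {p q : ℕ} {x : obj m d} {y : obj n e}, x ∈ fil m d p → y ∈ fil n e q →
    comp hl hf i hi x y ∈ fil l f (p + q)
  one_comp : ∀ {n : ℕ} {d : ℤ} (hl : n + 1 = 1 + n) (hf : 0 + d = d) (x : obj n d),
    comp hl hf 0 Nat.one_pos one x = x
  comp_one : ∀ {m : ℕ} {d : ℤ} (hl : m + 1 = m + 1) (hf : d + 0 = d) (i : ℕ) (hi : i < m)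
    (x : obj m d), comp hl hf i hi x one = x
  /-- sequential composition axiom -/
  comp_seq : ∀ {m n p mn np l : ℕ} {d e f de ef g : ℤ}
    (h₁ : mn + 1 = m + n) (h₂ : l + 1 = mn + p) (h₃ : np + 1 = n + p) (h₄ : l + 1 = m + np)
    (g₁ : d + e = de) (g₂ : de + f = g) (g₃ : e + f = ef) (g₄ : d + ef = g)
    (i j : ℕ) (hi : i < m) (hj : j < n) (hij : i + j < mn)
    (x : obj m d) (y : obj n e) (z : obj p f),
    comp h₂ g₂ (i + j) hij (comp h₁ g₁ i hi x y) z = comp h₄ g₄ i hi x (comp h₃ g₃ j hj y z)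
  /-- parallel composition axiom, with its Koszul sign -/
  comp_par : ∀ {m n p mn mp l : ℕ} {d e f de df g : ℤ}
    (h₁ : mn + 1 = m + n) (h₂ : l + 1 = mn + p) (h₃ : mp + 1 = m + p) (h₄ : l + 1 = mp + n)
    (g₁ : d + e = de) (g₂ : de + f = g) (g₃ : d + f = df) (g₄ : df + e = g)
    (i j j' : ℕ) (_hij : i < j) (hj : j < m) (_hj' : j' + 1 = j + p)
    (hi : i < m) (hi' : i < mn) (hj'' : j' < mp)
    (x : obj m d) (y : obj n e) (z : obj p f),
    comp h₂ g₂ i hi' (comp h₁ g₁ j hj x y) z =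
      sgn k (e * f) • comp h₄ g₄ j' hj'' (comp h₃ g₃ i hi x z) y
  diff : ∀ (n : ℕ) {d e : ℤ}, d + 1 = e → (obj n d →ₗ[k] obj n e)
  diff_mem_fil : ∀ {n : ℕ} {d e : ℤ} (h : d + 1 = e) {p : ℕ} {x : obj n d},
    x ∈ fil n d p → diff n h x ∈ fil n e p
  diff_diff : ∀ {n : ℕ} {d e f : ℤ} (h : d + 1 = e) (h' : e + 1 = f) (x : obj n d),
    diff n h' (diff n h x) = 0
  /-- the differential is a derivation -/
  diff_comp : ∀ {m n l : ℕ} {d e f d' e' f' : ℤ} (hl : l + 1 = m + n) (hf : d + e = f)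
    (hd' : d + 1 = d') (he' : e + 1 = e') (hf' : f + 1 = f') (h₁ : d' + e = f')
    (h₂ : d + e' = f') (i : ℕ) (hi : i < m) (x : obj m d) (y : obj n e),
    diff l hf' (comp hl hf i hi x y) =
      comp hl h₁ i hi (diff m hd' x) y + sgn k d • comp hl h₂ i hi x (diff n he' y)

attribute [instance] FDGOperad.grp FDGOperad.mod

namespace FDGOperad

variable {k : Type u} [CommRing k]

/-- Completeness: each component maps isomorphically onto the limit of its quotients by the
filtration. Injectivity says that the filtration is separated; surjectivity says that every
compatible family of classes, represented by a sequence `s`, comes from an element. -/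
def IsComplete (P : FDGOperad k) : Prop :=
  ∀ n d, (∀ x : P.obj n d, (∀ p, x ∈ P.fil n d p) → x = 0) ∧
    ∀ s : ℕ → P.obj n d, (∀ p, s (p + 1) - s p ∈ P.fil n d p) → ∃ x, ∀ p, x - s p ∈ P.fil n d p

/-- Morphisms of (filtered, complete) dg ns operads. -/
structure Hom (P Q : FDGOperad k) where
  app : ∀ n d, P.obj n d →ₗ[k] Q.obj n d
  map_fil : ∀ {n d p} {x : P.obj n d}, x ∈ P.fil n d p → app n d x ∈ Q.fil n d p
  map_one : app 1 0 P.one = Q.one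
  map_comp : ∀ {m n l : ℕ} {d e f : ℤ} (hl : l + 1 = m + n) (hf : d + e = f) (i : ℕ) (hi : i < m)
    (x : P.obj m d) (y : P.obj n e),
    app l f (P.comp hl hf i hi x y) = Q.comp hl hf i hi (app m d x) (app n e y)
  map_diff : ∀ {n : ℕ} {d e : ℤ} (h : d + 1 = e) (x : P.obj n d),
    app n e (P.diff n h x) = Q.diff n h (app n d x)

/-- Isomorphisms of (filtered, complete) dg ns operads: there is an inverse morphism. -/
def Hom.IsIso {P Q : FDGOperad k} (φ : Hom P Q) : Prop :=
  ∃ ψ : Hom Q P, (∀ n d x, ψ.app n d (φ.app n d x) = x) ∧ ∀ n d y, φ.app n d (ψ.app n d y) = y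

/-- A morphism which is bijective and whose inverse is continuous for the filtration topologies,
that is, an isomorphism of the underlying topological dg ns operads. -/
def Hom.IsTopIso {P Q : FDGOperad k} (φ : Hom P Q) : Prop :=
  ∀ n d, Function.Bijective (φ.app n d) ∧
    ∀ p, ∃ q, ∀ x : P.obj n d, φ.app n d x ∈ Q.fil n d q → x ∈ P.fil n d p

theorem diff_one (P : FDGOperad k) {e : ℤ} (h : (0 : ℤ) + 1 = e) : P.diff 1 h P.one = 0 := by
  have h0 := P.diff_comp (l := 1) (m := 1) (n := 1) (f := 0) rfl rfl h h h
    (by omega) (by omega) 0 Nat.one_pos P.one P.one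
  rw [P.one_comp, P.comp_one] at h0
  subst h
  rw [P.one_comp] at h0
  simpa using h0

/-- The trivial filtration `F₀ = V`, `F₁ = F₂ = ⋯ = 0` of a module. -/
def disc (V : Type u) [AddCommGroup V] [Module k V] (p : ℕ) : Submodule k V :=
  if p = 0 then ⊤ else ⊥

theorem disc_antitone (V : Type u) [AddCommGroup V] [Module k V] :
    Antitone (disc (k := k) V) := by
  intro p q h
  by_cases hp : p = 0
  · simp [disc, hp]
  · rw [disc, if_neg (by omega)]
    exact bot_le

theorem disc_bilin {A B C : Type u} [AddCommGroup A] [AddCommGroup B] [AddCommGroup C] [Module k A]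
    [Module k B] [Module k C] (f : A →ₗ[k] B →ₗ[k] C) {p q : ℕ} {a : A} {b : B}
    (ha : a ∈ disc (k := k) A p) (hb : b ∈ disc (k := k) B q) : f a b ∈ disc (k := k) C (p + q) := by
  by_cases hp : p = 0
  · by_cases hq : q = 0
    · simp [disc, hp, hq]
    · rw [disc, if_neg hq, Submodule.mem_bot] at hb
      simp [hb]
  · rw [disc, if_neg hp, Submodule.mem_bot] at ha
    simp [ha]

/-! ### Suboperads, quotients, cohomology -/

/-- The suboperad carried by a family of submodules stable under the structure, with the induced
filtration. -/
def sub (P : FDGOperad k) (S : ∀ n d, Submodule k (P.obj n d)) (h_one : P.one ∈ S 1 0)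
    (h_comp : ∀ {m n l : ℕ} {d e f : ℤ} (hl : l + 1 = m + n) (hf : d + e = f) (i : ℕ) (hi : i < m)
      {x : P.obj m d} {y : P.obj n e}, x ∈ S m d → y ∈ S n e → P.comp hl hf i hi x y ∈ S l f)
    (h_diff : ∀ {n : ℕ} {d e : ℤ} (h : d + 1 = e) {x : P.obj n d}, x ∈ S n d →
      P.diff n h x ∈ S n e) : FDGOperad k where
  obj n d := S n d
  fil n d p := (P.fil n d p).comap (S n d).subtype
  fil_zero n d := by simp [P.fil_zero]
  fil_anti n d := fun p q h x hx => P.fil_anti n d h hx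
  one := ⟨P.one, h_one⟩
  comp hl hf i hi := LinearMap.mk₂ k
    (fun x y => ⟨P.comp hl hf i hi x.1 y.1, h_comp hl hf i hi x.2 y.2⟩)
    (fun _ _ _ => Subtype.ext (by simp)) (fun _ _ _ => Subtype.ext (by simp))
    (fun _ _ _ => Subtype.ext (by simp)) (fun _ _ _ => Subtype.ext (by simp))
  comp_mem_fil hl hf i hi _ _ _ _ hx hy := P.comp_mem_fil hl hf i hi hx hy
  one_comp _ _ _ := Subtype.ext (P.one_comp _ _ _)
  comp_one _ _ _ _ _ := Subtype.ext (P.comp_one _ _ _ _ _)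
  comp_seq h₁ h₂ h₃ h₄ g₁ g₂ g₃ g₄ i j hi hj hij x y z :=
    Subtype.ext (P.comp_seq h₁ h₂ h₃ h₄ g₁ g₂ g₃ g₄ i j hi hj hij x.1 y.1 z.1)
  comp_par h₁ h₂ h₃ h₄ g₁ g₂ g₃ g₄ i j j' hij hj hj' hi hi' hj'' x y z :=
    Subtype.ext (P.comp_par h₁ h₂ h₃ h₄ g₁ g₂ g₃ g₄ i j j' hij hj hj' hi hi' hj'' x.1 y.1 z.1)
  diff n _ _ h := ((P.diff n h).comp (S n _).subtype).codRestrict _ (fun x => h_diff h x.2)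
  diff_mem_fil h _ _ hx := P.diff_mem_fil h hx
  diff_diff h h' x := Subtype.ext (P.diff_diff h h' x.1)
  diff_comp hl hf hd' he' hf' h₁ h₂ i hi x y :=
    Subtype.ext (P.diff_comp hl hf hd' he' hf' h₁ h₂ i hi x.1 y.1)

/-- A two-sided (dg) operadic ideal. -/
structure IsIdeal (P : FDGOperad k) (I : ∀ n d, Submodule k (P.obj n d)) : Prop where
  comp_left : ∀ {m n l : ℕ} {d e f : ℤ} (hl : l + 1 = m + n) (hf : d + e = f) (i : ℕ) (hi : i < m)
    {x : P.obj m d} (y : P.obj n e), x ∈ I m d → P.comp hl hf i hi x y ∈ I l f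
  comp_right : ∀ {m n l : ℕ} {d e f : ℤ} (hl : l + 1 = m + n) (hf : d + e = f) (i : ℕ) (hi : i < m)
    (x : P.obj m d) {y : P.obj n e}, y ∈ I n e → P.comp hl hf i hi x y ∈ I l f
  diff_mem : ∀ {n : ℕ} {d e : ℤ} (h : d + 1 = e) {x : P.obj n d}, x ∈ I n d → P.diff n h x ∈ I n e

/-- The bilinear map induced on quotients. -/
def quotBilin {A B C : Type u} [AddCommGroup A] [AddCommGroup B] [AddCommGroup C] [Module k A]
    [Module k B] [Module k C] (f : A →ₗ[k] B →ₗ[k] C) (p : Submodule k A) (q : Submodule k B)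
    (r : Submodule k C) (hp : ∀ a ∈ p, ∀ b, f a b ∈ r) (hq : ∀ a, ∀ b ∈ q, f a b ∈ r) :
    (A ⧸ p) →ₗ[k] (B ⧸ q) →ₗ[k] (C ⧸ r) :=
  p.liftQ
    { toFun := fun a => q.mapQ r (f a) (fun b hb => hq a b hb)
      map_add' := fun a a' => by
        apply Submodule.linearMap_qext
        ext b
        simp
      map_smul' := fun c a => by
        apply Submodule.linearMap_qext
        ext b
        simp }
    (fun a ha => by
      rw [LinearMap.mem_ker]
      apply Submodule.linearMap_qext
      ext b
      simpa using hp a ha b)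

/-- The quotient by an ideal, with the quotient filtration. -/
def quot (P : FDGOperad k) (I : ∀ n d, Submodule k (P.obj n d)) (hI : P.IsIdeal I) :
    FDGOperad k where
  obj n d := P.obj n d ⧸ I n d
  fil n d p := (P.fil n d p).map (I n d).mkQ
  fil_zero n d := by simp [P.fil_zero]
  fil_anti n d := fun p q h => Submodule.map_mono (P.fil_anti n d h)
  one := Submodule.Quotient.mk P.one
  comp hl hf i hi := quotBilin (P.comp hl hf i hi) _ _ _
    (fun _ ha b => hI.comp_left hl hf i hi b ha) (fun a _ hb => hI.comp_right hl hf i hi a hb)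
  comp_mem_fil := by
    rintro m n l d e f hl hf i hi p q _ _ ⟨x, hx, rfl⟩ ⟨y, hy, rfl⟩
    exact ⟨_, P.comp_mem_fil hl hf i hi hx hy, rfl⟩
  one_comp := by
    intro n d hl hf x
    obtain ⟨x, rfl⟩ := Submodule.Quotient.mk_surjective _ x
    exact congrArg _ (P.one_comp hl hf x)
  comp_one := by
    intro n d hl hf i hi x
    obtain ⟨x, rfl⟩ := Submodule.Quotient.mk_surjective _ x
    exact congrArg _ (P.comp_one hl hf i hi x)
  comp_seq := by
    intro m n p mn np l d e f de ef g h₁ h₂ h₃ h₄ g₁ g₂ g₃ g₄ i j hi hj hij x y z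
    obtain ⟨x, rfl⟩ := Submodule.Quotient.mk_surjective _ x
    obtain ⟨y, rfl⟩ := Submodule.Quotient.mk_surjective _ y
    obtain ⟨z, rfl⟩ := Submodule.Quotient.mk_surjective _ z
    exact congrArg _ (P.comp_seq h₁ h₂ h₃ h₄ g₁ g₂ g₃ g₄ i j hi hj hij x y z)
  comp_par := by
    intro m n p mn mp l d e f de df g h₁ h₂ h₃ h₄ g₁ g₂ g₃ g₄ i j j' hij hj hj' hi hi' hj'' x y z
    obtain ⟨x, rfl⟩ := Submodule.Quotient.mk_surjective _ x
    obtain ⟨y, rfl⟩ := Submodule.Quotient.mk_surjective _ y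
    obtain ⟨z, rfl⟩ := Submodule.Quotient.mk_surjective _ z
    exact congrArg _ (P.comp_par h₁ h₂ h₃ h₄ g₁ g₂ g₃ g₄ i j j' hij hj hj' hi hi' hj'' x y z)
  diff n _ _ h := (I n _).mapQ (I n _) (P.diff n h) (fun _ hx => hI.diff_mem h hx)
  diff_mem_fil := by
    rintro n d e h p _ ⟨x, hx, rfl⟩
    exact ⟨_, P.diff_mem_fil h hx, rfl⟩
  diff_diff := by
    intro n d e f h h' x
    obtain ⟨x, rfl⟩ := Submodule.Quotient.mk_surjective _ x
    exact congrArg _ (P.diff_diff h h' x)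
  diff_comp := by
    intro m n l d e f d' e' f' hl hf hd' he' hf' h₁ h₂ i hi x y
    obtain ⟨x, rfl⟩ := Submodule.Quotient.mk_surjective _ x
    obtain ⟨y, rfl⟩ := Submodule.Quotient.mk_surjective _ y
    exact congrArg _ (P.diff_comp hl hf hd' he' hf' h₁ h₂ i hi x y)

/-- A family of submodules is closed for the filtration topology. -/
def IsClosedFamily (P : FDGOperad k) (I : ∀ n d, Submodule k (P.obj n d)) : Prop :=
  ∀ n d (x : P.obj n d), (∀ p, ∃ y ∈ I n d, x - y ∈ P.fil n d p) → x ∈ I n d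

/-- The smallest closed ideal containing the elements `R n d ⊆ P.obj n d`. -/
def closedIdeal (P : FDGOperad k) (R : ∀ n d, Set (P.obj n d)) (n : ℕ) (d : ℤ) :
    Submodule k (P.obj n d) :=
  ⨅ (I : ∀ n d, Submodule k (P.obj n d)) (_ : P.IsIdeal I ∧ P.IsClosedFamily I ∧
    ∀ n d, R n d ⊆ I n d), I n d

theorem mem_closedIdeal {P : FDGOperad k} {R : ∀ n d, Set (P.obj n d)} {n : ℕ} {d : ℤ}
    {x : P.obj n d} : x ∈ P.closedIdeal R n d ↔ ∀ I : ∀ n d, Submodule k (P.obj n d),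
      P.IsIdeal I ∧ P.IsClosedFamily I ∧ (∀ n d, R n d ⊆ I n d) → x ∈ I n d := by
  simp only [closedIdeal, Submodule.mem_iInf]

theorem isIdeal_closedIdeal (P : FDGOperad k) (R : ∀ n d, Set (P.obj n d)) :
    P.IsIdeal (P.closedIdeal R) where
  comp_left hl hf i hi _ y hx := mem_closedIdeal.2 fun I hI =>
    hI.1.comp_left hl hf i hi y (mem_closedIdeal.1 hx I hI)
  comp_right hl hf i hi x _ hy := mem_closedIdeal.2 fun I hI =>
    hI.1.comp_right hl hf i hi x (mem_closedIdeal.1 hy I hI)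
  diff_mem h _ hx := mem_closedIdeal.2 fun I hI => hI.1.diff_mem h (mem_closedIdeal.1 hx I hI)

/-- The quotient of a complete operad by relations `R`: the quotient by the smallest closed ideal
that contains them. -/
def presented (P : FDGOperad k) (R : ∀ n d, Set (P.obj n d)) : FDGOperad k :=
  P.quot (P.closedIdeal R) (P.isIdeal_closedIdeal R)

/-- The class of an element in `P.presented R`. -/
def presented.mk (P : FDGOperad k) (R : ∀ n d, Set (P.obj n d)) {n : ℕ} {d : ℤ} (x : P.obj n d) :
    (P.presented R).obj n d :=
  Submodule.Quotient.mk x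

/-- The suboperad of cocycles. -/
def cycles (P : FDGOperad k) : FDGOperad k :=
  P.sub (fun n _ => LinearMap.ker (P.diff n rfl)) (P.diff_one rfl)
    (fun hl hf i hi x y hx hy => by
      subst hf
      rw [LinearMap.mem_ker] at hx hy ⊢
      rw [P.diff_comp hl rfl rfl rfl rfl (by omega) (by omega) i hi, hx, hy]
      simp)
    (fun h x hx => by
      subst h
      exact P.diff_diff _ _ _)

/-- The coboundaries, inside the cocycles. -/
def boundaries (P : FDGOperad k) (n : ℕ) (d : ℤ) : Submodule k (P.cycles.obj n d) :=
  (LinearMap.range (P.diff n (sub_add_cancel d 1))).comap (LinearMap.ker (P.diff n rfl)).subtype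

theorem mem_boundaries {P : FDGOperad k} {n : ℕ} {d : ℤ} {x : P.cycles.obj n d} :
    x ∈ P.boundaries n d ↔ ∃ y, P.diff n (sub_add_cancel d 1) y = x.1 := Iff.rfl

theorem mem_boundaries_of {P : FDGOperad k} {n : ℕ} {d e : ℤ} (h : e + 1 = d)
    {x : P.cycles.obj n d} (y : P.obj n e) (hy : P.diff n h y = x.1) : x ∈ P.boundaries n d := by
  obtain rfl : e = d - 1 := by omega
  exact ⟨y, hy⟩

theorem isIdeal_boundaries (P : FDGOperad k) : P.cycles.IsIdeal P.boundaries where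
  comp_left := by
    rintro m n l d e f hl hf i hi x y ⟨z, hz⟩
    refine mem_boundaries_of (e := d - 1 + e) (by omega) (P.comp hl rfl i hi z y.1) ?_
    have hy : P.diff n rfl y.1 = 0 := y.2
    rw [P.diff_comp hl rfl (sub_add_cancel d 1) rfl (by omega) hf (by omega) i hi, hy, hz]
    simp only [map_zero, smul_zero, add_zero]
    rfl
  comp_right := by
    rintro m n l d e f hl hf i hi x y ⟨z, hz⟩
    refine mem_boundaries_of (e := d + (e - 1)) (by omega)
      (sgn k d • P.comp hl rfl i hi x.1 z) ?_
    have hx : P.diff m rfl x.1 = 0 := x.2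
    rw [map_smul, P.diff_comp hl rfl rfl (sub_add_cancel e 1) (by omega) (by omega) hf i hi, hx, hz]
    simp only [map_zero, LinearMap.zero_apply, zero_add, smul_smul, sgn_mul_self, one_smul]
    rfl
  diff_mem := by
    rintro n d e h x ⟨z, hz⟩
    refine mem_boundaries_of h 0 ?_
    subst h
    have hx : P.diff n rfl x.1 = 0 := x.2
    rw [map_zero]
    exact hx.symm

/-- The cohomology operad: cocycles modulo coboundaries, with the filtration induced on this
subquotient. (Its differential is zero.) -/
def cohomology (P : FDGOperad k) : FDGOperad k :=
  P.cycles.quot P.boundaries P.isIdeal_boundaries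

/-- The cohomology class of a cocycle. -/
def cls (P : FDGOperad k) {n : ℕ} {d : ℤ} (x : P.obj n d) (hx : P.diff n rfl x = 0) :
    P.cohomology.obj n d :=
  Submodule.Quotient.mk (p := P.boundaries n d) ⟨x, hx⟩

/-! ### Twisting -/

/-- The operad with differential `d + δ`, for a derivation `δ` such that `(d + δ)² = 0`. -/
def perturb (P : FDGOperad k) (δ : ∀ (n : ℕ) {d e : ℤ}, d + 1 = e → (P.obj n d →ₗ[k] P.obj n e))
    (h_fil : ∀ {n : ℕ} {d e : ℤ} (h : d + 1 = e) {p : ℕ} {x : P.obj n d},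
      x ∈ P.fil n d p → δ n h x ∈ P.fil n e p)
    (h_sq : ∀ {n : ℕ} {d e f : ℤ} (h : d + 1 = e) (h' : e + 1 = f) (x : P.obj n d),
      P.diff n h' (δ n h x) + δ n h' (P.diff n h x) + δ n h' (δ n h x) = 0)
    (h_comp : ∀ {m n l : ℕ} {d e f d' e' f' : ℤ} (hl : l + 1 = m + n) (hf : d + e = f)
      (hd' : d + 1 = d') (he' : e + 1 = e') (hf' : f + 1 = f') (h₁ : d' + e = f')
      (h₂ : d + e' = f') (i : ℕ) (hi : i < m) (x : P.obj m d) (y : P.obj n e),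
      δ l hf' (P.comp hl hf i hi x y) =
        P.comp hl h₁ i hi (δ m hd' x) y + sgn k d • P.comp hl h₂ i hi x (δ n he' y)) :
    FDGOperad k where
  obj := P.obj
  fil := P.fil
  fil_zero := P.fil_zero
  fil_anti := P.fil_anti
  one := P.one
  comp := P.comp
  comp_mem_fil := P.comp_mem_fil
  one_comp := P.one_comp
  comp_one := P.comp_one
  comp_seq := P.comp_seq
  comp_par := P.comp_par
  diff n _ _ h := P.diff n h + δ n h
  diff_mem_fil h _ _ hx := Submodule.add_mem _ (P.diff_mem_fil h hx) (h_fil h hx)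
  diff_diff h h' x := by
    simp only [LinearMap.add_apply, map_add, P.diff_diff]
    refine Eq.trans ?_ (h_sq h h' x)
    abel
  diff_comp hl hf hd' he' hf' h₁ h₂ i hi x y := by
    simp only [LinearMap.add_apply, map_add, P.diff_comp hl hf hd' he' hf' h₁ h₂ i hi,
      h_comp hl hf hd' he' hf' h₁ h₂ i hi, smul_add]
    abel

/-- The operator `ad_μ(x) = μ ⋆ x - (-1)^|x| x ⋆ μ`, where `x ⋆ y = ∑ᵢ x ∘ᵢ y`, for an element `μ`
of arity `1` and degree `1`. -/
def ad (P : FDGOperad k) (μ : P.obj 1 1) (n : ℕ) {d e : ℤ} (h : d + 1 = e) :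
    P.obj n d →ₗ[k] P.obj n e :=
  P.comp (add_comm n 1) (by omega) 0 Nat.one_pos μ -
    sgn k d • ∑ i : Fin n, (P.comp rfl h i.1 i.2).flip μ

/-- Partial composition extended by zero to all positions. -/
def compz (P : FDGOperad k) {m n l : ℕ} {d e f : ℤ} (hl : l + 1 = m + n) (hf : d + e = f) (i : ℕ)
    (x : P.obj m d) (y : P.obj n e) : P.obj l f :=
  if hi : i < m then P.comp hl hf i hi x y else 0

theorem compz_pos (P : FDGOperad k) {m n l : ℕ} {d e f : ℤ} (hl : l + 1 = m + n) (hf : d + e = f)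
    (i : ℕ) (hi : i < m) (x : P.obj m d) (y : P.obj n e) :
    P.compz hl hf i x y = P.comp hl hf i hi x y := dif_pos hi

theorem ad_apply (P : FDGOperad k) (μ : P.obj 1 1) (n : ℕ) {d e : ℤ} (h : d + 1 = e)
    (x : P.obj n d) : P.ad μ n h x = P.comp (add_comm n 1) (by omega) 0 Nat.one_pos μ x -
      sgn k d • ∑ i ∈ Finset.range n, P.compz (l := n) rfl h i x μ := by
  have : ∑ i : Fin n, P.comp (l := n) rfl h i.1 i.2 x μ =
      ∑ i ∈ Finset.range n, P.compz (l := n) rfl h i x μ := by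
    rw [← Fin.sum_univ_eq_sum_range (fun i => P.compz (l := n) rfl h i x μ)]
    exact Finset.sum_congr rfl fun i _ => (P.compz_pos _ _ _ i.2 _ _).symm
  simp [ad, LinearMap.sum_apply, this]

theorem sum_range_three {M : Type u} [AddCommGroup M] {l m n i : ℕ} (hl : l + 1 = m + n)
    (hi : i < m) (G : ℕ → M) :
    ∑ j ∈ Finset.range l, G j = ∑ j ∈ Finset.range i, G j + ∑ j ∈ Finset.range n, G (i + j) +
      ∑ j ∈ Finset.range (m - 1 - i), G (i + n + j) := by
  obtain rfl : l = i + n + (m - 1 - i) := by omega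
  rw [Finset.sum_range_add, Finset.sum_range_add]

theorem ad_comp (P : FDGOperad k) (μ : P.obj 1 1) {m n l : ℕ} {d e f d' e' f' : ℤ}
    (hl : l + 1 = m + n) (hf : d + e = f) (hd' : d + 1 = d') (he' : e + 1 = e') (hf' : f + 1 = f')
    (h₁ : d' + e = f') (h₂ : d + e' = f') (i : ℕ) (hi : i < m) (x : P.obj m d) (y : P.obj n e) :
    P.ad μ l hf' (P.comp hl hf i hi x y) =
      P.comp hl h₁ i hi (P.ad μ m hd' x) y + sgn k d • P.comp hl h₂ i hi x (P.ad μ n he' y) := by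
  simp only [ad_apply, map_sub, map_smul, LinearMap.sub_apply, LinearMap.smul_apply, map_sum,
    LinearMap.sum_apply]
  have e1 : P.comp (add_comm l 1) (by omega) 0 Nat.one_pos μ (P.comp hl hf i hi x y) =
      P.comp hl h₁ i hi (P.comp (add_comm m 1) (by omega) 0 Nat.one_pos μ x) y := by
    have := P.comp_seq (mn := m) (l := l) (de := d') (g := f') (ef := f) (add_comm m 1) hl hl
      (add_comm l 1) (by omega) h₁ hf (by omega) 0 i Nat.one_pos hi (by omega) μ x y
    rw [← this]
    congr 2; simp
  have hm : ∀ H : ℕ → P.obj l f', ∑ j ∈ Finset.range m, H j = ∑ j ∈ Finset.range i, H j + H i +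
      ∑ j ∈ Finset.range (m - 1 - i), H (i + 1 + j) := fun H => by
    rw [sum_range_three (m := m) (n := 1) rfl hi, Finset.sum_range_one, add_zero]
  have e2 : ∑ j ∈ Finset.range m, P.comp hl h₁ i hi (P.compz (l := m) rfl hd' j x μ) y =
      ∑ j ∈ Finset.range i, P.comp hl h₁ i hi (P.compz (l := m) rfl hd' j x μ) y +
      P.comp hl h₁ i hi (P.compz (l := m) rfl hd' i x μ) y +
      ∑ j ∈ Finset.range (m - 1 - i),
        P.comp hl h₁ i hi (P.compz (l := m) rfl hd' (i + 1 + j) x μ) y := hm _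
  have e3 : ∀ j ∈ Finset.range i, P.compz (l := l) rfl hf' j (P.comp hl hf i hi x y) μ =
      sgn k e • P.comp hl h₁ i hi (P.compz (l := m) rfl hd' j x μ) y := by
    intro j hj
    have hj := Finset.mem_range.1 hj
    rw [compz_pos (hi := by omega), compz_pos (hi := by omega)]
    have := P.comp_par (mn := l) (l := l) (mp := m) (de := f) (g := f') (df := d') hl rfl rfl hl
      hf hf' hd' h₁ j i i hj hi rfl (by omega) (by omega) hi x y μ
    rw [this, mul_one]
  have e4 : ∀ j ∈ Finset.range n, P.compz (l := l) rfl hf' (i + j) (P.comp hl hf i hi x y) μ =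
      P.comp hl h₂ i hi x (P.compz (l := n) rfl he' j y μ) := by
    intro j hj
    have hj := Finset.mem_range.1 hj
    rw [compz_pos (hi := by omega), compz_pos (hi := by omega)]
    exact P.comp_seq hl rfl rfl hl hf hf' he' h₂ i j hi hj (by omega) x y μ
  have e5 : ∀ j ∈ Finset.range (m - 1 - i),
      P.compz (l := l) rfl hf' (i + n + j) (P.comp hl hf i hi x y) μ =
      sgn k e • P.comp hl h₁ i hi (P.compz (l := m) rfl hd' (i + 1 + j) x μ) y := by
    intro j hj
    have hj := Finset.mem_range.1 hj
    rw [compz_pos (hi := by omega), compz_pos (hi := by omega)]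
    have := P.comp_par (mn := m) (l := l) (mp := l) (de := d') (g := f') (df := f) rfl hl hl rfl
      hd' h₁ hf hf' i (i + 1 + j) (i + n + j) (by omega) (by omega) (by omega) (by omega)
      (by omega) (by omega) x μ y
    rw [this, one_mul, smul_smul, sgn_mul_self, one_smul]
  have e6 : P.comp hl h₁ i hi (P.compz (l := m) rfl hd' i x μ) y =
      P.comp hl h₂ i hi x (P.comp (add_comm n 1) (by omega) 0 Nat.one_pos μ y) := by
    rw [compz_pos (hi := hi)]
    exact P.comp_seq (l := l) rfl hl (add_comm n 1) hl hd' h₁ (by omega) h₂ i 0 hi Nat.one_pos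
      (by omega) x μ y
  have hfs : sgn k f = sgn k d * sgn k e := by rw [← hf, sgn_add]
  rw [sum_range_three hl hi, Finset.sum_congr rfl e3, Finset.sum_congr rfl e4,
    Finset.sum_congr rfl e5, e1, e2, e6, ← Finset.smul_sum, ← Finset.smul_sum, hfs]
  have hs : sgn k e * sgn k e = 1 := sgn_mul_self e
  set A := ∑ j ∈ Finset.range i, P.comp hl h₁ i hi (P.compz (l := m) rfl hd' j x μ) y
  set B := ∑ j ∈ Finset.range (m - 1 - i),
        P.comp hl h₁ i hi (P.compz (l := m) rfl hd' (i + 1 + j) x μ) y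
  have : ∀ v : P.obj l f', (sgn k d * sgn k e) • sgn k e • v = sgn k d • v := fun v => by
    rw [smul_smul, mul_assoc, hs, mul_one]
  simp only [smul_add, smul_sub, this, smul_smul]
  abel

theorem sum_sum_antisymm {M : Type u} [AddCommGroup M] {n : ℕ} (T : ℕ → ℕ → M)
    (hT : ∀ i j, i < j → j < n → T i j = - T j i) :
    ∑ i ∈ Finset.range n, ∑ j ∈ Finset.range n, T i j = ∑ i ∈ Finset.range n, T i i := by
  have h1 : ∀ i ∈ Finset.range n, ∀ j ∈ Finset.range n, T i j =
      (if i < j then T i j else 0) + (if j < i then T i j else 0) + if i = j then T i i else 0 := by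
    intro i _ j _
    rcases lt_trichotomy i j with h | h | h
    · simp [h, h.not_gt, h.ne]
    · simp [h]
    · simp [h, h.not_gt, h.ne']
  rw [Finset.sum_congr rfl fun i hi => Finset.sum_congr rfl (h1 i hi)]
  simp only [Finset.sum_add_distrib]
  rw [Finset.sum_comm (f := fun i j => if j < i then T i j else 0), ← Finset.sum_add_distrib]
  have h2 : ∑ i ∈ Finset.range n, ((∑ j ∈ Finset.range n, if i < j then T i j else 0) +
      ∑ j ∈ Finset.range n, if i < j then T j i else 0) = 0 := by
    refine Finset.sum_eq_zero fun i _ => ?_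
    rw [← Finset.sum_add_distrib]
    refine Finset.sum_eq_zero fun j hj => ?_
    by_cases h : i < j
    · simp [h, hT i j h (Finset.mem_range.1 hj)]
    · simp [h]
  rw [h2, zero_add]
  refine Finset.sum_congr rfl fun i hi => ?_
  rw [Finset.sum_ite_eq, if_pos hi]

theorem ad_sq (P : FDGOperad k) (μ : P.obj 1 1)
    (hμ : P.diff 1 one_add_one_eq_two μ +
      P.comp rfl one_add_one_eq_two 0 Nat.one_pos μ μ = 0)
    {n : ℕ} {d e f : ℤ} (h : d + 1 = e) (h' : e + 1 = f) (x : P.obj n d) :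
    P.diff n h' (P.ad μ n h x) + P.ad μ n h' (P.diff n h x) + P.ad μ n h' (P.ad μ n h x) = 0 := by
  have hse : sgn k e = - sgn k d := by rw [← h, sgn_add]; simp
  have hsd : ∀ v : P.obj n f, sgn k d • sgn k d • v = v := fun v => by
    rw [smul_smul, sgn_mul_self, one_smul]
  have a1 : P.diff n h' (P.comp (l := n) (add_comm n 1) (by omega) 0 Nat.one_pos μ x) =
      P.comp (add_comm n 1) (by omega) 0 Nat.one_pos (P.diff 1 one_add_one_eq_two μ) x
      - P.comp (add_comm n 1) (by omega) 0 Nat.one_pos μ (P.diff n h x) := by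
    rw [P.diff_comp _ _ one_add_one_eq_two h h' (by omega) (by omega)]
    simp [sub_eq_add_neg]
  have a2 : ∀ i ∈ Finset.range n, P.diff n h' (P.compz (l := n) rfl h i x μ) =
      P.compz (l := n) rfl h' i (P.diff n h x) μ +
        sgn k d • P.compz (l := n) rfl (by omega) i x (P.diff 1 one_add_one_eq_two μ) := by
    intro i hi
    have hi := Finset.mem_range.1 hi
    simp only [compz_pos _ _ _ _ hi]
    rw [P.diff_comp _ _ h one_add_one_eq_two h' h' (by omega)]
  have a3 : P.comp (l := n) (add_comm n 1) (by omega : 1 + e = f) 0 Nat.one_pos μ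
        (P.comp (l := n) (add_comm n 1) (by omega : 1 + d = e) 0 Nat.one_pos μ x) =
      P.comp (add_comm n 1) (by omega) 0 Nat.one_pos
        (P.comp rfl one_add_one_eq_two 0 Nat.one_pos μ μ) x :=
    (P.comp_seq (mn := 1) rfl (add_comm n 1) (add_comm n 1) (add_comm n 1) one_add_one_eq_two
      (by omega) (by omega) (by omega) 0 0 Nat.one_pos Nat.one_pos Nat.one_pos μ μ x).symm
  have a4 : ∀ i ∈ Finset.range n, P.comp (l := n) (add_comm n 1) (by omega : 1 + e = f) 0
        Nat.one_pos μ (P.compz (l := n) rfl h i x μ) =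
      P.compz (l := n) rfl h' i
        (P.comp (l := n) (add_comm n 1) (by omega : 1 + d = e) 0 Nat.one_pos μ x) μ := by
    intro i hi
    have hi := Finset.mem_range.1 hi
    simp only [compz_pos _ _ _ _ hi]
    rw [← P.comp_seq (mn := n) (l := n) (de := e) (g := f) (ef := e) (add_comm n 1) rfl rfl
      (add_comm n 1) (by omega) h' h (by omega) 0 i Nat.one_pos hi (by omega) μ x μ]
    congr 2; simp
  have a5 : ∑ j ∈ Finset.range n, ∑ i ∈ Finset.range n,
        P.compz (l := n) rfl h' i (P.compz (l := n) rfl h j x μ) μ =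
      ∑ i ∈ Finset.range n, P.compz (l := n) rfl (by omega) i x
        (P.comp rfl one_add_one_eq_two 0 Nat.one_pos μ μ) := by
    rw [Finset.sum_comm, sum_sum_antisymm]
    · refine Finset.sum_congr rfl fun i hi => ?_
      have hi := Finset.mem_range.1 hi
      simp only [compz_pos _ _ _ _ hi]
      exact P.comp_seq (l := n) rfl rfl rfl rfl h h' one_add_one_eq_two (by omega) i 0 hi
        Nat.one_pos (by omega) x μ μ
    · intro i j hij hj
      simp only [compz_pos _ _ _ _ hj, compz_pos _ _ _ _ (hij.trans hj)]
      rw [P.comp_par (mn := n) (l := n) (mp := n) (de := e) (g := f) (df := e) rfl rfl rfl rfl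
        h h' h h' i j j hij hj rfl (by omega) (by omega) (by omega) x μ μ]
      simp
  have a6 : ∀ i ∈ Finset.range n, P.compz (l := n) rfl (by omega : d + 2 = f) i x
        (P.comp rfl one_add_one_eq_two 0 Nat.one_pos μ μ) =
      - P.compz (l := n) rfl (by omega) i x (P.diff 1 one_add_one_eq_two μ) := by
    intro i hi
    have hi := Finset.mem_range.1 hi
    simp only [compz_pos _ _ _ _ hi]
    rw [eq_neg_of_add_eq_zero_right hμ, map_neg]
  have a7 : P.comp (l := n) (add_comm n 1) (by omega : 2 + d = f) 0 Nat.one_pos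
        (P.comp rfl one_add_one_eq_two 0 Nat.one_pos μ μ) x =
      - P.comp (l := n) (add_comm n 1) (by omega) 0 Nat.one_pos
        (P.diff 1 one_add_one_eq_two μ) x := by
    rw [eq_neg_of_add_eq_zero_right hμ, map_neg, LinearMap.neg_apply]
  simp only [ad_apply, map_sub, map_smul, map_sum, Finset.sum_sub_distrib,
    ← Finset.smul_sum, a1, a3]
  rw [a5, Finset.sum_congr rfl a2, Finset.sum_congr rfl a4, Finset.sum_congr rfl a6, a7, hse]
  simp only [Finset.sum_add_distrib, ← Finset.smul_sum, smul_add, smul_sub, neg_smul, hsd,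
    Finset.sum_neg_distrib, smul_neg]
  abel

theorem ad_mem_fil (P : FDGOperad k) (μ : P.obj 1 1) {n : ℕ} {d e : ℤ} (h : d + 1 = e) {p : ℕ}
    {x : P.obj n d} (hx : x ∈ P.fil n d p) : P.ad μ n h x ∈ P.fil n e p := by
  have hμ : μ ∈ P.fil 1 1 0 := by rw [P.fil_zero]; trivial
  rw [ad_apply]
  refine Submodule.sub_mem _ ?_ (Submodule.smul_mem _ _ (Submodule.sum_mem _ fun i hi => ?_))
  · simpa using P.comp_mem_fil (add_comm n 1) (by omega) 0 Nat.one_pos hμ hx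
  · rw [compz_pos _ _ _ _ (Finset.mem_range.1 hi)]
    exact P.comp_mem_fil rfl h i _ hx hμ

/-- The operad twisted by an operadic Maurer–Cartan element `μ`, an element of arity `1` and
degree `1` with `dμ + μ ∘₁ μ = 0`: the differential becomes `d + ad_μ`. -/
def twist (P : FDGOperad k) (μ : P.obj 1 1)
    (hμ : P.diff 1 one_add_one_eq_two μ +
      P.comp rfl one_add_one_eq_two 0 Nat.one_pos μ μ = 0) : FDGOperad k :=
  P.perturb (P.ad μ) (P.ad_mem_fil μ) (P.ad_sq μ hμ) (P.ad_comp μ)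

/-! ### Adjoining an arity zero generator -/

section adjoin

/-- The factorisations `u = x ++ y ++ z` with `i` letters `true` in `x` and `n` in `y`. -/
def cuts (u : List Bool) (i n : ℕ) : Finset (List Bool × List Bool × List Bool) :=
  ((Finset.range (u.length + 1) ×ˢ Finset.range (u.length + 1)).image fun ab =>
    (u.take ab.1, (u.drop ab.1).take ab.2, (u.drop ab.1).drop ab.2)).filter
      fun t => t.1.count true = i ∧ t.2.1.count true = n

theorem mem_cuts {u : List Bool} {i n : ℕ} {t : List Bool × List Bool × List Bool} :
    t ∈ cuts u i n ↔ t.1 ++ (t.2.1 ++ t.2.2) = u ∧ t.1.count true = i ∧ t.2.1.count true = n := by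
  obtain ⟨x, y, z⟩ := t
  simp only [cuts, Finset.mem_filter, Finset.mem_image, Finset.mem_product, Finset.mem_range,
    Prod.mk.injEq, Prod.exists]
  refine and_congr_left fun _ => ⟨?_, ?_⟩
  · rintro ⟨a, b, _, rfl, rfl, rfl⟩
    simp
  · rintro rfl
    refine ⟨x.length, y.length, ⟨?_, ?_⟩, ?_, ?_, ?_⟩ <;> simp; omega

/-- The factorisations `u = x ++ [false, false] ++ z`. -/
def bcuts (u : List Bool) : Finset (List Bool × List Bool) :=
  ((Finset.range (u.length + 1)).image fun a => (u.take a, u.drop (a + 2))).filter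
    fun t => t.1 ++ false :: false :: t.2 = u

theorem mem_bcuts {u : List Bool} {t : List Bool × List Bool} :
    t ∈ bcuts u ↔ t.1 ++ false :: false :: t.2 = u := by
  obtain ⟨x, z⟩ := t
  simp only [bcuts, Finset.mem_filter, Finset.mem_image, Finset.mem_range, Prod.mk.injEq,
    and_iff_right_iff_imp]
  rintro rfl
  exact ⟨x.length, by simp, by simp, by simp⟩

variable (P : FDGOperad k)

/-- Elements of arity `n` and degree `d` of the operad obtained from `P` by freely adjoining a
generator `α` of arity `0` and degree `0`: families indexed by the words `v` with `n` letters `true`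
(and any number of letters `false`) of operations of `P` of arity the length of `v`. Such a family
stands for the series over all `v` of the operations `f v` where `α` is plugged at the inputs marked
by `false`, the inputs marked by `true` being left free. -/
abbrev AdjObj (n : ℕ) (d : ℤ) : Type u :=
  ∀ v : {v : List Bool // v.count true = n}, P.obj v.1.length d

variable {P}

theorem adj_aux {m n l i : ℕ} (hl : l + 1 = m + n) {u : List Bool} (hu : u.count true = l)
    {t : List Bool × List Bool × List Bool} (ht : t ∈ cuts u i n) :
    u.length + 1 = (t.1 ++ true :: t.2.2).length + t.2.1.length ∧
      t.1.length < (t.1 ++ true :: t.2.2).length ∧ (t.1 ++ true :: t.2.2).count true = m ∧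
      u.count false = (t.1 ++ true :: t.2.2).count false + t.2.1.count false := by
  obtain ⟨rfl, h1, h2⟩ := mem_cuts.1 ht
  simp at hu ⊢
  omega

/-- Partial composition: the `i`-th free input of `f` is replaced by `g`. -/
def adjComp {m n l : ℕ} {d e c : ℤ} (hl : l + 1 = m + n) (hc : d + e = c) (i : ℕ) :
    AdjObj P m d →ₗ[k] AdjObj P n e →ₗ[k] AdjObj P l c :=
  LinearMap.mk₂ k
    (fun f g u => ∑ t ∈ (cuts u.1 i n).attach,
      P.comp (adj_aux hl u.2 t.2).1 hc t.1.1.length (adj_aux hl u.2 t.2).2.1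
        (f ⟨t.1.1 ++ true :: t.1.2.2, (adj_aux hl u.2 t.2).2.2.1⟩)
        (g ⟨t.1.2.1, (mem_cuts.1 t.2).2.2⟩))
    (fun f f' g => by ext u; simp [Finset.sum_add_distrib])
    (fun a f g => by ext u; simp [Finset.smul_sum])
    (fun f g g' => by ext u; simp [Finset.sum_add_distrib])
    (fun a f g => by ext u; simp [Finset.smul_sum])

theorem adjComp_apply {m n l : ℕ} {d e c : ℤ} (hl : l + 1 = m + n) (hc : d + e = c) (i : ℕ)
    (f : AdjObj P m d) (g : AdjObj P n e) (u) :
    adjComp hl hc i f g u = ∑ t ∈ (cuts u.1 i n).attach,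
      P.comp (adj_aux hl u.2 t.2).1 hc t.1.1.length (adj_aux hl u.2 t.2).2.1
        (f ⟨t.1.1 ++ true :: t.1.2.2, (adj_aux hl u.2 t.2).2.2.1⟩)
        (g ⟨t.1.2.1, (mem_cuts.1 t.2).2.2⟩) := rfl

variable (P) in
/-- The operation `x` with `α` plugged at the inputs marked by `false` in the word `w` (zero unless
`w` has as many letters as `x` has inputs, and `n` letters `true`). -/
def mono {n N : ℕ} {d : ℤ} (w : List Bool) (x : P.obj N d) : AdjObj P n d :=
  fun v => if h : v.1 = w ∧ N = v.1.length then h.2 ▸ x else 0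

theorem mono_apply_self {n N : ℕ} {d : ℤ} (v : {v : List Bool // v.count true = n})
    (h : N = v.1.length) (x : P.obj N d) : mono P v.1 x v = h ▸ x := by
  simp [mono, h]

theorem mono_apply_ne {n N : ℕ} {d : ℤ} (v : {v : List Bool // v.count true = n})
    {w : List Bool} (h : v.1 ≠ w) (x : P.obj N d) : mono P w x v = 0 := by
  simp [mono, h]

theorem mono_add {n N : ℕ} {d : ℤ} (w : List Bool) (x y : P.obj N d) :
    (mono P w (x + y) : AdjObj P n d) = mono P w x + mono P w y := by
  funext v
  by_cases h : v.1 = w ∧ N = v.1.length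
  · obtain ⟨h1, rfl⟩ := h
    simp [mono, h1]
  · simp [mono, h]

theorem mono_smul {n N : ℕ} {d : ℤ} (w : List Bool) (a : k) (x : P.obj N d) :
    (mono P w (a • x) : AdjObj P n d) = a • mono P w x := by
  funext v
  by_cases h : v.1 = w ∧ N = v.1.length
  · obtain ⟨h1, rfl⟩ := h
    simp [mono, h1]
  · simp [mono, h]

theorem mono_zero {n N : ℕ} {d : ℤ} (w : List Bool) :
    (mono P w (0 : P.obj N d) : AdjObj P n d) = 0 := by
  simpa using mono_smul (n := n) w (0 : k) (0 : P.obj N d)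

variable (P) in
/-- The families that vanish on all words of length at most `N`. -/
def tail (n : ℕ) (d : ℤ) (N : ℕ) : Set (AdjObj P n d) := {f | ∀ v, v.1.length ≤ N → f v = 0}

theorem adj_ext {n n' : ℕ} {d d' : ℤ} (E E' : AdjObj P n d →ₗ[k] AdjObj P n' d')
    (hE : ∀ N, ∃ M, ∀ f ∈ tail P n d M, E f ∈ tail P n' d' N)
    (hE' : ∀ N, ∃ M, ∀ f ∈ tail P n d M, E' f ∈ tail P n' d' N)
    (h : ∀ (w : List Bool) (_ : w.count true = n) (x : P.obj w.length d),
      E (mono P w x) = E' (mono P w x)) : E = E' := by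
  classical
  ext f u
  obtain ⟨M, hM⟩ := hE u.1.length
  obtain ⟨M', hM'⟩ := hE' u.1.length
  have hfin : {v : {v : List Bool // v.count true = n} | v.1.length ≤ max M M'}.Finite :=
    (List.finite_length_le Bool (max M M')).preimage Subtype.val_injective.injOn
  set r := f - ∑ v ∈ hfin.toFinset, mono P v.1 (f v) with hr
  have hrt : ∀ v : {v : List Bool // v.count true = n}, v.1.length ≤ max M M' → r v = 0 := by
    intro v hv
    rw [hr, Pi.sub_apply, Finset.sum_apply, Finset.sum_eq_single v]
    · rw [mono_apply_self v rfl, sub_self]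
    · intro w _ hw
      exact mono_apply_ne _ (fun h => hw (Subtype.ext h.symm)) _
    · intro h
      exact absurd (by simpa using hv) h
  have hf : f = r + ∑ v ∈ hfin.toFinset, mono P v.1 (f v) := by rw [hr]; abel
  have h1 : E r u = 0 := hM r (fun v hv => hrt v (hv.trans (le_max_left _ _))) u le_rfl
  have h2 : E' r u = 0 := hM' r (fun v hv => hrt v (hv.trans (le_max_right _ _))) u le_rfl
  rw [hf, map_add, map_add, Pi.add_apply, Pi.add_apply, h1, h2, map_sum, map_sum,
    Finset.sum_congr rfl fun v _ => h v.1 v.2 (f v)]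

theorem adjComp_tail_left {m n l : ℕ} {d e c : ℤ} (hl : l + 1 = m + n) (hc : d + e = c) (i : ℕ)
    {f : AdjObj P m d} {N : ℕ} (hf : f ∈ tail P m d (N + 1)) (g : AdjObj P n e) :
    adjComp hl hc i f g ∈ tail P l c N := by
  intro u hu
  rw [adjComp_apply]
  refine Finset.sum_eq_zero fun t _ => ?_
  have := (adj_aux hl u.2 t.2).1
  rw [hf _ (by simp only; omega)]
  simp

theorem adjComp_tail_right {m n l : ℕ} {d e c : ℤ} (hl : l + 1 = m + n) (hc : d + e = c) (i : ℕ)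
    (f : AdjObj P m d) {N : ℕ} {g : AdjObj P n e} (hg : g ∈ tail P n e N) :
    adjComp hl hc i f g ∈ tail P l c N := by
  intro u hu
  rw [adjComp_apply]
  refine Finset.sum_eq_zero fun t _ => ?_
  have := (adj_aux hl u.2 t.2).1
  simp only [List.length_append, List.length_cons] at this
  rw [hg _ (by simp only; omega)]
  simp

theorem split_unique {a c x z : List Bool} (h : x ++ true :: z = a ++ true :: c)
    (hc : x.count true = a.count true) : x = a ∧ z = c := by
  induction a generalizing x with
  | nil =>
    cases x with
    | nil => simpa using h
    | cons b x => simp at h; simp [h.1] at hc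
  | cons b a ih =>
    cases x with
    | nil => simp at h; simp [← h.1] at hc
    | cons b' x =>
      simp only [List.cons_append, List.cons.injEq] at h
      obtain ⟨rfl, h⟩ := h
      have := ih h (by simpa [List.count_cons] using hc)
      simpa using this

theorem exists_split {w : List Bool} {i : ℕ} (hi : i < w.count true) :
    ∃ a c, w = a ++ true :: c ∧ a.count true = i := by
  induction w generalizing i with
  | nil => simp at hi
  | cons b w ih =>
    cases b with
    | false =>
      obtain ⟨a, c, rfl, h⟩ := ih (by simpa using hi)
      exact ⟨false :: a, c, rfl, by simpa using h⟩
    | true =>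
      cases i with
      | zero => exact ⟨[], w, rfl, rfl⟩
      | succ i =>
        obtain ⟨a, c, rfl, h⟩ := ih (by simpa using hi)
        exact ⟨true :: a, c, rfl, by simpa using h⟩

theorem adjComp_mono {m n l : ℕ} {d e c : ℤ} (hl : l + 1 = m + n) (hc : d + e = c) {i : ℕ}
    (a b : List Bool) {v w : List Bool} (r : List Bool) {N N' L : ℕ} (hv : v = a ++ true :: b)
    (hr : r = a ++ (w ++ b)) (hL : L + 1 = N + N') (hN : N = v.length)
    (hN' : N' = w.length) (hm : v.count true = m) (hn : w.count true = n)
    (hi : a.count true = i) {A : ℕ} (hA : A = a.length) (ha : A < N)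
    (x : P.obj N d) (y : P.obj N' e) :
    adjComp hl hc i (mono P v x) (mono P w y) = mono P r (P.comp hL hc A ha x y) := by
  subst hv hr hA
  funext u
  rw [adjComp_apply]
  by_cases hu : u.1 = a ++ (w ++ b)
  · obtain ⟨u, hu'⟩ := u
    simp only at hu
    subst hu hN hN'
    have ht : (a, w, b) ∈ cuts (a ++ (w ++ b)) i n := mem_cuts.2 ⟨rfl, hi, hn⟩
    rw [Finset.sum_eq_single ⟨(a, w, b), ht⟩]
    · simp only
      have e1 := mono_apply_self (P := P) ⟨a ++ true :: b, hm⟩ rfl x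
      have e2 := mono_apply_self (P := P) ⟨w, hn⟩ rfl y
      simp only at e1 e2
      rw [e1, e2]
      obtain rfl : L = (a ++ (w ++ b)).length := by
        simp only [List.length_append, List.length_cons] at hL ⊢; omega
      exact (mono_apply_self (P := P) ⟨a ++ (w ++ b), hu'⟩ rfl _).symm
    · rintro ⟨⟨x', y', z'⟩, ht'⟩ _ hne
      by_cases h1 : x' ++ true :: z' = a ++ true :: b
      · obtain ⟨h3, h4, h5⟩ := mem_cuts.1 ht'
        obtain ⟨rfl, rfl⟩ := split_unique h1 (by simp only at h4; rw [h4, hi])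
        refine absurd ?_ hne
        simpa using h3
      · have := mono_apply_ne (P := P) ⟨x' ++ true :: z', (adj_aux hl hu' ht').2.2.1⟩ h1 x
        simp only
        rw [this]
        simp
    · intro h
      exact absurd (Finset.mem_attach _ _) h
  · rw [mono_apply_ne _ hu]
    refine Finset.sum_eq_zero fun t _ => ?_
    obtain ⟨⟨x', y', z'⟩, ht'⟩ := t
    obtain ⟨h3, h4, h5⟩ := mem_cuts.1 ht'
    by_cases h1 : x' ++ true :: z' = a ++ true :: b
    · obtain ⟨rfl, rfl⟩ := split_unique h1 (by simp only at h4; rw [h4, hi])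
      have h2 : y' ≠ w := by rintro rfl; exact hu h3.symm
      have := mono_apply_ne (P := P) ⟨y', h5⟩ h2 y
      simp only
      rw [this]
      simp
    · have := mono_apply_ne (P := P) ⟨x' ++ true :: z', (adj_aux hl u.2 ht').2.2.1⟩ h1 x
      simp only
      rw [this]
      simp

theorem adj_one_comp {n : ℕ} {d : ℤ} (hl : n + 1 = 1 + n) (hf : 0 + d = d) (x : AdjObj P n d) :
    adjComp hl hf 0 (mono P [true] P.one) x = x := by
  have := adj_ext (adjComp hl hf 0 (mono P [true] P.one)) LinearMap.id
    (fun N => ⟨N, fun f hf' => adjComp_tail_right hl hf 0 _ hf'⟩) (fun N => ⟨N, fun f hf' => hf'⟩)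
    (fun w hw x => by
      rw [adjComp_mono hl hf (i := 0) [] [] (v := [true]) w rfl (by simp) (add_comm w.length 1) rfl rfl rfl hw rfl rfl
        Nat.one_pos P.one x, LinearMap.id_apply]
      congr 1
      exact P.one_comp _ _ _)
  exact LinearMap.congr_fun this x

theorem adj_comp_one {m : ℕ} {d : ℤ} (hl : m + 1 = m + 1) (hf : d + 0 = d) (i : ℕ) (hi : i < m)
    (x : AdjObj P m d) : adjComp hl hf i x (mono P [true] P.one) = x := by
  have := adj_ext ((adjComp hl hf i).flip (mono P [true] P.one)) LinearMap.id
    (fun N => ⟨N + 1, fun f hf' => adjComp_tail_left hl hf i hf' _⟩) (fun N => ⟨N, fun f hf' => hf'⟩)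
    (fun w hw x => by
      obtain ⟨a, b, rfl, ha⟩ := exists_split (hw ▸ hi)
      rw [LinearMap.flip_apply, adjComp_mono hl hf a b (a ++ true :: b) (w := [true]) (N' := 1)
        rfl (by simp) (L := (a ++ true :: b).length) rfl rfl rfl hw rfl ha rfl (by simp) x P.one,
        LinearMap.id_apply]
      congr 1
      exact P.comp_one _ _ _ _ _)
  exact LinearMap.congr_fun this x

theorem adj_comp_seq {m n p mn np l : ℕ} {d e f de ef g : ℤ}
    (h₁ : mn + 1 = m + n) (h₂ : l + 1 = mn + p) (h₃ : np + 1 = n + p) (h₄ : l + 1 = m + np)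
    (g₁ : d + e = de) (g₂ : de + f = g) (g₃ : e + f = ef) (g₄ : d + ef = g)
    (i j : ℕ) (hi : i < m) (hj : j < n)
    (x : AdjObj P m d) (y : AdjObj P n e) (z : AdjObj P p f) :
    adjComp h₂ g₂ (i + j) (adjComp h₁ g₁ i x y) z = adjComp h₄ g₄ i x (adjComp h₃ g₃ j y z) := by
  have key : ∀ (v w u : List Bool) (hv : v.count true = m) (hw : w.count true = n)
      (hu : u.count true = p) (x : P.obj v.length d) (y : P.obj w.length e) (z : P.obj u.length f),
      adjComp h₂ g₂ (i + j) (adjComp h₁ g₁ i (mono P v x) (mono P w y)) (mono P u z) =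
        adjComp h₄ g₄ i (mono P v x) (adjComp h₃ g₃ j (mono P w y) (mono P u z)) := by
    intro v w u hv hw hu x y z
    obtain ⟨a, b, rfl, ha⟩ := exists_split (hv ▸ hi)
    obtain ⟨a', b', rfl, ha'⟩ := exists_split (hw ▸ hj)
    rw [adjComp_mono h₁ g₁ a b ((a ++ a') ++ true :: (b' ++ b)) rfl (by simp)
      (L := ((a ++ a') ++ true :: (b' ++ b)).length) (by simp; omega) rfl rfl hv hw ha rfl
      (by simp) x y,
      adjComp_mono h₃ g₃ a' b' (a' ++ (u ++ b')) rfl rfl (L := (a' ++ (u ++ b')).length)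
      (by simp; omega) rfl rfl hw hu ha' rfl (by simp) y z,
      adjComp_mono h₄ g₄ a b (a ++ ((a' ++ (u ++ b')) ++ b)) rfl rfl
      (L := (a ++ ((a' ++ (u ++ b')) ++ b)).length) (by simp; omega) rfl rfl
      hv (by simp at hw ⊢; omega) ha rfl (by simp) x _,
      adjComp_mono h₂ g₂ (i := i + j) (a ++ a') (b' ++ b) (a ++ ((a' ++ (u ++ b')) ++ b)) rfl
      (by simp) (L := (a ++ ((a' ++ (u ++ b')) ++ b)).length) (by simp; omega) rfl rfl
      (by simp at hv hw ⊢; omega) hu (by simp; omega) List.length_append.symm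
      (by simp) _ z]
    congr 1
    exact P.comp_seq _ _ _ _ _ _ _ _ _ _ _ _ _ _ _ _
  have s1 : ∀ (v w : List Bool) (hv : v.count true = m) (hw : w.count true = n)
      (x : P.obj v.length d) (y : P.obj w.length e),
      adjComp h₂ g₂ (i + j) (adjComp h₁ g₁ i (mono P v x) (mono P w y)) =
        adjComp h₄ g₄ i (mono P v x) ∘ₗ adjComp h₃ g₃ j (mono P w y) := fun v w hv hw x y =>
    adj_ext _ _ (fun N => ⟨N, fun f hf => adjComp_tail_right h₂ g₂ _ _ hf⟩)
      (fun N => ⟨N, fun f hf => adjComp_tail_right h₄ g₄ _ _ (adjComp_tail_right h₃ g₃ _ _ hf)⟩)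
      (fun u hu z => key v w u hv hw hu x y z)
  have s2 : ∀ (v : List Bool) (hv : v.count true = m) (x : P.obj v.length d) (z : AdjObj P p f),
      (adjComp h₂ g₂ (i + j)).flip z ∘ₗ adjComp h₁ g₁ i (mono P v x) =
        adjComp h₄ g₄ i (mono P v x) ∘ₗ (adjComp h₃ g₃ j).flip z := fun v hv x z =>
    adj_ext _ _
      (fun N => ⟨N + 1, fun f hf => adjComp_tail_left h₂ g₂ _ (adjComp_tail_right h₁ g₁ _ _ hf) _⟩)
      (fun N => ⟨N + 1, fun f hf => adjComp_tail_right h₄ g₄ _ _ (adjComp_tail_left h₃ g₃ _ hf _)⟩)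
      (fun w hw y => LinearMap.congr_fun (s1 v w hv hw x y) z)
  have s3 : (adjComp h₂ g₂ (i + j)).flip z ∘ₗ (adjComp h₁ g₁ i).flip y =
        (adjComp h₄ g₄ i).flip (adjComp h₃ g₃ j y z) :=
    adj_ext _ _
      (fun N => ⟨N + 1 + 1, fun f hf => adjComp_tail_left h₂ g₂ _ (adjComp_tail_left h₁ g₁ _ hf _) _⟩)
      (fun N => ⟨N + 1, fun f hf => adjComp_tail_left h₄ g₄ _ hf _⟩)
      (fun v hv x => LinearMap.congr_fun (s2 v hv x z) y)
  exact LinearMap.congr_fun s3 x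

theorem adj_comp_par {m n p mn mp l : ℕ} {d e f de df g : ℤ}
    (h₁ : mn + 1 = m + n) (h₂ : l + 1 = mn + p) (h₃ : mp + 1 = m + p) (h₄ : l + 1 = mp + n)
    (g₁ : d + e = de) (g₂ : de + f = g) (g₃ : d + f = df) (g₄ : df + e = g)
    (i j j' : ℕ) (hij : i < j) (hj : j < m) (hj' : j' + 1 = j + p)
    (x : AdjObj P m d) (y : AdjObj P n e) (z : AdjObj P p f) :
    adjComp h₂ g₂ i (adjComp h₁ g₁ j x y) z =
      sgn k (e * f) • adjComp h₄ g₄ j' (adjComp h₃ g₃ i x z) y := by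
  have key : ∀ (v w u : List Bool) (hv : v.count true = m) (hw : w.count true = n)
      (hu : u.count true = p) (x : P.obj v.length d) (y : P.obj w.length e) (z : P.obj u.length f),
      adjComp h₂ g₂ i (adjComp h₁ g₁ j (mono P v x) (mono P w y)) (mono P u z) =
      sgn k (e * f) • adjComp h₄ g₄ j' (adjComp h₃ g₃ i (mono P v x) (mono P u z)) (mono P w y) := by
    intro v w u hv hw hu x y z
    obtain ⟨a', c, rfl, ha'⟩ := exists_split (hv ▸ hj)
    obtain ⟨a, b, rfl, ha⟩ := exists_split (ha' ▸ hij)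
    rw [adjComp_mono h₁ g₁ (a ++ true :: b) c (a ++ true :: (b ++ (w ++ c))) rfl (by simp)
      (L := (a ++ true :: (b ++ (w ++ c))).length) (by simp; omega) rfl rfl hv hw ha' rfl
      (by simp) x y,
      adjComp_mono (i := i) h₂ g₂ a (b ++ (w ++ c)) (a ++ (u ++ (b ++ (w ++ c)))) rfl rfl
      (L := (a ++ (u ++ (b ++ (w ++ c)))).length)
      (by simp; omega) rfl rfl (by simp at hv hw ⊢; omega) hu ha rfl (by simp) _ z,
      adjComp_mono (i := i) h₃ g₃ a (b ++ true :: c) ((a ++ (u ++ b)) ++ true :: c) (by simp)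
      (by simp) (L := ((a ++ (u ++ b)) ++ true :: c).length) (by simp; omega) rfl rfl hv hu ha rfl
      (by simp) x z,
      adjComp_mono (i := j') h₄ g₄ (a ++ (u ++ b)) c (a ++ (u ++ (b ++ (w ++ c)))) rfl (by simp)
      (L := (a ++ (u ++ (b ++ (w ++ c)))).length)
      (by simp; omega) rfl rfl (by simp at hv ⊢; omega) hw
      (by simp at ha' ⊢; omega) rfl (by simp) _ y, ← mono_smul]
    congr 1
    exact P.comp_par _ _ _ _ _ _ _ _ _ _ _ (by simp) (by simp) (by simp; omega) _ _ _ x y z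
  have s1 : ∀ (v w : List Bool) (hv : v.count true = m) (hw : w.count true = n)
      (x : P.obj v.length d) (y : P.obj w.length e),
      adjComp h₂ g₂ i (adjComp h₁ g₁ j (mono P v x) (mono P w y)) =
        sgn k (e * f) • ((adjComp h₄ g₄ j').flip (mono P w y) ∘ₗ adjComp h₃ g₃ i (mono P v x)) :=
    fun v w hv hw x y =>
    adj_ext _ _ (fun N => ⟨N, fun f hf => adjComp_tail_right h₂ g₂ _ _ hf⟩)
      (fun N => ⟨N + 1, fun f hf u hu => by
        have := adjComp_tail_left h₄ g₄ j' (adjComp_tail_right h₃ g₃ i (mono P v x) hf)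
          (mono P w y) u hu
        simp only [LinearMap.smul_apply, LinearMap.comp_apply, LinearMap.flip_apply, Pi.smul_apply,
          this, smul_zero]⟩)
      (fun u hu z => key v w u hv hw hu x y z)
  have s2 : ∀ (v : List Bool) (hv : v.count true = m) (x : P.obj v.length d) (z : AdjObj P p f),
      (adjComp h₂ g₂ i).flip z ∘ₗ adjComp h₁ g₁ j (mono P v x) =
        sgn k (e * f) • adjComp h₄ g₄ j' (adjComp h₃ g₃ i (mono P v x) z) := fun v hv x z =>
    adj_ext _ _
      (fun N => ⟨N + 1, fun f hf => adjComp_tail_left h₂ g₂ _ (adjComp_tail_right h₁ g₁ _ _ hf) _⟩)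
      (fun N => ⟨N, fun f hf u hu => by
        have := adjComp_tail_right h₄ g₄ j' (adjComp h₃ g₃ i (mono P v x) z) hf u hu
        simp only [LinearMap.smul_apply, Pi.smul_apply, this, smul_zero]⟩)
      (fun w hw y => LinearMap.congr_fun (s1 v w hv hw x y) z)
  have s3 : (adjComp h₂ g₂ i).flip z ∘ₗ (adjComp h₁ g₁ j).flip y =
        sgn k (e * f) • ((adjComp h₄ g₄ j').flip y ∘ₗ (adjComp h₃ g₃ i).flip z) :=
    adj_ext _ _
      (fun N => ⟨N + 1 + 1, fun f hf => adjComp_tail_left h₂ g₂ _ (adjComp_tail_left h₁ g₁ _ hf _) _⟩)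
      (fun N => ⟨N + 1 + 1, fun f hf u hu => by
        have := adjComp_tail_left h₄ g₄ j' (adjComp_tail_left h₃ g₃ i hf z) y u hu
        simp only [LinearMap.smul_apply, LinearMap.comp_apply, LinearMap.flip_apply, Pi.smul_apply,
          this, smul_zero]⟩)
      (fun v hv x => LinearMap.congr_fun (s2 v hv x z) y)
  exact LinearMap.congr_fun s3 x

/-- The differential of `P`, applied to each coefficient; it kills `α`. -/
def adjDiff (n : ℕ) {d e : ℤ} (h : d + 1 = e) : AdjObj P n d →ₗ[k] AdjObj P n e :=
  LinearMap.pi fun v => P.diff v.1.length h ∘ₗ LinearMap.proj v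

variable (P) in
/-- The complete operad `P ∨̂ α` obtained from `P` by freely adjoining (complete coproduct) a closed
generator `α` of arity `0` and degree `0`, placed in `F_w`, for `w ≥ 1`. -/
def adjoin (w : ℕ) : FDGOperad k where
  obj := AdjObj P
  fil n d p := Submodule.pi Set.univ fun v => P.fil v.1.length d (p - w * v.1.count false)
  fil_zero n d := by simp [P.fil_zero]
  fil_anti n d := fun p q h f hf v hv =>
    P.fil_anti _ _ (Nat.sub_le_sub_right h _) (hf v hv)
  one := mono P [true] P.one
  comp hl hf i _ := adjComp hl hf i
  comp_mem_fil hl hf i hi p q x y hx hy := by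
    intro u _
    rw [adjComp_apply]
    refine Submodule.sum_mem _ fun t _ => ?_
    have h := (adj_aux hl u.2 t.2).2.2.2
    refine P.fil_anti _ _ ?_ (P.comp_mem_fil _ _ _ _
      (hx ⟨_, (adj_aux hl u.2 t.2).2.2.1⟩ trivial) (hy ⟨_, (mem_cuts.1 t.2).2.2⟩ trivial))
    simp only
    rw [h, mul_add]
    omega
  one_comp := adj_one_comp
  comp_one hl hf i hi x := adj_comp_one hl hf i hi x
  comp_seq h₁ h₂ h₃ h₄ g₁ g₂ g₃ g₄ i j hi hj _ x y z :=
    adj_comp_seq h₁ h₂ h₃ h₄ g₁ g₂ g₃ g₄ i j hi hj x y z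
  comp_par h₁ h₂ h₃ h₄ g₁ g₂ g₃ g₄ i j j' hij hj hj' _ _ _ x y z :=
    adj_comp_par h₁ h₂ h₃ h₄ g₁ g₂ g₃ g₄ i j j' hij hj hj' x y z
  diff := adjDiff
  diff_mem_fil h _ _ hx := fun v hv => P.diff_mem_fil h (hx v hv)
  diff_diff h h' x := funext fun v => P.diff_diff h h' (x v)
  diff_comp hl hf hd' he' hf' h₁ h₂ i hi x y := by
    funext u
    simp only [adjDiff, LinearMap.pi_apply, LinearMap.comp_apply, LinearMap.proj_apply,
      Pi.add_apply, Pi.smul_apply, adjComp_apply, map_sum, Finset.smul_sum]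
    rw [← Finset.sum_add_distrib]
    exact Finset.sum_congr rfl fun t _ => P.diff_comp _ _ _ _ _ _ _ _ _ _ _

/-- The inclusion of `P` into `P ∨̂ α`. -/
def incl (P : FDGOperad k) (w : ℕ) {n : ℕ} {d : ℤ} (x : P.obj n d) : (P.adjoin w).obj n d :=
  mono P (List.replicate n true) x

/-- The generator `α` of `P ∨̂ α`. -/
def gen (P : FDGOperad k) (w : ℕ) : (P.adjoin w).obj 0 0 := mono P [false] P.one

end adjoin

/-! ### Twisting by a shifted multiplicative structure -/

section Tw

variable {P : FDGOperad k}

theorem bcuts_aux {n : ℕ} {u : List Bool} (hu : u.count true = n) {t : List Bool × List Bool}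
    (ht : t ∈ bcuts u) : u.length + 1 = (t.1 ++ false :: t.2).length + 2 ∧
      t.1.length < (t.1 ++ false :: t.2).length ∧ (t.1 ++ false :: t.2).count true = n ∧
      (t.1 ++ false :: t.2).count false ≤ u.count false := by
  obtain rfl := mem_bcuts.1 ht
  simp at hu ⊢
  omega

/-- The derivation of `P ∨̂ α` that vanishes on `P` and sends `α` to `-m(α, α)`, for `m` of arity `2`
and degree `1`. -/
def mcDer (m : P.obj 2 1) (n : ℕ) {d e : ℤ} (h : d + 1 = e) : AdjObj P n d →ₗ[k] AdjObj P n e where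
  toFun f u := -(sgn k d • ∑ t ∈ (bcuts u.1).attach,
    P.comp (bcuts_aux u.2 t.2).1 h t.1.1.length (bcuts_aux u.2 t.2).2.1
      (f ⟨t.1.1 ++ false :: t.1.2, (bcuts_aux u.2 t.2).2.2.1⟩) m)
  map_add' f g := by
    funext u
    simp only [Pi.add_apply, map_add, LinearMap.add_apply, Finset.sum_add_distrib, smul_add,
      neg_add]
  map_smul' a f := by
    funext u
    simp only [Pi.smul_apply, map_smul, LinearMap.smul_apply, ← Finset.smul_sum, RingHom.id_apply,
      smul_neg, smul_comm a]

theorem mcDer_apply (m : P.obj 2 1) (n : ℕ) {d e : ℤ} (h : d + 1 = e) (f : AdjObj P n d) (u) :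
    mcDer m n h f u = -(sgn k d • ∑ t ∈ (bcuts u.1).attach,
    P.comp (bcuts_aux u.2 t.2).1 h t.1.1.length (bcuts_aux u.2 t.2).2.1
      (f ⟨t.1.1 ++ false :: t.1.2, (bcuts_aux u.2 t.2).2.2.1⟩) m) := rfl

/-- The factorisations `w = x ++ [false] ++ z`. -/
def bsplits : List Bool → Finset (List Bool × List Bool)
  | [] => ∅
  | false :: w => insert ([], w) ((bsplits w).image fun t => (false :: t.1, t.2))
  | true :: w => (bsplits w).image fun t => (true :: t.1, t.2)

theorem mem_bsplits {w : List Bool} {t : List Bool × List Bool} :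
    t ∈ bsplits w ↔ t.1 ++ false :: t.2 = w := by
  obtain ⟨x, z⟩ := t
  induction w generalizing x with
  | nil => simp [bsplits]
  | cons b w ih =>
    cases b <;> cases x <;> simp [bsplits, ih] <;> aesop

theorem sum_bsplits_cons_true {M : Type u} [AddCommGroup M] (w : List Bool)
    (G : List Bool → List Bool → M) :
    ∑ t ∈ bsplits (true :: w), G t.1 t.2 = ∑ t ∈ bsplits w, G (true :: t.1) t.2 := by
  rw [bsplits, Finset.sum_image]
  rintro ⟨a, b⟩ _ ⟨c, d⟩ _ h
  simpa using h

theorem sum_bsplits_cons_false {M : Type u} [AddCommGroup M] (w : List Bool)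
    (G : List Bool → List Bool → M) :
    ∑ t ∈ bsplits (false :: w), G t.1 t.2 =
      G [] w + ∑ t ∈ bsplits w, G (false :: t.1) t.2 := by
  rw [bsplits, Finset.sum_insert (by simp), Finset.sum_image]
  rintro ⟨a, b⟩ _ ⟨c, d⟩ _ h
  simpa using h

theorem sum_bsplits_append {M : Type u} [AddCommGroup M] (v w : List Bool)
    (G : List Bool → List Bool → M) :
    ∑ t ∈ bsplits (v ++ w), G t.1 t.2 =
      ∑ t ∈ bsplits v, G t.1 (t.2 ++ w) + ∑ t ∈ bsplits w, G (v ++ t.1) t.2 := by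
  induction v generalizing G with
  | nil => simp [bsplits]
  | cons b v ih =>
    cases b
    · simp only [List.cons_append, sum_bsplits_cons_false]
      rw [ih (fun a b => G (false :: a) b), sum_bsplits_cons_false v (fun a b => G a (b ++ w)),
        add_assoc]
    · simp only [List.cons_append, sum_bsplits_cons_true]
      rw [ih (fun a b => G (true :: a) b), sum_bsplits_cons_true v (fun a b => G a (b ++ w))]

theorem sum_bsplits_assoc {M : Type u} [AddCommGroup M] (w : List Bool)
    (H : List Bool → List Bool → List Bool → M) :
    ∑ t ∈ bsplits w, ∑ s ∈ bsplits t.1, H s.1 s.2 t.2 =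
      ∑ t ∈ bsplits w, ∑ s ∈ bsplits t.2, H t.1 s.1 s.2 := by
  induction w generalizing H with
  | nil => simp [bsplits]
  | cons b w ih =>
    cases b
    · rw [sum_bsplits_cons_false w (fun a b => ∑ s ∈ bsplits a, H s.1 s.2 b),
        sum_bsplits_cons_false w (fun a b => ∑ s ∈ bsplits b, H a s.1 s.2),
        ← ih fun a b c => H (false :: a) b c, ← Finset.sum_add_distrib]
      simp only [bsplits, Finset.sum_empty, zero_add]
      refine Finset.sum_congr rfl fun t _ => ?_
      exact sum_bsplits_cons_false t.1 (fun a b => H a b t.2)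
    · rw [sum_bsplits_cons_true w (fun a b => ∑ s ∈ bsplits a, H s.1 s.2 b),
        sum_bsplits_cons_true w (fun a b => ∑ s ∈ bsplits b, H a s.1 s.2),
        ← ih fun a b c => H (true :: a) b c]
      refine Finset.sum_congr rfl fun t _ => ?_
      exact sum_bsplits_cons_true t.1 (fun a b => H a b t.2)

theorem mcDer_mono (m : P.obj 2 1) (n : ℕ) {d e : ℤ} (h : d + 1 = e) {N : ℕ} (w : List Bool)
    (hN : N = w.length) (hw : w.count true = n) (x : P.obj N d) :
    mcDer m n h (mono P w x) = -(sgn k d • ∑ t ∈ bsplits w,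
      mono P (t.1 ++ false :: false :: t.2) (P.compz (m := N) (n := 2) (l := N + 1) rfl h t.1.length x m)) := by
  subst hN
  funext u
  rw [mcDer_apply, Pi.neg_apply, Pi.smul_apply, Finset.sum_apply]
  congr 2
  let K : List Bool × List Bool → P.obj u.1.length e := fun t =>
    if t ∈ bsplits w then
      (mono P (t.1 ++ false :: false :: t.2)
        (P.compz (m := w.length) (n := 2) (l := w.length + 1) rfl h t.1.length x m) : AdjObj P n e) u else 0
  have h1 : ∀ t ∈ (bcuts u.1).attach,
      P.comp (bcuts_aux u.2 t.2).1 h t.1.1.length (bcuts_aux u.2 t.2).2.1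
        ((mono P w x : AdjObj P n d) ⟨t.1.1 ++ false :: t.1.2, (bcuts_aux u.2 t.2).2.2.1⟩) m =
      K t.1 := by
    rintro ⟨⟨a, b⟩, ht⟩ _
    by_cases hab : a ++ false :: b = w
    · subst hab
      have hK : (a, b) ∈ bsplits (a ++ false :: b) := mem_bsplits.2 rfl
      simp only [K, if_pos hK]
      obtain ⟨u, hu⟩ := u
      obtain rfl := mem_bcuts.1 ht
      have e1 := mono_apply_self (P := P) ⟨a ++ false :: b, hw⟩ rfl x
      simp only at e1
      rw [e1, compz_pos _ _ _ _ (by simp)]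
      have e2 : ∀ (N : ℕ) (hN : N + 1 = (a ++ false :: b).length + 2)
          (hN' : N = (a ++ false :: false :: b).length),
          P.comp (m := (a ++ false :: b).length) (n := 2) (l := (a ++ false :: false :: b).length)
            (by simp; omega) h a.length (by simp) x m =
            (mono P (a ++ false :: false :: b) (P.comp hN h a.length (by simp) x m) : AdjObj P n e)
            ⟨a ++ false :: false :: b, hu⟩ := by
        rintro N hN rfl
        exact (mono_apply_self (P := P) ⟨a ++ false :: false :: b, hu⟩ rfl _).symm
      exact e2 _ rfl (by simp; omega)
    · have hK : (a, b) ∉ bsplits w := fun hh => hab (mem_bsplits.1 hh)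
      simp only [K, if_neg hK]
      have := mono_apply_ne (P := P) ⟨a ++ false :: b, (bcuts_aux u.2 ht).2.2.1⟩ hab x
      simp only at this
      rw [this]
      simp
  rw [Finset.sum_congr rfl h1, Finset.sum_attach (bcuts u.1) K, Finset.sum_ite, Finset.sum_const_zero,
    add_zero]
  refine Finset.sum_subset (fun t ht => (Finset.mem_filter.1 ht).2) fun t ht ht' => ?_
  refine mono_apply_ne _ (fun hu => ht' (Finset.mem_filter.2 ⟨mem_bcuts.2 hu.symm, ht⟩)) _

theorem mcDer_tail (m : P.obj 2 1) (n : ℕ) {d e : ℤ} (h : d + 1 = e) {N : ℕ} {f : AdjObj P n d}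
    (hf : f ∈ tail P n d N) : mcDer m n h f ∈ tail P n e N := by
  intro u hu
  rw [mcDer_apply, Finset.sum_eq_zero, smul_zero, neg_zero]
  intro t _
  have := (bcuts_aux u.2 t.2).1
  rw [hf _ (by simp only; omega)]
  simp

theorem adjDiff_tail (n : ℕ) {d e : ℤ} (h : d + 1 = e) {N : ℕ} {f : AdjObj P n d}
    (hf : f ∈ tail P n d N) : adjDiff n h f ∈ tail P n e N := by
  intro u hu
  simp [adjDiff, hf u hu]

theorem adjDiff_mono (n : ℕ) {d e : ℤ} (h : d + 1 = e) {N : ℕ} (w : List Bool) (x : P.obj N d) :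
    adjDiff n h (mono P w x) = mono P w (P.diff N h x) := by
  funext u
  simp only [adjDiff, mono, LinearMap.pi_apply, LinearMap.comp_apply, LinearMap.proj_apply]
  by_cases hu : u.1 = w ∧ N = u.1.length
  · obtain ⟨hu1, rfl⟩ := hu
    simp [hu1]
  · simp [hu]

theorem mono_sum {ι : Type} {n N : ℕ} {d : ℤ} (w : List Bool) (s : Finset ι) (x : ι → P.obj N d) :
    (mono P w (∑ i ∈ s, x i) : AdjObj P n d) = ∑ i ∈ s, mono P w (x i) := by
  classical
  induction s using Finset.induction_on with
  | empty => simp [mono_zero]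
  | insert a s ha ih => rw [Finset.sum_insert ha, Finset.sum_insert ha, mono_add, ih]

theorem mcDer_comp (μ : P.obj 2 1) {m n l : ℕ} {d e f d' e' f' : ℤ} (hl : l + 1 = m + n)
    (hf : d + e = f) (hd' : d + 1 = d') (he' : e + 1 = e') (hf' : f + 1 = f') (h₁ : d' + e = f')
    (h₂ : d + e' = f') (i : ℕ) (hi : i < m) (x : AdjObj P m d) (y : AdjObj P n e) :
    mcDer μ l hf' (adjComp hl hf i x y) =
      adjComp hl h₁ i (mcDer μ m hd' x) y + sgn k d • adjComp hl h₂ i x (mcDer μ n he' y) := by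
  have key : ∀ (v w : List Bool) (_ : v.count true = m) (_ : w.count true = n)
      (x : P.obj v.length d) (y : P.obj w.length e),
      mcDer μ l hf' (adjComp hl hf i (mono P v x) (mono P w y)) =
        adjComp hl h₁ i (mcDer μ m hd' (mono P v x)) (mono P w y) +
          sgn k d • adjComp hl h₂ i (mono P v x) (mcDer μ n he' (mono P w y)) := by
    intro v w hv hw x y
    obtain ⟨a, b, rfl, ha⟩ := exists_split (hv ▸ hi)
    have hcount : (a ++ (w ++ b)).count true = l := by simp at hv hw ⊢; omega
    have s1 : ∀ t ∈ bsplits a, (mono P (t.1 ++ false :: false :: (t.2 ++ (w ++ b)))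
        (P.compz (m := (a ++ (w ++ b)).length) (n := 2) (l := (a ++ (w ++ b)).length + 1) rfl hf' t.1.length
          (P.comp (l := (a ++ (w ++ b)).length) (by simp; omega) hf a.length (by simp) x y) μ) :
            AdjObj P l f') =
        sgn k e • adjComp hl h₁ i (mono P (t.1 ++ false :: false :: (t.2 ++ true :: b))
          (P.compz (m := (a ++ true :: b).length) (n := 2) (l := (a ++ true :: b).length + 1) rfl hd' t.1.length x μ)) (mono P w y) := by
      rintro ⟨p, q⟩ ht
      obtain rfl : p ++ false :: q = _ := mem_bsplits.1 ht
      dsimp only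
      rw [compz_pos _ _ _ _ (by simp), compz_pos _ _ _ _ (by simp),
        adjComp_mono hl h₁ (p ++ false :: false :: q) b
          (p ++ false :: false :: (q ++ (w ++ b))) (by simp) (by simp)
          (L := ((p ++ false :: q) ++ (w ++ b)).length + 1) (by simp; omega) (by simp; omega) rfl
          (by simp at hv ⊢; omega) hw (by simp at ha ⊢; omega) (A := (p ++ false :: q).length + 1)
          (by simp; omega) (by simp) _ y, ← mono_smul]
      congr 1
      rw [P.comp_par (p := 2) (l := ((p ++ false :: q) ++ (w ++ b)).length + 1)
        (mn := ((p ++ false :: q) ++ (w ++ b)).length)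
        (mp := ((p ++ false :: q) ++ true :: b).length + 1) (by simp; omega) (by simp)
        (by simp) (by simp; omega) hf hf' hd' h₁ p.length (p ++ false :: q).length
        ((p ++ false :: q).length + 1) (by simp) (by simp) (by omega) (by simp)
        (by simp) (by simp) x y μ, mul_one]
    have s2 : ∀ t ∈ bsplits w, (mono P ((a ++ t.1) ++ false :: false :: (t.2 ++ b))
        (P.compz (m := (a ++ (w ++ b)).length) (n := 2) (l := (a ++ (w ++ b)).length + 1) rfl hf' (a ++ t.1).length
          (P.comp (l := (a ++ (w ++ b)).length) (by simp; omega) hf a.length (by simp) x y) μ) :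
            AdjObj P l f') =
        adjComp hl h₂ i (mono P (a ++ true :: b) x) (mono P (t.1 ++ false :: false :: t.2)
          (P.compz (m := w.length) (n := 2) (l := w.length + 1) rfl he' t.1.length y μ)) := by
      rintro ⟨p, q⟩ ht
      obtain rfl : p ++ false :: q = _ := mem_bsplits.1 ht
      dsimp only
      rw [compz_pos _ _ _ _ (by simp), compz_pos _ _ _ _ (by simp),
        adjComp_mono hl h₂ a b ((a ++ p) ++ false :: false :: (q ++ b)) rfl (by simp)
          (L := (a ++ ((p ++ false :: q) ++ b)).length + 1) (by simp; omega) rfl (by simp; omega)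
          hv (by simp at hw ⊢; omega) ha rfl (by simp) x _]
      congr 1
      simp only [List.length_append (as := a) (bs := p)]
      exact P.comp_seq (p := 2) (np := (p ++ false :: q).length + 1) _ rfl rfl _ hf hf' he' h₂ a.length p.length (by simp) (by simp) _ x y μ
    have s3 : ∀ t ∈ bsplits b, (mono P ((a ++ (w ++ t.1)) ++ false :: false :: t.2)
        (P.compz (m := (a ++ (w ++ b)).length) (n := 2) (l := (a ++ (w ++ b)).length + 1) rfl hf' (a ++ (w ++ t.1)).length
          (P.comp (l := (a ++ (w ++ b)).length) (by simp; omega) hf a.length (by simp) x y) μ) :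
            AdjObj P l f') =
        sgn k e • adjComp hl h₁ i (mono P ((a ++ true :: t.1) ++ false :: false :: t.2)
          (P.compz (m := (a ++ true :: b).length) (n := 2) (l := (a ++ true :: b).length + 1) rfl hd' (a ++ true :: t.1).length x μ))
          (mono P w y) := by
      rintro ⟨p, q⟩ ht
      obtain rfl : p ++ false :: q = _ := mem_bsplits.1 ht
      dsimp only
      rw [compz_pos _ _ _ _ (by simp), compz_pos _ _ _ _ (by simp),
        adjComp_mono hl h₁ a (p ++ false :: false :: q)
          ((a ++ (w ++ p)) ++ false :: false :: q) (by simp) (by simp)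
          (L := (a ++ (w ++ (p ++ false :: q))).length + 1) (by simp; omega) (by simp; omega) rfl
          (by simp at hv ⊢; omega) hw ha rfl (by simp) _ y, ← mono_smul]
      congr 1
      have := P.comp_par (l := (a ++ (w ++ (p ++ false :: q))).length + 1)
        (mp := (a ++ (w ++ (p ++ false :: q))).length)
        (mn := (a ++ true :: (p ++ false :: q)).length + 1) (n := 2)
        (by simp) (by simp; omega) (by simp; omega) (by simp) hd' h₁ hf hf' a.length
        (a ++ true :: p).length (a ++ (w ++ p)).length (by simp) (by simp)
        (by simp; omega) (by simp) (by simp) (by simp) x μ y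
      rw [this, one_mul, smul_smul, sgn_mul_self, one_smul]
    rw [adjComp_mono hl hf a b (a ++ (w ++ b)) rfl rfl (L := (a ++ (w ++ b)).length)
      (by simp; omega) rfl rfl hv hw ha rfl (by simp) x y,
      mcDer_mono μ l hf' _ rfl hcount, mcDer_mono μ m hd' _ rfl hv, mcDer_mono μ n he' _ rfl hw]
    rw [sum_bsplits_append a (w ++ b) (fun p q => mono P (p ++ false :: false :: q)
        (P.compz (m := (a ++ (w ++ b)).length) (n := 2) (l := (a ++ (w ++ b)).length + 1) rfl hf' p.length _ μ)),
      sum_bsplits_append w b (fun p q => mono P ((a ++ p) ++ false :: false :: q)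
        (P.compz (m := (a ++ (w ++ b)).length) (n := 2) (l := (a ++ (w ++ b)).length + 1) rfl hf' (a ++ p).length _ μ)),
      Finset.sum_congr rfl s1, Finset.sum_congr rfl s2, Finset.sum_congr rfl s3,
      sum_bsplits_append a (true :: b) (fun p q => mono P (p ++ false :: false :: q)
        (P.compz (m := (a ++ true :: b).length) (n := 2) (l := (a ++ true :: b).length + 1) rfl hd' p.length x μ)),
      sum_bsplits_cons_true b (fun p q => mono P ((a ++ p) ++ false :: false :: q)
        (P.compz (m := (a ++ true :: b).length) (n := 2) (l := (a ++ true :: b).length + 1) rfl hd' (a ++ p).length x μ))]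
    have hfs : sgn k f = sgn k d * sgn k e := by rw [← hf, sgn_add]
    have hsc : ∀ z : AdjObj P l f', (sgn k d * sgn k e) • sgn k e • z = sgn k d • z := fun z => by
      rw [smul_smul, mul_assoc, sgn_mul_self, mul_one]
    simp only [← Finset.smul_sum, hfs, map_neg, map_smul, map_add, map_sum, LinearMap.neg_apply,
      LinearMap.smul_apply, LinearMap.add_apply, LinearMap.sum_apply, smul_add, hsc, smul_neg]
    simp only [smul_smul, mul_comm (sgn k d)]
    abel
  have s1 : ∀ (v : List Bool) (_ : v.count true = m) (x : P.obj v.length d),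
      mcDer μ l hf' ∘ₗ adjComp hl hf i (mono P v x) =
        adjComp hl h₁ i (mcDer μ m hd' (mono P v x)) +
          sgn k d • (adjComp hl h₂ i (mono P v x) ∘ₗ mcDer μ n he') := fun v hv x =>
    adj_ext _ _ (fun N => ⟨N, fun f hf0 => mcDer_tail _ _ _ (adjComp_tail_right hl hf _ _ hf0)⟩)
      (fun N => ⟨N, fun f hf0 u hu => by
        have e1 := adjComp_tail_right hl h₁ i (mcDer μ m hd' (mono P v x)) hf0 u hu
        have e2 := adjComp_tail_right hl h₂ i (mono P v x) (mcDer_tail μ n he' hf0) u hu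
        simp only [LinearMap.add_apply, LinearMap.smul_apply, LinearMap.comp_apply, Pi.add_apply,
          Pi.smul_apply, e1, e2, smul_zero, add_zero]⟩)
      (fun w hw y => key v w hv hw x y)
  have s2 : mcDer μ l hf' ∘ₗ (adjComp hl hf i).flip y =
        (adjComp hl h₁ i).flip y ∘ₗ mcDer μ m hd' +
          sgn k d • ((adjComp hl h₂ i).flip (mcDer μ n he' y)) :=
    adj_ext _ _ (fun N => ⟨N + 1, fun f hf0 => mcDer_tail _ _ _ (adjComp_tail_left hl hf _ hf0 _)⟩)
      (fun N => ⟨N + 1, fun f hf0 u hu => by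
        have e1 := adjComp_tail_left hl h₁ i (mcDer_tail μ m hd' hf0) y u hu
        have e2 := adjComp_tail_left hl h₂ i hf0 (mcDer μ n he' y) u hu
        simp only [LinearMap.add_apply, LinearMap.smul_apply, LinearMap.comp_apply, Pi.add_apply,
          LinearMap.flip_apply, Pi.smul_apply, e1, e2, smul_zero, add_zero]⟩)
      (fun v hv x => LinearMap.congr_fun (s1 v hv x) y)
  exact LinearMap.congr_fun s2 x

theorem mcDer_mcDer (μ : P.obj 2 1)
    (hμ : P.comp (m := 2) (n := 2) (l := 3) rfl one_add_one_eq_two 0 Nat.two_pos μ μ +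
      P.comp (m := 2) (n := 2) (l := 3) rfl one_add_one_eq_two 1 Nat.one_lt_two μ μ = 0) {n : ℕ} {d e f : ℤ}
    (h : d + 1 = e) (h' : e + 1 = f) (x : AdjObj P n d) :
    mcDer μ n h' (mcDer μ n h x) = 0 := by
  have key : mcDer μ n h' ∘ₗ mcDer μ n h = (0 : AdjObj P n d →ₗ[k] AdjObj P n f) := by
    refine adj_ext _ _ (fun N => ⟨N, fun f hf0 => mcDer_tail _ _ _ (mcDer_tail _ _ _ hf0)⟩)
      (fun N => ⟨N, fun f hf0 u hu => rfl⟩) fun w hw x => ?_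
    let H : List Bool → List Bool → List Bool → AdjObj P n f := fun p q r =>
      mono P (p ++ false :: false :: (q ++ false :: false :: r))
        (P.compz (m := w.length + 1) (n := 2) (l := w.length + 2) rfl h' p.length
          (P.compz (m := w.length) (n := 2) (l := w.length + 1) rfl h (p ++ false :: q).length x μ) μ)
    have s1 : ∀ t ∈ bsplits w, mcDer μ n h' (mono P (t.1 ++ false :: false :: t.2)
        (P.compz (m := w.length) (n := 2) (l := w.length + 1) rfl h t.1.length x μ)) =
        -(sgn k e • (∑ s ∈ bsplits t.1, H s.1 s.2 t.2 - ∑ s ∈ bsplits t.2, H t.1 s.1 s.2)) := by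
      rintro ⟨p, q⟩ ht
      obtain rfl : p ++ false :: q = _ := mem_bsplits.1 ht
      dsimp only
      rw [mcDer_mono μ n h' _ (by simp; omega) (by simp at hw ⊢; omega),
        sum_bsplits_append p (false :: false :: q) (fun p' q' => mono P
          (p' ++ false :: false :: q') (P.compz (m := (p ++ false :: q).length + 1) (n := 2) (l := (p ++ false :: q).length + 2) rfl h' p'.length
            (P.compz (m := (p ++ false :: q).length) (n := 2) (l := (p ++ false :: q).length + 1) rfl h p.length x μ) μ)),
        sum_bsplits_cons_false (false :: q) (fun p' q' => mono P
          ((p ++ p') ++ false :: false :: q') (P.compz (m := (p ++ false :: q).length + 1) (n := 2) (l := (p ++ false :: q).length + 2) rfl h'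
            (p ++ p').length
            (P.compz (m := (p ++ false :: q).length) (n := 2) (l := (p ++ false :: q).length + 1) rfl h p.length x μ) μ)),
        sum_bsplits_cons_false q (fun p' q' => mono P
          ((p ++ false :: p') ++ false :: false :: q')
            (P.compz (m := (p ++ false :: q).length + 1) (n := 2) (l := (p ++ false :: q).length + 2) rfl h' (p ++ false :: p').length
            (P.compz (m := (p ++ false :: q).length) (n := 2) (l := (p ++ false :: q).length + 1) rfl h p.length x μ) μ))]
      have e1 : ∀ s ∈ bsplits p, (mono P (s.1 ++ false :: false :: (s.2 ++ false :: false :: q))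
          (P.compz (m := (p ++ false :: q).length + 1) (n := 2) (l := (p ++ false :: q).length + 2) rfl h' s.1.length
            (P.compz (m := (p ++ false :: q).length) (n := 2) (l := (p ++ false :: q).length + 1) rfl h p.length x μ) μ) : AdjObj P n f) =
          H s.1 s.2 q := by
        rintro ⟨a, b⟩ hs
        obtain rfl := mem_bsplits.1 hs
        rfl
      have e2 : ∀ s ∈ bsplits q,
          (mono P ((p ++ false :: false :: s.1) ++ false :: false :: s.2)
          (P.compz (m := (p ++ false :: q).length + 1) (n := 2) (l := (p ++ false :: q).length + 2) rfl h' (p ++ false :: false :: s.1).length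
            (P.compz (m := (p ++ false :: q).length) (n := 2) (l := (p ++ false :: q).length + 1) rfl h p.length x μ) μ) : AdjObj P n f) =
          - H p s.1 s.2 := by
        rintro ⟨a, b⟩ hs
        obtain rfl : a ++ false :: b = _ := mem_bsplits.1 hs
        simp only [H]
        rw [compz_pos _ _ _ _ (by simp), compz_pos _ _ _ _ (by simp),
          compz_pos _ _ _ _ (by simp), compz_pos _ _ _ _ (by simp)]
        rw [P.comp_par (n := 2) (p := 2) (l := (p ++ false :: (a ++ false :: b)).length + 2)
          (mn := (p ++ false :: (a ++ false :: b)).length + 1)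
          (mp := (p ++ false :: (a ++ false :: b)).length + 1) rfl rfl rfl rfl h h' h h' p.length (p ++ false :: a).length
          (p ++ false :: false :: a).length (by simp) (by simp) (by simp; omega) (by simp)
          (by simp) (by simp) x μ μ]
        have hw2 : (p ++ false :: false :: a) ++ false :: false :: b =
          p ++ false :: false :: (a ++ false :: false :: b) := by simp
        rw [hw2, mono_smul]
        simp
      have e3 : (mono P ((p ++ []) ++ false :: false :: false :: q)
            (P.compz (m := (p ++ false :: q).length + 1) (n := 2) (l := (p ++ false :: q).length + 2) rfl h' (p ++ []).length
            (P.compz (m := (p ++ false :: q).length) (n := 2) (l := (p ++ false :: q).length + 1) rfl h p.length x μ) μ) : AdjObj P n f) +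
          mono P ((p ++ [false]) ++ false :: false :: q)
            (P.compz (m := (p ++ false :: q).length + 1) (n := 2) (l := (p ++ false :: q).length + 2) rfl h' (p ++ [false]).length
            (P.compz (m := (p ++ false :: q).length) (n := 2) (l := (p ++ false :: q).length + 1) rfl h p.length x μ) μ) = 0 := by
        have hw2 : (p ++ [false]) ++ false :: false :: q = (p ++ []) ++ false :: false :: false :: q :=
          by simp
        rw [hw2, ← mono_add, compz_pos _ _ _ _ (by simp), compz_pos _ _ _ _ (by simp),
          compz_pos _ _ _ _ (by simp)]
        simp only [List.append_nil, List.length_append (as := p) (bs := [false]), List.length_singleton]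
        have c0 := P.comp_seq (n := 2) (p := 2) (np := 3) (l := (p ++ false :: q).length + 2)
          (mn := (p ++ false :: q).length + 1) rfl rfl rfl rfl h h' one_add_one_eq_two
          (by omega) p.length 0 (by simp) Nat.two_pos (by simp) x μ μ
        have c1 := P.comp_seq (n := 2) (p := 2) (np := 3) (l := (p ++ false :: q).length + 2)
          (mn := (p ++ false :: q).length + 1) rfl rfl rfl rfl h h' one_add_one_eq_two
          (by omega) p.length 1 (by simp) Nat.one_lt_two (by simp) x μ μ
        simp only [add_zero] at c0
        rw [c0, c1, ← map_add, hμ, map_zero, mono_zero]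
      rw [Finset.sum_congr rfl e1]
      have key' : ∀ A B C D : AdjObj P n f, B + C = 0 → A + (B + (C + -D)) = A - D :=
        fun A B C D hBC => by
          have : A + (B + (C + -D)) = A + (B + C) - D := by abel
          rw [this, hBC, add_zero]
      have e4 : (∑ s ∈ bsplits q, mono P ((p ++ false :: false :: s.1) ++ false :: false :: s.2)
          (P.compz (m := (p ++ false :: q).length + 1) (n := 2) (l := (p ++ false :: q).length + 2) rfl h' (p ++ false :: false :: s.1).length
            (P.compz (m := (p ++ false :: q).length) (n := 2) (l := (p ++ false :: q).length + 1) rfl h p.length x μ) μ) : AdjObj P n f) =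
          - ∑ s ∈ bsplits q, H p s.1 s.2 := by
        rw [Finset.sum_congr rfl e2, Finset.sum_neg_distrib]
      rw [e4, key' _ _ _ _ e3]
    rw [LinearMap.comp_apply, mcDer_mono μ n h w rfl hw, map_neg, map_smul, map_sum,
      Finset.sum_congr rfl s1, Finset.sum_neg_distrib, ← Finset.smul_sum, Finset.sum_sub_distrib,
      sum_bsplits_assoc w H]
    simp
  exact LinearMap.congr_fun key x

end Tw

/-! ### The twisted operad -/

section Tw

theorem mcDer_mem_fil {P : FDGOperad k} (m : P.obj 2 1) {n : ℕ} {d e : ℤ} (h : d + 1 = e) {p : ℕ}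
    {f : AdjObj P n d} (hf : f ∈ (P.adjoin 1).fil n d p) :
    mcDer m n h f ∈ (P.adjoin 1).fil n e p := by
  intro u _
  rw [mcDer_apply]
  refine Submodule.neg_mem _ (Submodule.smul_mem _ _ (Submodule.sum_mem _ fun t _ => ?_))
  have hm : m ∈ P.fil 2 1 0 := by rw [P.fil_zero]; trivial
  have ht := (bcuts_aux u.2 t.2).2.2.2
  refine P.fil_anti _ _ ?_ (P.comp_mem_fil _ _ _ _
    (hf ⟨_, (bcuts_aux u.2 t.2).2.2.1⟩ trivial) hm)
  simp only
  omega

theorem mcDer_sq {P : FDGOperad k} (m : P.obj 2 1) (hd : P.diff 2 one_add_one_eq_two m = 0)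
    (hm : P.comp (m := 2) (n := 2) (l := 3) rfl one_add_one_eq_two 0 Nat.two_pos m m +
      P.comp (m := 2) (n := 2) (l := 3) rfl one_add_one_eq_two 1 Nat.one_lt_two m m = 0)
    {n : ℕ} {d e f : ℤ} (h : d + 1 = e) (h' : e + 1 = f) (x : AdjObj P n d) :
    adjDiff n h' (mcDer m n h x) + mcDer m n h' (adjDiff n h x) + mcDer m n h' (mcDer m n h x) =
      0 := by
  rw [mcDer_mcDer m hm, add_zero]
  funext u
  have hse : sgn k e = - sgn k d := by rw [← h, sgn_add]; simp
  rw [Pi.add_apply, mcDer_apply, hse]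
  simp only [adjDiff, LinearMap.pi_apply, LinearMap.comp_apply, LinearMap.proj_apply, mcDer_apply,
    map_neg, map_smul, map_sum]
  have : ∀ t ∈ (bcuts u.1).attach, P.diff u.1.length h' (P.comp (bcuts_aux u.2 t.2).1 h
      t.1.1.length (bcuts_aux u.2 t.2).2.1
        (x ⟨t.1.1 ++ false :: t.1.2, (bcuts_aux u.2 t.2).2.2.1⟩) m) =
      P.comp (bcuts_aux u.2 t.2).1 h' t.1.1.length (bcuts_aux u.2 t.2).2.1
        (P.diff _ h (x ⟨t.1.1 ++ false :: t.1.2, (bcuts_aux u.2 t.2).2.2.1⟩)) m := fun t _ => by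
    rw [P.diff_comp _ _ h one_add_one_eq_two h' h' (by omega), hd, map_zero, smul_zero, add_zero]
  rw [Finset.sum_congr rfl this]
  simp

/-- The operad `P ∨̂ α` (with `α` in `F₁`) whose differential is the one of `P` on `P`, and
`α ↦ -m(α, α)`, for a closed shifted multiplicative structure `m` on `P`. -/
def adjoinMC (P : FDGOperad k) (m : P.obj 2 1) (hd : P.diff 2 one_add_one_eq_two m = 0)
    (hm : P.comp (m := 2) (n := 2) (l := 3) rfl one_add_one_eq_two 0 Nat.two_pos m m +
      P.comp (m := 2) (n := 2) (l := 3) rfl one_add_one_eq_two 1 Nat.one_lt_two m m = 0) :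
    FDGOperad k :=
  (P.adjoin 1).perturb (mcDer m) (mcDer_mem_fil m) (mcDer_sq m hd hm)
    fun hl hf hd' he' hf' h₁ h₂ i hi x y => mcDer_comp m hl hf hd' he' hf' h₁ h₂ i hi x y

/-- The element `m(α, -) + m(-, α)` of `P ∨̂ α`. -/
def muAlpha (P : FDGOperad k) (m : P.obj 2 1) : (P.adjoin 1).obj 1 1 :=
  (P.adjoin 1).comp (m := 2) (n := 0) rfl (add_zero 1) 0 Nat.two_pos (P.incl 1 m) (P.gen 1) +
    (P.adjoin 1).comp (m := 2) (n := 0) rfl (add_zero 1) 1 Nat.one_lt_two (P.incl 1 m) (P.gen 1)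

theorem muAlpha_eq (P : FDGOperad k) (m : P.obj 2 1) :
    muAlpha P m = mono P [false, true] m + mono P [true, false] m := by
  have h0 := adjComp_mono (P := P) (m := 2) (n := 0) (l := 1) rfl (add_zero (1 : ℤ)) (i := 0) []
    [true] (v := [true, true]) (w := [false]) [false, true] (N := 2) (N' := 1) (L := 2) rfl rfl
    rfl rfl rfl rfl rfl rfl rfl Nat.two_pos m P.one
  have h1 := adjComp_mono (P := P) (m := 2) (n := 0) (l := 1) rfl (add_zero (1 : ℤ)) (i := 1)
    [true] [] (v := [true, true]) (w := [false]) [true, false] (N := 2) (N' := 1) (L := 2) rfl rfl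
    rfl rfl rfl rfl rfl rfl rfl Nat.one_lt_two m P.one
  rw [P.comp_one] at h0 h1
  exact congrArg₂ (· + ·) h0 h1

theorem muAlpha_mc (P : FDGOperad k) (m : P.obj 2 1) (hd : P.diff 2 one_add_one_eq_two m = 0)
    (hm : P.comp (m := 2) (n := 2) (l := 3) rfl one_add_one_eq_two 0 Nat.two_pos m m +
      P.comp (m := 2) (n := 2) (l := 3) rfl one_add_one_eq_two 1 Nat.one_lt_two m m = 0) :
    (P.adjoinMC m hd hm).diff 1 one_add_one_eq_two (muAlpha P m) +
      (P.adjoinMC m hd hm).comp (m := 1) (n := 1) rfl one_add_one_eq_two 0 Nat.one_pos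
        (muAlpha P m) (muAlpha P m) = 0 := by
  have key : adjDiff 1 one_add_one_eq_two (mono P [false, true] m + mono P [true, false] m) +
      mcDer m 1 one_add_one_eq_two (mono P [false, true] m + mono P [true, false] m) +
      adjComp (m := 1) (n := 1) (l := 1) rfl one_add_one_eq_two 0
        (mono P [false, true] m + mono P [true, false] m)
        (mono P [false, true] m + mono P [true, false] m) = 0 := by
    have b1 : bsplits [false, true] = {([], [true])} := by decide
    have b2 : bsplits [true, false] = {([true], [])} := by decide
    have c1 := adjComp_mono (P := P) (m := 1) (n := 1) (l := 1) rfl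
      (one_add_one_eq_two (R := ℤ)) (i := 0) [false] [] (v := [false, true]) (w := [false, true])
      [false, false, true] (N := 2) (N' := 2) (L := 3) rfl rfl rfl rfl rfl rfl rfl rfl rfl
      Nat.one_lt_two m m
    have c2 := adjComp_mono (P := P) (m := 1) (n := 1) (l := 1) rfl
      (one_add_one_eq_two (R := ℤ)) (i := 0) [false] [] (v := [false, true]) (w := [true, false])
      [false, true, false] (N := 2) (N' := 2) (L := 3) rfl rfl rfl rfl rfl rfl rfl rfl rfl
      Nat.one_lt_two m m
    have c3 := adjComp_mono (P := P) (m := 1) (n := 1) (l := 1) rfl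
      (one_add_one_eq_two (R := ℤ)) (i := 0) [] [false] (v := [true, false]) (w := [false, true])
      [false, true, false] (N := 2) (N' := 2) (L := 3) rfl rfl rfl rfl rfl rfl rfl rfl rfl
      Nat.two_pos m m
    have c4 := adjComp_mono (P := P) (m := 1) (n := 1) (l := 1) rfl
      (one_add_one_eq_two (R := ℤ)) (i := 0) [] [false] (v := [true, false]) (w := [true, false])
      [true, false, false] (N := 2) (N' := 2) (L := 3) rfl rfl rfl rfl rfl rfl rfl rfl rfl
      Nat.two_pos m m
    have d1 := mcDer_mono (P := P) m 1 (one_add_one_eq_two (R := ℤ)) [false, true] (N := 2) rfl rfl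
      m
    have d2 := mcDer_mono (P := P) m 1 (one_add_one_eq_two (R := ℤ)) [true, false] (N := 2) rfl rfl
      m
    rw [b1, Finset.sum_singleton, compz_pos _ _ _ _ (show ([] : List Bool).length < 2 from Nat.two_pos)] at d1
    rw [b2, Finset.sum_singleton, compz_pos _ _ _ _ (show [true].length < 2 from Nat.one_lt_two)] at d2
    simp only [map_add, LinearMap.add_apply, c1, c2, c3, c4, d1, d2, adjDiff_mono, hd, mono_zero]
    have hm' := eq_neg_of_add_eq_zero_left hm
    simp only [sgn_one, neg_smul, one_smul, neg_neg, List.nil_append, List.cons_append,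
      List.length_nil, List.length_singleton]
    have e : ∀ w, (mono P w (P.comp (m := 2) (n := 2) (l := 3) rfl one_add_one_eq_two 0
        Nat.two_pos m m) : AdjObj P 1 2) = - mono P w (P.comp (m := 2) (n := 2) (l := 3) rfl
          one_add_one_eq_two 1 Nat.one_lt_two m m) := fun w => by
      rw [hm', ← neg_one_smul k, mono_smul, neg_one_smul]
    simp only [e]
    abel
  rw [show _ = _ from muAlpha_eq P m]
  exact key

/-- The twisted operad `Tw P` of a complete dg ns operad `P` with a closed shifted multiplicative
structure `m`: the operad `P ∨̂ α` with the differential above, twisted by `m(α, -) + m(-, α)`. -/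
def Tw (P : FDGOperad k) (m : P.obj 2 1) (hd : P.diff 2 one_add_one_eq_two m = 0)
    (hm : P.comp (m := 2) (n := 2) (l := 3) rfl one_add_one_eq_two 0 Nat.two_pos m m +
      P.comp (m := 2) (n := 2) (l := 3) rfl one_add_one_eq_two 1 Nat.one_lt_two m m = 0) :
    FDGOperad k :=
  (P.adjoinMC m hd hm).twist (muAlpha P m) (muAlpha_mc P m hd hm)

end Tw

/-! ### The operad of bamboos -/

section ncGerst

/-- The free module on the bamboos with `n ≥ 1` vertices and `d` edges. A bamboo with `n` vertices
is encoded by the word of length `n - 1` whose `j`-th letter tells whether the `j`-th and the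
`(j + 1)`-st vertices are joined by an edge; an element of the module is encoded by its function of
coefficients. -/
def bambooModule (k : Type u) [CommRing k] (n : ℕ) (d : ℤ) : Submodule k (List Bool → k) where
  carrier := {f | ∀ u, ¬(u.length + 1 = n ∧ (u.count true : ℤ) = d) → f u = 0}
  add_mem' hf hg u hu := by rw [Pi.add_apply, hf u hu, hg u hu, add_zero]
  zero_mem' _ _ := rfl
  smul_mem' a f hf u hu := by rw [Pi.smul_apply, hf u hu, smul_zero]

/-- The bamboo encoded by the word `u`. -/
def bamboo (k : Type u) [CommRing k] (u : List Bool) {n : ℕ} {d : ℤ} (hn : u.length + 1 = n)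
    (hd : (u.count true : ℤ) = d) : bambooModule k n d :=
  ⟨Pi.single u 1, fun v hv =>
    Pi.single_eq_of_ne (by rintro rfl; exact hv ⟨hn, hd⟩) 1⟩

/-- The coefficient of `u` in the composition of `f` with `g`, placed at the vertex `i` of `f`: the
word `u` is cut as `x ++ y ++ z`, where `y` is the part that comes from `g`. The sign is given by
the number of edges in `z` times the number of edges in `y`. -/
def bambooCoeff (n i : ℕ) (f g : List Bool → k) (u : List Bool) : k :=
  sgn k ((((u.drop i).drop (n - 1)).count true : ℤ) * (((u.drop i).take (n - 1)).count true : ℤ)) *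
    (f (u.take i ++ (u.drop i).drop (n - 1)) * g ((u.drop i).take (n - 1)))

theorem bambooCoeff_append {n i : ℕ} (f g : List Bool → k) (x y z : List Bool) (hx : x.length = i)
    (hy : y.length = n - 1) : bambooCoeff n i f g (x ++ (y ++ z)) =
      sgn k ((z.count true : ℤ) * (y.count true : ℤ)) * (f (x ++ z) * g y) := by
  subst hx
  simp [bambooCoeff, ← hy]

theorem bambooCoeff_mem {m n l : ℕ} {d e c : ℤ} (hl : l + 1 = m + n) (hc : d + e = c) (i : ℕ)
    {f g : List Bool → k} (hf : f ∈ bambooModule k m d) (hg : g ∈ bambooModule k n e) :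
    bambooCoeff n i f g ∈ bambooModule k l c := by
  intro u hu
  by_cases h1 : (u.take i ++ (u.drop i).drop (n - 1)).length + 1 = m ∧
      ((u.take i ++ (u.drop i).drop (n - 1)).count true : ℤ) = d
  · by_cases h2 : ((u.drop i).take (n - 1)).length + 1 = n ∧
        (((u.drop i).take (n - 1)).count true : ℤ) = e
    · refine absurd ?_ hu
      have hu' : u = u.take i ++ ((u.drop i).take (n - 1) ++ (u.drop i).drop (n - 1)) := by simp
      have l1 := congrArg List.length hu'
      have l2 := congrArg (List.count true) hu'
      simp only [List.length_append, List.count_append] at l1 l2 h1 h2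
      omega
    · rw [bambooCoeff, hg _ h2, mul_zero, mul_zero]
  · rw [bambooCoeff, hf _ h1, zero_mul, mul_zero]

/-- The composition `f ∘ᵢ g`: the bamboo `g` is placed at the vertex `i` of the bamboo `f`. -/
def bambooComp {m n l : ℕ} {d e c : ℤ} (hl : l + 1 = m + n) (hc : d + e = c) (i : ℕ) :
    bambooModule k m d →ₗ[k] bambooModule k n e →ₗ[k] bambooModule k l c :=
  LinearMap.mk₂ k (fun f g => ⟨bambooCoeff n i f.1 g.1, bambooCoeff_mem hl hc i f.2 g.2⟩)
    (fun _ _ _ => Subtype.ext (funext fun u => by simp [bambooCoeff]; ring))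
    (fun _ _ _ => Subtype.ext (funext fun u => by simp [bambooCoeff]; ring))
    (fun _ _ _ => Subtype.ext (funext fun u => by simp [bambooCoeff]; ring))
    (fun _ _ _ => Subtype.ext (funext fun u => by simp [bambooCoeff]; ring))

theorem bamboo_ext {n : ℕ} {d : ℤ} {f g : bambooModule k n d}
    (h : ∀ u : List Bool, u.length + 1 = n → f.1 u = g.1 u) : f = g := by
  refine Subtype.ext (funext fun u => ?_)
  by_cases hu : u.length + 1 = n
  · exact h u hu
  · rw [f.2 u fun h => hu h.1, g.2 u fun h => hu h.1]

theorem bamboo_zero {n : ℕ} (hn : n = 0) {d : ℤ} (f : bambooModule k n d) : f = 0 :=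
  bamboo_ext fun u hu => by omega

theorem exists_append {u : List Bool} {a b : ℕ} (h : u.length = a + b) :
    ∃ x y : List Bool, u = x ++ y ∧ x.length = a ∧ y.length = b :=
  ⟨u.take a, u.drop a, by simp, by simp; omega, by simp; omega⟩

theorem bamboo_comp_seq {m n p mn np l : ℕ} {d e f de ef g : ℤ}
    (h₁ : mn + 1 = m + n) (h₂ : l + 1 = mn + p) (h₃ : np + 1 = n + p) (h₄ : l + 1 = m + np)
    (g₁ : d + e = de) (g₂ : de + f = g) (g₃ : e + f = ef) (g₄ : d + ef = g)
    (i j : ℕ) (hi : i < m) (hj : j < n)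
    (x : bambooModule k m d) (y : bambooModule k n e) (z : bambooModule k p f) :
    bambooComp h₂ g₂ (i + j) (bambooComp h₁ g₁ i x y) z =
      bambooComp h₄ g₄ i x (bambooComp h₃ g₃ j y z) := by
  rcases Nat.eq_zero_or_pos p with hp | hp
  · rw [bamboo_zero hp z]; simp
  refine bamboo_ext fun u hu => ?_
  obtain ⟨x₁, u, rfl, l₁, hu₁⟩ := exists_append (u := u) (a := i)
    (b := j + (p - 1) + (n - 1 - j) + (m - 1 - i)) (by omega)
  obtain ⟨u, x₄, rfl, hu₂, l₄⟩ := exists_append hu₁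
  obtain ⟨u, x₃, rfl, hu₃, l₃⟩ := exists_append hu₂
  obtain ⟨x₂, v, rfl, l₂, lv⟩ := exists_append hu₃
  have e₁ : bambooCoeff n i x.1 y.1 (x₁ ++ x₂ ++ (x₃ ++ x₄)) =
      sgn k ((x₄.count true : ℤ) * ((x₂ ++ x₃).count true : ℤ)) *
        (x.1 (x₁ ++ x₄) * y.1 (x₂ ++ x₃)) := by
    rw [← bambooCoeff_append (n := n) x.1 y.1 x₁ (x₂ ++ x₃) x₄ l₁ (by simp; omega)]
    simp
  have e₂ : bambooCoeff p (i + j) (bambooCoeff n i x.1 y.1) z.1 (x₁ ++ (x₂ ++ v ++ x₃ ++ x₄)) =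
      sgn k (((x₃ ++ x₄).count true : ℤ) * (v.count true : ℤ)) *
        (bambooCoeff n i x.1 y.1 (x₁ ++ x₂ ++ (x₃ ++ x₄)) * z.1 v) := by
    rw [← bambooCoeff_append (i := i + j) _ z.1 (x₁ ++ x₂) v (x₃ ++ x₄) (by simp; omega) lv]
    simp
  have e₃ : bambooCoeff p j y.1 z.1 (x₂ ++ v ++ x₃) =
      sgn k ((x₃.count true : ℤ) * (v.count true : ℤ)) * (y.1 (x₂ ++ x₃) * z.1 v) := by
    rw [← bambooCoeff_append y.1 z.1 x₂ v x₃ l₂ lv]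
    simp
  have e₄ : bambooCoeff np i x.1 (bambooCoeff p j y.1 z.1) (x₁ ++ (x₂ ++ v ++ x₃ ++ x₄)) =
      sgn k ((x₄.count true : ℤ) * ((x₂ ++ v ++ x₃).count true : ℤ)) *
        (x.1 (x₁ ++ x₄) * bambooCoeff p j y.1 z.1 (x₂ ++ v ++ x₃)) :=
    bambooCoeff_append x.1 _ x₁ (x₂ ++ v ++ x₃) x₄ l₁ (by simp; omega)
  have e₅ : sgn k (((x₃ ++ x₄).count true : ℤ) * (v.count true : ℤ)) *
      sgn k ((x₄.count true : ℤ) * ((x₂ ++ x₃).count true : ℤ)) =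
      sgn k ((x₄.count true : ℤ) * ((x₂ ++ v ++ x₃).count true : ℤ)) *
        sgn k ((x₃.count true : ℤ) * (v.count true : ℤ)) := by
    rw [← sgn_add, ← sgn_add]
    congr 1
    simp only [List.count_append]
    push_cast
    ring
  change bambooCoeff p (i + j) (bambooCoeff n i x.1 y.1) z.1 _ =
    bambooCoeff np i x.1 (bambooCoeff p j y.1 z.1) _
  rw [e₂, e₁, e₄, e₃]
  linear_combination (x.1 (x₁ ++ x₄) * y.1 (x₂ ++ x₃) * z.1 v) * e₅

theorem bamboo_comp_par {m n p mn mp l : ℕ} {d e f de df g : ℤ}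
    (h₁ : mn + 1 = m + n) (h₂ : l + 1 = mn + p) (h₃ : mp + 1 = m + p) (h₄ : l + 1 = mp + n)
    (g₁ : d + e = de) (g₂ : de + f = g) (g₃ : d + f = df) (g₄ : df + e = g)
    (i j j' : ℕ) (hij : i < j) (hj : j < m) (hj' : j' + 1 = j + p)
    (x : bambooModule k m d) (y : bambooModule k n e) (z : bambooModule k p f) :
    bambooComp h₂ g₂ i (bambooComp h₁ g₁ j x y) z =
      sgn k (e * f) • bambooComp h₄ g₄ j' (bambooComp h₃ g₃ i x z) y := by
  rcases Nat.eq_zero_or_pos p with hp | hp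
  · rw [bamboo_zero hp z]; simp
  rcases Nat.eq_zero_or_pos n with hn | hn
  · rw [bamboo_zero hn y]; simp
  refine bamboo_ext fun u hu => ?_
  obtain ⟨x₁, u, rfl, l₁, hu₁⟩ := exists_append (u := u) (a := i)
    (b := (p - 1) + (j - i) + (n - 1) + (m - 1 - j)) (by omega)
  obtain ⟨u, x₃, rfl, hu₂, l₃⟩ := exists_append hu₁
  obtain ⟨u, w, rfl, hu₃, lw⟩ := exists_append hu₂
  obtain ⟨v, x₂, rfl, lv, l₂⟩ := exists_append hu₃
  have e₁ : bambooCoeff n j x.1 y.1 (x₁ ++ (x₂ ++ w ++ x₃)) =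
      sgn k ((x₃.count true : ℤ) * (w.count true : ℤ)) *
        (x.1 (x₁ ++ x₂ ++ x₃) * y.1 w) := by
    rw [← bambooCoeff_append (i := j) x.1 y.1 (x₁ ++ x₂) w x₃ (by simp; omega) lw]
    simp
  have e₂ : bambooCoeff p i (bambooCoeff n j x.1 y.1) z.1 (x₁ ++ (v ++ x₂ ++ w ++ x₃)) =
      sgn k (((x₂ ++ w ++ x₃).count true : ℤ) * (v.count true : ℤ)) *
        (bambooCoeff n j x.1 y.1 (x₁ ++ (x₂ ++ w ++ x₃)) * z.1 v) := by
    rw [← bambooCoeff_append _ z.1 x₁ v (x₂ ++ w ++ x₃) l₁ lv]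
    simp
  have e₃ : bambooCoeff p i x.1 z.1 (x₁ ++ v ++ x₂ ++ x₃) =
      sgn k (((x₂ ++ x₃).count true : ℤ) * (v.count true : ℤ)) *
        (x.1 (x₁ ++ x₂ ++ x₃) * z.1 v) := by
    have := bambooCoeff_append x.1 z.1 x₁ v (x₂ ++ x₃) l₁ lv
    simp only [List.append_assoc] at this ⊢
    exact this
  have e₄ : bambooCoeff n j' (bambooCoeff p i x.1 z.1) y.1 (x₁ ++ (v ++ x₂ ++ w ++ x₃)) =
      sgn k ((x₃.count true : ℤ) * (w.count true : ℤ)) *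
        (bambooCoeff p i x.1 z.1 (x₁ ++ v ++ x₂ ++ x₃) * y.1 w) := by
    rw [← bambooCoeff_append (i := j') _ y.1 (x₁ ++ v ++ x₂) w x₃ (by simp; omega) lw]
    simp
  change bambooCoeff p i (bambooCoeff n j x.1 y.1) z.1 _ =
    sgn k (e * f) * bambooCoeff n j' (bambooCoeff p i x.1 z.1) y.1 _
  rw [e₂, e₁, e₄, e₃]
  by_cases hw : w.length + 1 = n ∧ (w.count true : ℤ) = e
  · by_cases hv : v.length + 1 = p ∧ (v.count true : ℤ) = f
    · have e₅ : sgn k (((x₂ ++ w ++ x₃).count true : ℤ) * (v.count true : ℤ)) =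
          sgn k (e * f) * sgn k (((x₂ ++ x₃).count true : ℤ) * (v.count true : ℤ)) := by
        rw [← sgn_add, ← hw.2, ← hv.2]
        congr 1
        simp only [List.count_append]
        push_cast
        ring
      rw [e₅]
      ring
    · rw [z.2 v hv]; ring
  · rw [y.2 w hw]; ring

/-- The ns operad of bamboos, that is the noncommutative Gerstenhaber operad: `ncGerst(0) = 0`, and
`ncGerst(n)` is free on the bamboos with `n` vertices. Its filtration is trivial and its differential
is zero. -/
def ncGerst (k : Type u) [CommRing k] : FDGOperad k where
  obj n d := bambooModule k n d
  fil _ _ := disc _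
  fil_zero _ _ := if_pos rfl
  fil_anti _ _ := disc_antitone _
  one := bamboo k [] rfl rfl
  comp hl hf i _ := bambooComp hl hf i
  comp_mem_fil hl hf i _ _ _ _ _ hx hy := disc_bilin _ hx hy
  one_comp {n d} hl hf x := by
    rcases Nat.eq_zero_or_pos n with hn | hn
    · rw [bamboo_zero hn x]; simp
    refine bamboo_ext fun u hu => ?_
    have := bambooCoeff_append (k := k) (n := n) (i := 0) (Pi.single [] 1) x.1 [] u [] rfl (by omega)
    change bambooCoeff n 0 (Pi.single [] 1) x.1 u = x.1 u
    simpa using this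
  comp_one {m d} hl hf i hi x := by
    refine bamboo_ext fun u hu => ?_
    have := bambooCoeff_append (k := k) (n := 1) (i := i) x.1 (Pi.single [] 1) (u.take i) []
      (u.drop i) (by simp; omega) rfl
    change bambooCoeff 1 i x.1 (Pi.single [] 1) u = x.1 u
    simpa using this
  comp_seq h₁ h₂ h₃ h₄ g₁ g₂ g₃ g₄ i j hi hj _ x y z :=
    bamboo_comp_seq h₁ h₂ h₃ h₄ g₁ g₂ g₃ g₄ i j hi hj x y z
  comp_par h₁ h₂ h₃ h₄ g₁ g₂ g₃ g₄ i j j' hij hj hj' _ _ _ x y z :=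
    bamboo_comp_par h₁ h₂ h₃ h₄ g₁ g₂ g₃ g₄ i j j' hij hj hj' x y z
  diff _ _ _ _ := 0
  diff_mem_fil _ _ _ _ := Submodule.zero_mem _
  diff_diff _ _ _ := rfl
  diff_comp _ _ _ _ _ _ _ _ _ _ _ := by simp

/-- The connected bamboo with two vertices. -/
def edge (k : Type u) [CommRing k] : (ncGerst k).obj 2 1 := bamboo k [true] rfl rfl

/-- The disconnected bamboo with two vertices. -/
def twoPoints (k : Type u) [CommRing k] : (ncGerst k).obj 2 0 := bamboo k [false] rfl rfl

/-- The edge is a shifted multiplicative structure. -/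
theorem edge_assoc (k : Type u) [CommRing k] :
    (ncGerst k).comp (m := 2) (n := 2) (l := 3) rfl one_add_one_eq_two 0 Nat.two_pos (edge k)
      (edge k) + (ncGerst k).comp (m := 2) (n := 2) (l := 3) rfl one_add_one_eq_two 1
        Nat.one_lt_two (edge k) (edge k) = 0 := by
  refine bamboo_ext fun u hu => ?_
  change bambooCoeff 2 0 (Pi.single [true] 1) (Pi.single [true] 1) u +
    bambooCoeff 2 1 (Pi.single [true] 1) (Pi.single [true] 1) u = (0 : k)
  match u, hu with
  | [a, b], _ => cases a <;> cases b <;> simp [bambooCoeff, Pi.single_apply]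

/-- The twisted operad of the noncommutative Gerstenhaber operad, for the shifted multiplicative
structure given by the edge. -/
def TwNcGerst (k : Type u) [CommRing k] : FDGOperad k :=
  (ncGerst k).Tw (edge k) rfl (edge_assoc k)

/-- The connected bamboo with two white vertices. -/
def whiteEdge (k : Type u) [CommRing k] : (TwNcGerst k).obj 2 1 :=
  mono (ncGerst k) [true, true] (edge k)

/-- The bamboo made of two disjoint black vertices. -/
def twoBlackPoints (k : Type u) [CommRing k] : (TwNcGerst k).obj 0 0 :=
  mono (ncGerst k) [false, false] (twoPoints k)

end ncGerst

/-! ### Shifted associative algebras -/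

section sAs

/-- The component of arity `n` and degree `d` of `S⁻¹As`: a copy of `k` for `n ≥ 1` and `d = n - 1`,
and zero otherwise. -/
def sAsModule (k : Type u) [CommRing k] (n : ℕ) (d : ℤ) : Submodule k k where
  carrier := {c | ¬(1 ≤ n ∧ (n : ℤ) = d + 1) → c = 0}
  add_mem' hf hg hu := by rw [hf hu, hg hu, add_zero]
  zero_mem' _ := rfl
  smul_mem' a f hf hu := by rw [hf hu, smul_zero]

/-- The composition of `S⁻¹As`. -/
def sAsComp {m n l : ℕ} {d e c : ℤ} (hl : l + 1 = m + n) (hc : d + e = c) (i : ℕ) :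
    sAsModule k m d →ₗ[k] sAsModule k n e →ₗ[k] sAsModule k l c :=
  LinearMap.mk₂ k (fun a b => ⟨sgn k ((i : ℤ) * ((n : ℤ) - 1)) * (a.1 * b.1), fun h => by
      by_cases h1 : 1 ≤ m ∧ (m : ℤ) = d + 1
      · by_cases h2 : 1 ≤ n ∧ (n : ℤ) = e + 1
        · exact absurd (by omega) h
        · rw [b.2 h2, mul_zero, mul_zero]
      · rw [a.2 h1, zero_mul, mul_zero]⟩)
    (fun _ _ _ => Subtype.ext (by simp; ring)) (fun _ _ _ => Subtype.ext (by simp; ring))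
    (fun _ _ _ => Subtype.ext (by simp; ring)) (fun _ _ _ => Subtype.ext (by simp; ring))

/-- The operad `S⁻¹As`, the tensor product of the operad of associative algebras with the
endomorphism operad of a one-dimensional module: its component of arity `n ≥ 1` is free of rank one
on an element `ν n` of degree `n - 1`, and `ν m ∘ᵢ ν n = (-1) ^ (i * (n - 1)) • ν (m + n - 1)` for
`i = 0, …, m - 1`. It is generated by `b = ν 2`, of degree `1`, subject to the relation that `b` is
anti-associative: `b ∘₀ b = -b ∘₁ b`. -/
def sAs (k : Type u) [CommRing k] : FDGOperad k where
  obj n d := sAsModule k n d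
  fil _ _ := disc _
  fil_zero _ _ := if_pos rfl
  fil_anti _ _ := disc_antitone _
  one := ⟨1, fun h => absurd (by simp) h⟩
  comp hl hf i _ := sAsComp hl hf i
  comp_mem_fil hl hf i _ _ _ _ _ hx hy := disc_bilin _ hx hy
  one_comp hl hf x := Subtype.ext (by simp [sAsComp])
  comp_one hl hf i hi x := Subtype.ext (by simp [sAsComp])
  comp_seq {m n p mn np l d e f de ef g} h₁ h₂ h₃ h₄ g₁ g₂ g₃ g₄ i j hi hj _ x y z := by
    refine Subtype.ext ?_
    have h3 : (np : ℤ) = n + p - 1 := by omega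
    have e₅ : sgn k ((i + j : ℕ) * ((p : ℤ) - 1)) * sgn k (i * ((n : ℤ) - 1)) =
        sgn k (i * ((np : ℤ) - 1)) * sgn k (j * ((p : ℤ) - 1)) := by
      rw [← sgn_add, ← sgn_add, h3]
      congr 1
      push_cast
      ring
    simp only [sAsComp, LinearMap.mk₂_apply]
    linear_combination (x.1 * y.1 * z.1) * e₅
  comp_par {m n p mn mp l d e f de df g} h₁ h₂ h₃ h₄ g₁ g₂ g₃ g₄ i j j' hij hj hj' _ _ _ x y z := by
    refine Subtype.ext ?_
    simp only [sAsComp, LinearMap.mk₂_apply, Submodule.coe_smul, smul_eq_mul]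
    by_cases hy : 1 ≤ n ∧ (n : ℤ) = e + 1
    · by_cases hz : 1 ≤ p ∧ (p : ℤ) = f + 1
      · have h3 : (j' : ℤ) = j + p - 1 := by omega
        have e₅ : sgn k (i * ((p : ℤ) - 1)) * sgn k (j * ((n : ℤ) - 1)) =
            sgn k (e * f) * (sgn k (j' * ((n : ℤ) - 1)) * sgn k (i * ((p : ℤ) - 1))) := by
          rw [← sgn_add, ← sgn_add, ← sgn_add]
          refine sgn_eq_of_even_sub ⟨-(e * f), ?_⟩
          rw [h3, hy.2, hz.2]
          ring
        linear_combination (x.1 * y.1 * z.1) * e₅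
      · rw [z.2 hz]; ring
    · rw [y.2 hy]; ring
  diff _ _ _ _ := 0
  diff_mem_fil _ _ _ _ := Submodule.zero_mem _
  diff_diff _ _ _ := rfl
  diff_comp _ _ _ _ _ _ _ _ _ _ _ := by simp

/-- The generator `b` of `S⁻¹As`. -/
def sAs.b (k : Type u) [CommRing k] : (sAs k).obj 2 1 := ⟨1, fun h => absurd (by norm_num) h⟩

/-- The coproduct `S⁻¹As ∨̂ γ` in complete operads, where the closed generator `γ` of arity `0` and
degree `0` is placed in `F_w`. -/
def sAsFree (k : Type u) [CommRing k] (w : ℕ) : FDGOperad k := (sAs k).adjoin w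

/-- The generator `b` of `S⁻¹As ∨̂ γ`. -/
def sAsFree.b (k : Type u) [CommRing k] (w : ℕ) : (sAsFree k w).obj 2 1 := (sAs k).incl w (sAs.b k)

/-- The generator `γ` of `S⁻¹As ∨̂ γ`. -/
def sAsFree.γ (k : Type u) [CommRing k] (w : ℕ) : (sAsFree k w).obj 0 0 := (sAs k).gen w

/-- The relators `b(γ, -)` and `b(-, γ)`. -/
inductive SAsPlusRel (k : Type u) [CommRing k] (w : ℕ) :
    ∀ (n : ℕ) (d : ℤ), (sAsFree k w).obj n d → Prop
  | left : SAsPlusRel k w 1 1 ((sAsFree k w).comp (m := 2) (n := 0) rfl (add_zero 1) 0 Nat.two_pos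
      (sAsFree.b k w) (sAsFree.γ k w))
  | right : SAsPlusRel k w 1 1 ((sAsFree k w).comp (m := 2) (n := 0) rfl (add_zero 1) 1
      Nat.one_lt_two (sAsFree.b k w) (sAsFree.γ k w))

/-- The complete operad `S⁻¹As⁺`, the quotient of `S⁻¹As ∨̂ γ` by the relations `b(γ, -) = 0` and
`b(-, γ) = 0`. -/
def sAsPlus (k : Type u) [CommRing k] (w : ℕ) : FDGOperad k :=
  (sAsFree k w).presented fun n d => {x | SAsPlusRel k w n d x}

/-- The projection from `S⁻¹As ∨̂ γ` to `S⁻¹As⁺`. -/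
def sAsPlus.mk (k : Type u) [CommRing k] (w : ℕ) {n : ℕ} {d : ℤ} (x : (sAsFree k w).obj n d) :
    (sAsPlus k w).obj n d :=
  presented.mk _ _ x

end sAs

end FDGOperad

end NSOp

/-! An element of `TwNcGerst k` is a function on coloured bamboos: a word `V` of colours and a word
`U` of edges. In these coefficients the twisted differential is dual to the contraction of edges.
The derivation `D` splits a black vertex into two joined black ones, `x ⋆ μ` splits a white vertex
into a white one joined to a black one, and `μ ⋆ x` hangs a black vertex on either end. Once an
auxiliary white vertex is joined to both ends of every bamboo, the end terms become contractions
too, and the differential is the single operator `contr` (`coef_twDiff`).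

That complex is almost contractible. Inserting a black vertex, joined by an edge, after the initial
connected white run is a homotopy: contracting the new edge gives the bamboo back and all other
terms cancel (`contr_htpy_add_htpy_contr`). It must be modified when the first vertex is black and
followed by a gap, because absorbing that vertex would detach the auxiliary one; the new black
vertex then goes after the gap (`contr_totHtpy_add_totHtpy_contr`). Two kinds of bamboos escape: the
connected white ones, in which no edge can be contracted, and the pair of disjoint black vertices.
Their coefficients vanish on coboundaries, and a cocycle on which they vanish is a coboundary
(`twDiff_primitive`, `cls_eq_zero_iff`).

On the other side, `S⁻¹As ∨̂ γ` has in degree `d` a finite basis for each arity: the words of length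
`d + 1` in inputs and `γ`. Hence `b` and `γ` generate it algebraically (`sAsFree_generated`), which
gives uniqueness of `φ` and reduces the cocycle condition to two elements. The map `phi` sends a
word to the bamboo in which consecutive letters are joined and each `γ` becomes two disjoint black
vertices, with a binomial sign that compensates the two sign conventions (`phi_adjComp`). The
relators generate all words containing `γ` except `γ` itself (`mem_relIdeal`), so the quotient is
spanned by the `ν n` and `γ`, on which the two surviving coefficients are dual up to sign. This
gives bijectivity.

As for filtrations, the surviving classes have zero or two black vertices, so `F₃` vanishes in the
cohomology, and also in the quotient since `w ≤ 2`. Completeness and continuity of the inverse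
follow; for `w = 2` the weight of `γ` equals that of its image and the inverse is filtered. -/

namespace NSOp
namespace FDGOperad

/-! ### Contracting homotopies on coloured bamboos -/

section BambooHomotopy

variable {k : Type u} [CommRing k]

/-- The operator on functions of coloured bamboos (a word of colours, `true` for white, and a word
of edges) which sums, with alternating signs, the values at the bamboos obtained by contracting an
edge that is not between two white vertices. -/
def contr : (List Bool → List Bool → k) → List Bool → List Bool → k
  | G, c :: c' :: V, true :: U => (if c && c' then 0 else G ((c || c') :: V) U) -
      contr (fun V U => G (c :: V) (true :: U)) (c' :: V) U
  | G, c :: c' :: V, false :: U => contr (fun V U => G (c :: V) (false :: U)) (c' :: V) U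
  | _, [], _ => 0
  | _, [_], _ => 0
  | _, _ :: _ :: _, [] => 0

@[simp] theorem contr_nil (G : List Bool → List Bool → k) (U : List Bool) :
    contr G [] U = 0 := by simp [contr]

@[simp] theorem contr_singleton (G : List Bool → List Bool → k) (c : Bool) (U : List Bool) :
    contr G [c] U = 0 := by simp [contr]

@[simp] theorem contr_edges_nil (G : List Bool → List Bool → k) (V : List Bool) :
    contr G V [] = 0 := by
  match V with
  | [] => simp
  | [_] => simp
  | _ :: _ :: _ => simp [contr]

theorem contr_cons_true (G : List Bool → List Bool → k) (c c' : Bool) (V U : List Bool) :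
    contr G (c :: c' :: V) (true :: U) = (if c && c' then 0 else G ((c || c') :: V) U) -
      contr (fun V U => G (c :: V) (true :: U)) (c' :: V) U := by
  rw [contr]

theorem contr_cons_false (G : List Bool → List Bool → k) (c c' : Bool) (V U : List Bool) :
    contr G (c :: c' :: V) (false :: U) =
      contr (fun V U => G (c :: V) (false :: U)) (c' :: V) U := by
  rw [contr]

theorem contr_neg (G : List Bool → List Bool → k) (V U : List Bool) :
    contr (fun V U => -G V U) V U = -contr G V U := by
  induction U generalizing V G with
  | nil => simp
  | cons u U ih =>
    match V with
    | [] => simp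
    | [_] => simp
    | c :: c' :: V =>
      cases u
      · rw [contr_cons_false, contr_cons_false, ih]
      · rw [contr_cons_true, contr_cons_true, ih]
        split_ifs <;> ring

theorem contr_congr {G G' : List Bool → List Bool → k}
    (h : ∀ c V U, G (c :: V) U = G' (c :: V) U) (V U : List Bool) :
    contr G V U = contr G' V U := by
  match V, U with
  | [], _ => simp
  | [_], _ => simp
  | _ :: _ :: _, [] => simp
  | _ :: _ :: _, true :: U => simp only [contr_cons_true, h]
  | _ :: _ :: _, false :: U => simp only [contr_cons_false, h]

/-- A white vertex absorbs whatever is contracted into it, so a word that starts with white only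
produces words that start with white. -/
theorem contr_congr_white {G G' : List Bool → List Bool → k}
    (h : ∀ V U, G (true :: V) U = G' (true :: V) U) (V U : List Bool) :
    contr G (true :: V) U = contr G' (true :: V) U := by
  match V, U with
  | [], _ => simp
  | _ :: _, [] => simp
  | _ :: _, true :: U => simp only [contr_cons_true, h, Bool.true_or]
  | _ :: _, false :: U => simp only [contr_cons_false, h]

/-- A one-vertex word can arise only by contracting a two-vertex word; `hV` leaves only the white
pair, whose edge is never contracted. This serves a homotopy formula that is valid only when at
least two vertices remain. -/
theorem contr_congr_of_two_le {G G' : List Bool → List Bool → k}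
    (h : ∀ c c' V U, G (c :: c' :: V) U = G' (c :: c' :: V) U) {V U : List Bool}
    (hV : ∀ c c', V = [c, c'] → c && c') :
    contr G V U = contr G' V U := by
  match V, U with
  | [], _ => simp
  | [_], _ => simp
  | _ :: _ :: _, [] => simp
  | c :: c' :: V, false :: U =>
    rw [contr_cons_false, contr_cons_false]
    exact contr_congr (fun _ _ _ => h _ _ _ _) _ _
  | c :: c' :: V, true :: U =>
    rw [contr_cons_true, contr_cons_true]
    congr 1
    · cases V with
      | nil => simp [hV c c' rfl]
      | cons c'' V => rw [h]
    · exact contr_congr (fun _ _ _ => h _ _ _ _) _ _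

/-- The homotopy which evaluates at the bamboo obtained by inserting, with an edge, a black vertex
after the largest connected white initial part. -/
def htpy : (List Bool → List Bool → k) → List Bool → List Bool → k
  | G, c :: true :: V, true :: U => -htpy (fun V U => G (c :: V) (true :: U)) (true :: V) U
  | G, c :: V, U => G (c :: false :: V) (true :: U)
  | _, [], _ => 0

theorem htpy_true (G : List Bool → List Bool → k) (c : Bool) (V U : List Bool) :
    htpy G (c :: true :: V) (true :: U) =
      -htpy (fun V U => G (c :: V) (true :: U)) (true :: V) U := by
  rw [htpy]

theorem htpy_black (G : List Bool → List Bool → k) (c : Bool) (V U : List Bool) :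
    htpy G (c :: false :: V) U = G (c :: false :: false :: V) (true :: U) := by
  rw [htpy]; simp

theorem htpy_gap (G : List Bool → List Bool → k) (c : Bool) (V U : List Bool) :
    htpy G (c :: V) (false :: U) = G (c :: false :: V) (true :: false :: U) := by
  rw [htpy]; simp

theorem htpy_edges_nil (G : List Bool → List Bool → k) (c : Bool) (V : List Bool) :
    htpy G (c :: V) [] = G (c :: false :: V) [true] := by
  rw [htpy]; simp

theorem htpy_singleton (G : List Bool → List Bool → k) (c : Bool) (U : List Bool) :
    htpy G [c] U = G [c, false] (true :: U) := by
  rw [htpy]; simp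

theorem htpy_neg (G : List Bool → List Bool → k) (c : Bool) (V U : List Bool) :
    htpy (fun V U => -G V U) (c :: V) U = -htpy G (c :: V) U := by
  induction U generalizing c V G with
  | nil => simp [htpy_edges_nil]
  | cons u U ih =>
    match V, u with
    | [], _ => simp [htpy_singleton]
    | c' :: V, false => simp [htpy_gap]
    | false :: V, true => simp [htpy_black]
    | true :: V, true => simp [htpy_true, ih]

theorem htpy_congr {G G' : List Bool → List Bool → k} {c : Bool}
    (h : ∀ V U, G (c :: V) U = G' (c :: V) U) (V U : List Bool) :
    htpy G (c :: V) U = htpy G' (c :: V) U := by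
  match V, U with
  | [], _ => simp [htpy_singleton, h]
  | _ :: _, [] => simp [htpy_edges_nil, h]
  | _ :: _, false :: _ => simp [htpy_gap, h]
  | false :: _, true :: _ => simp [htpy_black, h]
  | true :: _, true :: _ => simp [htpy_true, h]

/-- The new edge contracts back to the original word, which produces the right-hand side; a
contraction elsewhere occurs in both composites, and the extra edge to its left makes the signs
opposite. The hypothesis `h` says that the initial connected white run is not the whole bamboo. -/
theorem contr_htpy_add_htpy_contr (G : List Bool → List Bool → k) {V U : List Bool}
    (hl : V.length = U.length) (h : false ∈ V ∨ false ∈ U) :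
    contr (htpy G) (true :: V) U + htpy (contr G) (true :: V) U = G (true :: V) U := by
  induction U generalizing V G with
  | nil => obtain rfl := List.length_eq_zero_iff.1 hl; simp at h
  | cons u U ih =>
    match V, u with
    -- The run stops at a gap: the remaining contractions lie beyond the gap and cancel in pairs.
    | c :: V, false =>
      simp only [htpy_gap, contr_cons_true, contr_cons_false, Bool.true_and, Bool.true_or,
        Bool.false_eq_true, if_false]
      ring
    -- A white–white edge is not contracted, so both operators commute with removing the leading
    -- vertex up to the sign of its edge; the two signs in each composite cancel and the induction
    -- applies to the shifted function.
    | true :: V, true =>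
      have e1 : contr (htpy G) (true :: true :: V) (true :: U) =
          contr (htpy fun V U => G (true :: V) (true :: U)) (true :: V) U := by
        rw [contr_cons_true, contr_congr_white
          (G' := fun V U => -htpy (fun V U => G (true :: V) (true :: U)) V U)
          (fun V U => htpy_true G true V U), contr_neg]
        simp
      have e2 : htpy (contr G) (true :: true :: V) (true :: U) =
          htpy (contr fun V U => G (true :: V) (true :: U)) (true :: V) U := by
        rw [htpy_true, htpy_congr (G' := fun V U => -contr (fun V U => G (true :: V) (true :: U))
          V U) (fun V U => by rw [contr_cons_true]; simp), htpy_neg, neg_neg]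
      rw [e1, e2]
      exact ih _ (by simpa using hl) (by simpa using h)
    | false :: V, true =>
      match V, U with
      | [], [] => simp [contr_cons_true, htpy_singleton, htpy_black]
      | [], _ :: _ => simp at hl
      | _ :: _, [] => simp at hl
      -- Black is neutral for `||`: a black vertex may be absorbed to the left or to the right with
      -- the same resulting word and opposite signs. This removes the terms in which the black
      -- vertex ending the white run disappears.
      | c :: V, true :: U =>
        simp only [htpy_black, contr_cons_true, Bool.true_and, Bool.true_or, Bool.false_and,
          Bool.false_or, Bool.false_eq_true, if_false]
        ring
      | c :: V, false :: U =>
        simp only [htpy_black, htpy_gap, contr_cons_true, contr_cons_false, Bool.true_and,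
          Bool.true_or, Bool.false_and, Bool.false_or, Bool.false_eq_true, if_false]
        ring

/-- The contracting homotopy of the complex of coloured bamboos with a white vertex attached to
both ends. -/
def totHtpy (G : List Bool → List Bool → k) : List Bool → List Bool → k
  | true :: true :: V, true :: U => -htpy (fun V U => G (true :: V) (true :: U)) (true :: V) U
  | true :: false :: V, true :: true :: U => G (true :: false :: false :: V) (true :: true :: true :: U)
  | true :: false :: c :: V, true :: false :: u :: U =>
    -G (true :: false :: false :: c :: V) (true :: false :: true :: u :: U)
  | _, _ => 0

theorem totHtpy_white (G : List Bool → List Bool → k) (V U : List Bool) :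
    totHtpy G (true :: true :: V) (true :: U) =
      -htpy (fun V U => G (true :: V) (true :: U)) (true :: V) U := by
  rw [totHtpy]

theorem totHtpy_black (G : List Bool → List Bool → k) (V U : List Bool) :
    totHtpy G (true :: false :: V) (true :: true :: U) =
      G (true :: false :: false :: V) (true :: true :: true :: U) := by
  rw [totHtpy]

theorem totHtpy_gap (G : List Bool → List Bool → k) (c u : Bool) (V U : List Bool) :
    totHtpy G (true :: false :: c :: V) (true :: false :: u :: U) =
      -G (true :: false :: false :: c :: V) (true :: false :: true :: u :: U) := by
  rw [totHtpy]

theorem totHtpy_not_edge (G : List Bool → List Bool → k) (V U : List Bool) :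
    totHtpy G V (false :: U) = 0 := by
  rw [totHtpy] <;> simp

/-- By `htpy_true` and `htpy_black`, `totHtpy` takes the same value as `htpy` unless the first
vertex after the auxiliary white one is black and followed by a gap. In that case the part beyond
the gap has a free left end, and a black vertex is attached there; its minus sign is that of the one
edge to the left of the new edge. The excluded word is the extension of two disjoint black vertices.
-/
theorem contr_totHtpy_add_totHtpy_contr (G : List Bool → List Bool → k)
    (hG : ∀ V U, G V (false :: U) = 0) (hG' : ∀ V U, V.length ≠ U.length + 1 → G V U = 0)
    {V U : List Bool}
    (hl : V.length = U.length) (hV : V.getLast? = some true) (hU : U.getLast? = some true)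
    (hU' : U.head? = some true)
    (h : false ∈ V ∨ false ∈ U) (h' : ¬ (V = [false, false, true] ∧ U = [true, false, true])) :
    contr (totHtpy G) (true :: V) U + totHtpy (contr G) (true :: V) U = G (true :: V) U := by
  match V, U with
  | [], _ => simp at hV
  | _ , [] => simp at hU
  | _, false :: _ => simp at hU'
  | true :: V, true :: U =>
    have e1 : contr (totHtpy G) (true :: true :: V) (true :: U) =
        contr (htpy fun V U => G (true :: V) (true :: U)) (true :: V) U := by
      rw [contr_cons_true, contr_congr_white
        (G' := fun V U => -htpy (fun V U => G (true :: V) (true :: U)) V U)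
        (fun V U => totHtpy_white G V U), contr_neg]
      simp
    have e2 : totHtpy (contr G) (true :: true :: V) (true :: U) =
        htpy (contr fun V U => G (true :: V) (true :: U)) (true :: V) U := by
      rw [totHtpy_white, htpy_congr (G' := fun V U => -contr (fun V U => G (true :: V) (true :: U))
        V U) (fun V U => by rw [contr_cons_true]; simp), htpy_neg, neg_neg]
    rw [e1, e2]
    exact contr_htpy_add_htpy_contr _ (by simpa using hl) (by simpa using h)
  | [false], _ => simp at hV
  | false :: c :: V, [true] => simp at hl
  -- Here the computation is that of `htpy` next to a joined black vertex.
  | false :: c :: V, true :: true :: U =>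
    simp only [totHtpy_black, contr_cons_true, Bool.true_and, Bool.true_or, Bool.false_and,
      Bool.false_or, Bool.false_eq_true, if_false]
    ring
  | false :: c :: V, [true, false] => simp at hU
  | [false, c], true :: false :: u :: U => simp at hl
  | false :: c :: c' :: V, true :: false :: u :: U =>
    have e1 : contr (fun V U => totHtpy G (true :: false :: V) (true :: false :: U))
        (c :: c' :: V) (u :: U) =
        -contr (fun V U => G (true :: false :: false :: V) (true :: false :: true :: U))
          (c :: c' :: V) (u :: U) := by
      rw [← contr_neg]
      refine contr_congr_of_two_le (fun a b W T => ?_) ?_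
      · cases T with
        | nil =>
          rw [hG' _ _ (by simp), totHtpy] <;> simp
        | cons t T => rw [totHtpy_gap]
      -- With two letters beyond the gap, the last one is the auxiliary white end. If the other were
      -- black, the word would be the excluded one; so both are white, as `contr_congr_of_two_le`
      -- requires.
      · intro a b hab
        obtain ⟨rfl, rfl, rfl⟩ : c = a ∧ c' = b ∧ V = [] := by simpa using hab
        obtain rfl : U = [] := by simpa using hl.symm
        simp at hV hU
        subst hV hU
        cases c
        · simp at h'
        · rfl
    -- Absorbing the isolated black vertex into the auxiliary white one leaves a gap at the left
    -- end, where both `totHtpy G` and `G` vanish.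
    have e2 : totHtpy G (true :: c :: c' :: V) (false :: u :: U) = 0 := totHtpy_not_edge _ _ _
    rw [contr_cons_true, contr_cons_false, e1, totHtpy_gap]
    simp only [contr_cons_true, contr_cons_false, Bool.true_and, Bool.true_or, Bool.false_and,
      Bool.false_or, Bool.false_eq_true, if_false, e2, hG]
    ring

/-- Well-formed words whose last vertex is white and attached to the rest. -/
def EndsWhite (V U : List Bool) : Prop :=
  V.getLast? = some true ∧ U.getLast? = some true ∧ V.length = U.length + 1

theorem endsWhite_cons_cons {c c' u u' : Bool} {V U : List Bool} :
    EndsWhite (c :: c' :: V) (u :: u' :: U) ↔ EndsWhite (c' :: V) (u' :: U) := by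
  simp [EndsWhite]

/-- `htpy` acts on all functions, not only on those supported on words with a white attached right
end. Each of its values is up to sign one value of `G`, and the last two clauses compare the right
ends of the two words. The implication from the longer word confines the support of a primitive; the
opposite one ensures that the error term only reads coefficients of an actual differential. -/
theorem exists_of_htpy_ne_zero {G : List Bool → List Bool → k} {c : Bool} {V U : List Bool}
    (h : htpy G (c :: V) U ≠ 0) : ∃ V' U', G (c :: V') U' ≠ 0 ∧
      V'.count true = V.count true ∧ U'.count true = U.count true + 1 ∧ U' ≠ [] ∧
      (EndsWhite (c :: V') U' → EndsWhite (c :: V) U) ∧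
      (false ∈ V ∨ false ∈ U → EndsWhite (c :: V) U → EndsWhite (c :: V') U') := by
  induction U generalizing c V G with
  | nil =>
    rw [htpy_edges_nil] at h
    refine ⟨_, _, h, by simp, by simp, by simp, ?_⟩
    cases V <;> simp [EndsWhite]
  | cons u U ih =>
    match V, u with
    | [], _ =>
      rw [htpy_singleton] at h
      exact ⟨_, _, h, by simp, by simp, by simp, by simp [EndsWhite]⟩
    | c' :: V, false =>
      rw [htpy_gap] at h
      exact ⟨_, _, h, by simp, by simp, by simp, by simp [EndsWhite]⟩
    | false :: V, true =>
      rw [htpy_black] at h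
      exact ⟨_, _, h, by simp, by simp, by simp, by simp [EndsWhite]⟩
    | true :: V, true =>
      rw [htpy_true, neg_ne_zero] at h
      obtain ⟨V', U', h, h1, h2, h3, h4, h5⟩ := ih h
      refine ⟨_, _, h, by simp [h1], by simp [h2], by simp, ?_⟩
      obtain ⟨u', U', rfl⟩ := List.exists_cons_of_ne_nil h3
      cases U with
      | cons u U => simpa only [endsWhite_cons_cons, List.mem_cons, Bool.false_eq_true, false_or,
        reduceCtorEq] using And.intro h4 h5
      | nil =>
        constructor
        · intro h6
          exact absurd (h4 (by simpa [EndsWhite] using h6)) (by simp [EndsWhite])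
        · intro h6 h7
          cases V <;> simp [EndsWhite] at h6 h7

theorem exists_of_totHtpy_ne_zero {G : List Bool → List Bool → k} {V U : List Bool}
    (h : totHtpy G V U ≠ 0) : ∃ V' U', G V' U' ≠ 0 ∧ V'.count true = V.count true ∧
      U'.count true = U.count true + 1 ∧ V.head? = some true ∧ U.head? = some true ∧
      V'.head? = some true ∧ U'.head? = some true ∧ (EndsWhite V' U' → EndsWhite V U) ∧
      (false ∈ V ∨ false ∈ U → EndsWhite V U → EndsWhite V' U') := by
  match V, U with
  | [], _ => exact absurd (by rw [totHtpy] <;> simp) h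
  | false :: _, _ => exact absurd (by rw [totHtpy] <;> simp) h
  | [true], _ => exact absurd (by rw [totHtpy] <;> simp) h
  | _, [] => exact absurd (by rw [totHtpy] <;> simp) h
  | _, false :: _ => exact absurd (totHtpy_not_edge _ _ _) h
  | true :: true :: V, true :: U =>
    rw [totHtpy_white, neg_ne_zero] at h
    obtain ⟨V', U', h, h1, h2, h3, h4, h5⟩ := exists_of_htpy_ne_zero h
    refine ⟨_, _, h, by simp [h1], by simp [h2], rfl, rfl, rfl, rfl, ?_⟩
    obtain ⟨u', U', rfl⟩ := List.exists_cons_of_ne_nil h3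
    cases U with
    | cons u U => simpa only [endsWhite_cons_cons, List.mem_cons, Bool.false_eq_true, false_or,
        reduceCtorEq] using And.intro h4 h5
    | nil =>
      constructor
      · intro h6
        exact absurd (h4 (by simpa [EndsWhite] using h6)) (by simp [EndsWhite])
      · intro h6 h7
        cases V <;> simp [EndsWhite] at h6 h7
  | true :: false :: V, [true] => exact absurd (by rw [totHtpy] <;> simp) h
  | true :: false :: V, true :: true :: U =>
    rw [totHtpy_black] at h
    exact ⟨_, _, h, by simp, by simp, rfl, rfl, rfl, rfl, by simp [EndsWhite]⟩
  | [true, false], true :: false :: U => exact absurd (by rw [totHtpy] <;> simp) h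
  | true :: false :: c :: V, [true, false] => exact absurd (by rw [totHtpy] <;> simp) h
  | true :: false :: c :: V, true :: false :: u :: U =>
    rw [totHtpy_gap, neg_ne_zero] at h
    exact ⟨_, _, h, by simp, by simp, rfl, rfl, rfl, rfl, by simp [EndsWhite]⟩

/-- The contribution to `contr` of the `p`-th edge. -/
def contrTerm (G : List Bool → List Bool → k) (V U : List Bool) (p : ℕ) : k :=
  if U[p]? = some true ∧ ¬ (V[p]? = some true ∧ V[p + 1]? = some true) then
    sgn k ((U.take p).count true) *
      G (V.take p ++ (V.getD p true || V.getD (p + 1) true) :: V.drop (p + 2))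
        (U.take p ++ U.drop (p + 1)) else 0

theorem contrTerm_append (G : List Bool → List Bool → k) {x y : List Bool} {p : ℕ}
    (hx : x.length = p) (hy : y.length = p) (a b u : Bool) (z w : List Bool) :
    contrTerm G (x ++ a :: b :: z) (y ++ u :: w) p =
      if u && !(a && b) then sgn k (y.count true) * G (x ++ (a || b) :: z) (y ++ w) else 0 := by
  subst hx
  have h1 : (y ++ u :: w)[x.length]? = some u := by simp [← hy]
  have h2 : (y ++ u :: w).take x.length = y := by simp [← hy]
  have h3 : (y ++ u :: w).drop (x.length + 1) = w := by simp [← hy]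
  rw [contrTerm, h1, h2, h3]
  cases a <;> cases b <;> cases u <;> simp

/-- Each edge passed by the recursion contributes `-1`, so the sign of a contraction counts the
edges on its left. -/
theorem contr_eq_sum (G : List Bool → List Bool → k) {V U : List Bool}
    (hl : V.length = U.length + 1) :
    contr G V U = ∑ p ∈ Finset.range U.length, contrTerm G V U p := by
  induction U generalizing V G with
  | nil => simp
  | cons u U ih =>
    match V, u with
    | [], _ => simp at hl
    | [_], _ => simp at hl
    | c :: c' :: V, true =>
      rw [contr_cons_true, ih _ (by simpa using hl), List.length_cons, Finset.sum_range_succ']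
      simp only [contrTerm, List.getElem?_cons_succ, List.take_succ_cons, List.drop_succ_cons,
        List.getElem?_cons_zero, List.getD_cons_zero, List.getD_cons_succ, List.take_zero,
        List.count_nil, List.count_cons_self, List.drop_zero, List.nil_append, List.cons_append]
      rw [sub_eq_neg_add, ← Finset.sum_neg_distrib]
      congr 1
      · refine Finset.sum_congr rfl fun p _ => ?_
        split_ifs
        · rw [Nat.cast_add, sgn_add]; simp
        · simp
      · cases c <;> cases c' <;> simp
    | c :: c' :: V, false =>
      rw [contr_cons_false, ih _ (by simpa using hl), List.length_cons, Finset.sum_range_succ']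
      simp only [contrTerm, List.getElem?_cons_succ, List.take_succ_cons, List.drop_succ_cons,
        List.getElem?_cons_zero, List.getD_cons_zero, List.getD_cons_succ, List.take_zero,
        List.count_nil, List.drop_zero, List.nil_append, List.cons_append]
      simp

end BambooHomotopy

/-! ### Sums over factorisations, reindexed by positions in a bamboo -/

section Cuts

theorem exists_eq_append_cons_cons {V : List Bool} {p : ℕ} (hp : p + 1 < V.length) :
    ∃ x a b z, V = x ++ a :: b :: z ∧ x.length = p := by
  refine ⟨V.take p, V[p], V[p + 1], V.drop (p + 2), ?_, by simp; omega⟩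
  rw [← List.drop_eq_getElem_cons, ← List.drop_eq_getElem_cons, List.take_append_drop]

/-- These are the adjacent black pairs, which come from `D(α) = -m(α, α)`. -/
theorem sum_bcuts {M : Type*} [AddCommMonoid M] (V : List Bool) (g : List Bool → List Bool → M) :
    ∑ t ∈ bcuts V, g t.1 t.2 = ∑ p ∈ Finset.range (V.length - 1),
      if V[p]? = some false ∧ V[p + 1]? = some false then g (V.take p) (V.drop (p + 2)) else 0 := by
  rw [← Finset.sum_filter]
  refine Finset.sum_nbij' (fun t => t.1.length) (fun p => (V.take p, V.drop (p + 2))) ?_ ?_ ?_ ?_ ?_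
  · rintro ⟨x, z⟩ ht
    obtain rfl := mem_bcuts.1 ht
    simp
  · intro p hp
    simp only [Finset.mem_filter, Finset.mem_range] at hp
    obtain ⟨x, a, b, z, rfl, rfl⟩ := exists_eq_append_cons_cons (V := V) (p := p) (by omega)
    have := hp.2
    simp at this
    simp [mem_bcuts, this]
  · rintro ⟨x, z⟩ ht
    obtain rfl := mem_bcuts.1 ht
    simp
  · intro p hp
    simp only [Finset.mem_filter, Finset.mem_range] at hp
    simp; omega
  · rintro ⟨x, z⟩ ht
    obtain rfl := mem_bcuts.1 ht
    simp

/-- These are the adjacent pairs of different colours, which come from `x ⋆ μ`. The input `i` at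
which `μ` is plugged is determined by the position, as the number of white vertices before it. -/
theorem sum_cuts_one {M : Type*} [AddCommMonoid M] (V : List Bool)
    (g : List Bool → List Bool → M) :
    ∑ i ∈ Finset.range (V.count true), ∑ t ∈ cuts V i 1,
      (if t.2.1 = [false, true] ∨ t.2.1 = [true, false] then g t.1 t.2.2 else 0) =
    ∑ p ∈ Finset.range (V.length - 1),
      if V[p]? ≠ V[p + 1]? then g (V.take p) (V.drop (p + 2)) else 0 := by
  simp only [← Finset.sum_filter]
  rw [Finset.sum_sigma']
  refine Finset.sum_nbij' (fun t => t.2.1.length) (fun p => ⟨(V.take p).count true,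
    (V.take p, (V.drop p).take 2, V.drop (p + 2))⟩) ?_ ?_ ?_ ?_ ?_
  · rintro ⟨i, x, y, z⟩ ht
    simp only [Finset.mem_sigma, Finset.mem_filter, mem_cuts] at ht
    obtain ⟨-, ⟨rfl, -, -⟩, rfl | rfl⟩ := ht <;> simp
  · intro p hp
    simp only [Finset.mem_filter, Finset.mem_range] at hp
    obtain ⟨x, a, b, z, rfl, rfl⟩ := exists_eq_append_cons_cons (V := V) (p := p) (by omega)
    have := hp.2
    simp at this
    cases a <;> cases b <;> simp [mem_cuts] at this ⊢
  · rintro ⟨i, x, y, z⟩ ht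
    simp only [Finset.mem_sigma, Finset.mem_filter, mem_cuts] at ht
    obtain ⟨-, ⟨rfl, rfl, -⟩, rfl | rfl⟩ := ht <;> simp
  · intro p hp
    simp only [Finset.mem_filter, Finset.mem_range] at hp
    simp; omega
  · rintro ⟨i, x, y, z⟩ ht
    simp only [Finset.mem_sigma, Finset.mem_filter, mem_cuts] at ht
    obtain ⟨-, ⟨rfl, -, -⟩, rfl | rfl⟩ := ht <;> simp

/-- In `μ ⋆ x` the outer word is that of `m(α, -)` or of `m(-, α)`, so a single black letter lies
outside `x`, at one end. -/
theorem sum_cuts_zero {M : Type*} [AddCommMonoid M] (V : List Bool) (g : List Bool → M)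
    (g' : List Bool → M) :
    ∑ t ∈ cuts V 0 (V.count true), ((if t.1 = [false] ∧ t.2.2 = [] then g t.2.1 else 0) +
      (if t.1 = [] ∧ t.2.2 = [false] then g' t.2.1 else 0)) =
    (if V.head? = some false then g V.tail else 0) +
      (if V.getLast? = some false then g' V.dropLast else 0) := by
  rw [Finset.sum_add_distrib]
  congr 1
  · split_ifs with h
    · obtain ⟨V, rfl⟩ : ∃ W, V = false :: W := by
        cases V <;> simp_all
      rw [Finset.sum_eq_single ([false], V, [])]
      · simp
      · rintro ⟨x, y, z⟩ ht hne
        obtain ⟨h1, -, -⟩ := mem_cuts.1 ht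
        rw [if_neg]
        rintro ⟨rfl, rfl⟩
        simp at h1 hne
        exact hne h1
      · intro ht
        simp [mem_cuts] at ht
    · refine Finset.sum_eq_zero fun t ht => if_neg ?_
      obtain ⟨x, y, z⟩ := t
      obtain ⟨rfl, -, -⟩ := mem_cuts.1 ht
      rintro ⟨rfl, rfl⟩
      simp at h
  · split_ifs with h
    · obtain ⟨V, rfl⟩ := List.getLast?_eq_some_iff.1 h
      rw [Finset.sum_eq_single ([], V, [false])]
      · simp
      · rintro ⟨x, y, z⟩ ht hne
        obtain ⟨h1, -, -⟩ := mem_cuts.1 ht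
        rw [if_neg]
        rintro ⟨rfl, rfl⟩
        simp at h1 hne
        exact hne h1
      · intro ht
        simp [mem_cuts] at ht
    · refine Finset.sum_eq_zero fun t ht => if_neg ?_
      obtain ⟨x, y, z⟩ := t
      obtain ⟨rfl, -, -⟩ := mem_cuts.1 ht
      rintro ⟨rfl, rfl⟩
      simp at h

end Cuts

/-! ### The twisted differential in coefficients -/

section Coef

variable {k : Type u} [CommRing k]

/-- The coefficient of the coloured bamboo with vertices `V` and edges `U`. -/
def coef (k : Type u) [CommRing k] (n : ℕ) (d : ℤ) (V U : List Bool) :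
    AdjObj (ncGerst k) n d →ₗ[k] k where
  toFun f := if h : V.count true = n then (f ⟨V, h⟩).1 U else 0
  map_add' f g := by
    split_ifs
    · rfl
    · simp
  map_smul' a f := by
    split_ifs
    · rfl
    · simp

theorem coef_eq {n : ℕ} {d : ℤ} {V : List Bool} (h : V.count true = n) (U : List Bool)
    (f : AdjObj (ncGerst k) n d) : coef k n d V U f = (f ⟨V, h⟩).1 U := dif_pos h

theorem coef_eq_zero_of_count {n : ℕ} {d : ℤ} {V : List Bool} (h : V.count true ≠ n)
    (U : List Bool) (f : AdjObj (ncGerst k) n d) : coef k n d V U f = 0 := dif_neg h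

theorem coef_eq_zero {n : ℕ} {d : ℤ} {V U : List Bool} (f : AdjObj (ncGerst k) n d)
    (h : ¬ (V.count true = n ∧ V.length = U.length + 1 ∧ (U.count true : ℤ) = d)) :
    coef k n d V U f = 0 := by
  by_cases hV : V.count true = n
  · rw [coef_eq hV]
    exact (f ⟨V, hV⟩).2 U fun h' => h ⟨hV, h'.1.symm, h'.2⟩
  · exact coef_eq_zero_of_count hV _ _

theorem coef_ext {n : ℕ} {d : ℤ} {f g : AdjObj (ncGerst k) n d}
    (h : ∀ V U, V.count true = n → V.length = U.length + 1 → (U.count true : ℤ) = d →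
      coef k n d V U f = coef k n d V U g) : f = g := by
  funext ⟨V, hV⟩
  refine Subtype.ext (funext fun U => ?_)
  by_cases hU : V.length = U.length + 1 ∧ (U.count true : ℤ) = d
  · have := h V U hV hU.1 hU.2
    rwa [coef_eq hV, coef_eq hV] at this
  · exact ((f ⟨V, hV⟩).2 U fun h' => hU ⟨h'.1.symm, h'.2⟩).trans
      ((g ⟨V, hV⟩).2 U fun h' => hU ⟨h'.1.symm, h'.2⟩).symm

/-- The element with prescribed coefficients. -/
def ofCoef (n : ℕ) (d : ℤ) (c : List Bool → List Bool → k) : AdjObj (ncGerst k) n d := fun V =>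
  show bambooModule k V.1.length d from
  ⟨fun U => if V.1.length = U.length + 1 ∧ (U.count true : ℤ) = d then c V.1 U else 0,
    fun _ hU => if_neg fun h => hU ⟨h.1.symm, h.2⟩⟩

theorem coef_ofCoef {n : ℕ} {d : ℤ} (c : List Bool → List Bool → k) {V U : List Bool}
    (hV : V.count true = n) (hl : V.length = U.length + 1) (hU : (U.count true : ℤ) = d) :
    coef k n d V U (ofCoef n d c) = c V U := by
  rw [coef_eq hV]
  exact if_pos ⟨hl, hU⟩

theorem coef_mono {n N : ℕ} {d : ℤ} {V W U : List Bool} (x : bambooModule k N d)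
    (hN : N = W.length) (hW : W.count true = n) :
    coef k n d V U (mono (ncGerst k) W x) = if V = W then x.1 U else 0 := by
  subst hN
  split_ifs with h
  · subst h
    rw [coef_eq hW, mono_apply_self (P := ncGerst k) ⟨V, hW⟩ rfl x]
  · by_cases hV : V.count true = n
    · rw [coef_eq hV, mono_apply_ne (P := ncGerst k) ⟨V, hV⟩ h x]
      rfl
    · exact coef_eq_zero_of_count hV _ _

theorem coef_adjComp {m n l : ℕ} {d e c : ℤ} (hl : l + 1 = m + n) (hc : d + e = c) (i : ℕ)
    (f : AdjObj (ncGerst k) m d) (g : AdjObj (ncGerst k) n e) {V : List Bool} (U : List Bool)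
    (hV : V.count true = l) :
    coef k l c V U (adjComp hl hc i f g) = ∑ t ∈ cuts V i n,
      bambooCoeff t.2.1.length t.1.length (fun U => coef k m d (t.1 ++ true :: t.2.2) U f)
        (fun U => coef k n e t.2.1 U g) U := by
  rw [coef_eq hV, adjComp_apply, ← Finset.sum_attach (cuts V i n)]
  refine (congrFun (map_sum (bambooModule k V.length c).subtype _ _) U).trans ?_
  rw [Finset.sum_apply]
  refine Finset.sum_congr rfl fun t _ => ?_
  have h1 := fun U => coef_eq (adj_aux hl hV t.2).2.2.1 U f
  have h2 := fun U => coef_eq (mem_cuts.1 t.2).2.2 U g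
  simp only [h1, h2]
  rfl

theorem coef_mcDer (n : ℕ) {d e : ℤ} (h : d + 1 = e)
    (f : AdjObj (ncGerst k) n d) {V : List Bool} (U : List Bool) (hV : V.count true = n) :
    coef k n e V U (mcDer (edge k) n h f) = -(sgn k d * ∑ t ∈ bcuts V,
      bambooCoeff 2 t.1.length (fun U => coef k n d (t.1 ++ false :: t.2) U f)
        (Pi.single [true] 1) U) := by
  rw [coef_eq hV, mcDer_apply, ← Finset.sum_attach (bcuts V)]
  change -(sgn k d * _) = _
  congr 2
  refine (congrFun (map_sum (bambooModule k V.length e).subtype _ _) U).trans ?_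
  rw [Finset.sum_apply]
  refine Finset.sum_congr rfl fun t _ => ?_
  have h1 := fun U => coef_eq (bcuts_aux hV t.2).2.2.1 U f
  simp only [h1]
  rfl

/-- The element `m(α, -) + m(-, α)`, as a family. -/
def muBlack (k : Type u) [CommRing k] : AdjObj (ncGerst k) 1 1 := muAlpha (ncGerst k) (edge k)

/-- The differential of `TwNcGerst k`, as a map between families. -/
def twDiff (k : Type u) [CommRing k] (n : ℕ) {d e : ℤ} (h : d + 1 = e) :
    AdjObj (ncGerst k) n d →ₗ[k] AdjObj (ncGerst k) n e := (TwNcGerst k).diff n h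

theorem coef_muBlack (V U : List Bool) :
    coef k 1 1 V U (muBlack k) =
      if V = [false, true] ∨ V = [true, false] then (Pi.single [true] 1 : List Bool → k) U else 0 := by
  rw [muBlack, muAlpha_eq]
  refine (map_add (coef k 1 1 V U) _ _).trans ((congrArg₂ (· + ·)
    (coef_mono (n := 1) (W := [false, true]) (edge k) rfl rfl)
    (coef_mono (n := 1) (W := [true, false]) (edge k) rfl rfl)).trans ?_)
  by_cases h1 : V = [false, true]
  · simp [h1]; rfl
  · by_cases h2 : V = [true, false]
    · simp [h2]; rfl
    · simp [h1, h2]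

theorem twDiff_eq (n : ℕ) {d e : ℤ} (h : d + 1 = e) (f : AdjObj (ncGerst k) n d) :
    twDiff k n h f = mcDer (edge k) n h f +
      (adjComp (add_comm n 1) (by omega) 0 (muBlack k) f -
        sgn k d • ∑ i ∈ Finset.range n,
          adjComp (l := n) rfl h i f (muBlack k)) := by
  have e1 : adjDiff n h f = 0 := rfl
  have e2 := ad_apply ((ncGerst k).adjoinMC (edge k) rfl (edge_assoc k))
    (muBlack k) n h f
  rw [Finset.sum_congr rfl fun i hi => compz_pos _ _ _ i (Finset.mem_range.1 hi) _ _] at e2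
  refine Eq.trans ?_ (congrArg₂ (· + ·) (zero_add (mcDer (edge k) n h f)) e2)
  rfl

theorem bambooCoeff_edge_right (f : List Bool → k) {U : List Bool} {p : ℕ} (hp : p < U.length) :
    bambooCoeff 2 p f (Pi.single [true] 1) U =
      if U[p]? = some true then
        sgn k ((U.drop (p + 1)).count true) * f (U.take p ++ U.drop (p + 1)) else 0 := by
  obtain ⟨x, b, z, rfl, rfl⟩ : ∃ x b z, U = x ++ b :: z ∧ x.length = p :=
    ⟨U.take p, U[p], U.drop (p + 1), by simp, by simp; omega⟩
  have := bambooCoeff_append f (Pi.single [true] 1) x [b] z rfl (n := 2) rfl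
  simp only [List.singleton_append] at this
  rw [this]
  cases b <;> simp

theorem bambooCoeff_edge_left (f : List Bool → k) (U : List Bool) :
    bambooCoeff U.length 1 (Pi.single [true] 1) f U =
      if U.head? = some true then f U.tail else 0 := by
  cases U with
  | nil => simp [bambooCoeff]
  | cons b U =>
    have := bambooCoeff_append (Pi.single [true] 1) f [b] U [] (i := 1) rfl (n := U.length + 1) rfl
    simp only [List.append_nil, List.singleton_append] at this
    rw [List.length_cons, this]
    cases b <;> simp

theorem bambooCoeff_edge_last (f : List Bool → k) (U : List Bool) :
    bambooCoeff U.length 0 (Pi.single [true] 1) f U =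
      if U.getLast? = some true then sgn k (U.dropLast.count true) * f U.dropLast else 0 := by
  rcases List.eq_nil_or_concat' U with rfl | ⟨U, b, rfl⟩
  · simp [bambooCoeff]
  · have := bambooCoeff_append (Pi.single [true] 1) f [] U [b] (i := 0) rfl (n := U.length + 1) rfl
    simp only [List.nil_append] at this
    rw [List.length_append, List.length_singleton, this]
    cases b <;> simp

/-- The two end terms come from `μ ⋆ f`. The sum collects `f ⋆ μ` (a white vertex replaced by a
joined black and white pair) and `D f` (a black vertex replaced by a joined black pair). A
coefficient of the result is thus read off by contracting edges, with the bamboo sign counting the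
edges on the right. -/
theorem coef_twDiff_eq_sum {n : ℕ} {d e : ℤ} (h : d + 1 = e) (f : AdjObj (ncGerst k) n d)
    {V U : List Bool} (hV : V.count true = n) (hl : V.length = U.length + 1) :
    coef k n e V U (twDiff k n h f) =
      (if V.head? = some false ∧ U.head? = some true then coef k n d V.tail U.tail f else 0) +
      (if V.getLast? = some false ∧ U.getLast? = some true then
        sgn k (U.dropLast.count true) * coef k n d V.dropLast U.dropLast f else 0) -
      sgn k d * ∑ p ∈ Finset.range U.length,
        if U[p]? = some true ∧ ¬ (V[p]? = some true ∧ V[p + 1]? = some true) then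
          sgn k ((U.drop (p + 1)).count true) *
          coef k n d (V.take p ++ (V.getD p true || V.getD (p + 1) true) :: V.drop (p + 2))
            (U.take p ++ U.drop (p + 1)) f else 0 := by
  have hVl : V.length - 1 = U.length := by omega
  have e1 : coef k n e V U (adjComp (add_comm n 1) (by omega) 0
      (muBlack k) f) =
      (if V.head? = some false ∧ U.head? = some true then coef k n d V.tail U.tail f else 0) +
      (if V.getLast? = some false ∧ U.getLast? = some true then
        sgn k (U.dropLast.count true) * coef k n d V.dropLast U.dropLast f else 0) := by
    rw [coef_adjComp _ _ _ _ _ _ hV]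
    have := sum_cuts_zero V
      (fun y => bambooCoeff y.length 1 (Pi.single [true] 1) (fun U => coef k n d y U f) U)
      (fun y => bambooCoeff y.length 0 (Pi.single [true] 1) (fun U => coef k n d y U f) U)
    rw [hV] at this
    rw [Finset.sum_congr rfl, this]
    · simp only [List.length_tail, List.length_dropLast, hVl, bambooCoeff_edge_left,
        bambooCoeff_edge_last, ← ite_and]
    · rintro ⟨x, y, z⟩ ht
      obtain ⟨h1, h2, h3⟩ := mem_cuts.1 ht
      simp only [coef_muBlack]
      by_cases hx : x = [false] ∧ z = []
      · obtain ⟨rfl, rfl⟩ := hx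
        simp
      · by_cases hz : x = [] ∧ z = [false]
        · obtain ⟨rfl, rfl⟩ := hz
          simp
        · have : ¬ (x ++ true :: z = [false, true] ∨ x ++ true :: z = [true, false]) := by
            rintro (h4 | h4)
            · obtain ⟨rfl, rfl⟩ := split_unique (a := [false]) (c := []) h4 (by simpa using h2)
              simp at hx
            · obtain ⟨rfl, rfl⟩ := split_unique (a := []) (c := [false]) h4 (by simpa using h2)
              simp at hz
          simp [this, hx, hz, bambooCoeff]
  have e2 : coef k n e V U (∑ i ∈ Finset.range n,
      adjComp (l := n) rfl h i f (muBlack k)) =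
      ∑ p ∈ Finset.range U.length, if V[p]? ≠ V[p + 1]? then
        bambooCoeff 2 p (fun U => coef k n d (V.take p ++ true :: V.drop (p + 2)) U f)
          (Pi.single [true] 1) U else 0 := by
    have := sum_cuts_one V (fun x z => bambooCoeff 2 x.length
      (fun U => coef k n d (x ++ true :: z) U f) (Pi.single [true] 1) U)
    rw [hV, hVl] at this
    rw [map_sum, Finset.sum_congr rfl (g := _), this]
    · refine Finset.sum_congr rfl fun p hp => ?_
      rw [List.length_take_of_le (by have := Finset.mem_range.1 hp; omega)]
    · intro i _
      rw [coef_adjComp _ _ _ _ _ _ hV]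
      refine Finset.sum_congr rfl fun t _ => ?_
      simp only [coef_muBlack]
      split_ifs with h1
      · rcases h1 with h1 | h1 <;> rw [h1] <;> rfl
      · simp [bambooCoeff]
  have e3 : coef k n e V U (mcDer (edge k) n h f) = -(sgn k d * ∑ p ∈ Finset.range U.length,
      if V[p]? = some false ∧ V[p + 1]? = some false then
        bambooCoeff 2 p (fun U => coef k n d (V.take p ++ false :: V.drop (p + 2)) U f)
          (Pi.single [true] 1) U else 0) := by
    rw [coef_mcDer _ _ _ _ hV, sum_bcuts V (fun x z => bambooCoeff 2 x.length
      (fun U => coef k n d (x ++ false :: z) U f) (Pi.single [true] 1) U), hVl]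
    congr 2
    refine Finset.sum_congr rfl fun p hp => ?_
    rw [List.length_take_of_le (by have := Finset.mem_range.1 hp; omega)]
  rw [twDiff_eq, map_add, map_sub, map_smul, e1, e2, e3, smul_eq_mul, neg_add_eq_sub, sub_sub,
    ← mul_add, ← Finset.sum_add_distrib]
  congr 2
  refine Finset.sum_congr rfl fun p hp => ?_
  have hp := Finset.mem_range.1 hp
  rw [bambooCoeff_edge_right _ hp, bambooCoeff_edge_right _ hp]
  obtain ⟨x, a, b, z, rfl, rfl⟩ := exists_eq_append_cons_cons (V := V) (p := p) (by omega)
  -- Unequal colours come from `f ⋆ μ`, two black vertices from `D f`, and nothing produces two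
  -- white ones.
  cases a <;> cases b <;> simp

open Classical in
/-- The coefficients of the bamboos extended by a white vertex attached to both ends, from the
coefficients of the bamboos. -/
noncomputable def extend (c : List Bool → List Bool → k) (V U : List Bool) : k :=
  if V.head? = some true ∧ U.head? = some true ∧ EndsWhite V U then
    c V.tail.dropLast U.tail.dropLast else 0

theorem extend_concat (c : List Bool → List Bool → k) {V U : List Bool}
    (h : V.length = U.length + 1) :
    extend c (true :: (V ++ [true])) (true :: (U ++ [true])) = c V U := by
  have : EndsWhite (true :: V ++ [true]) (true :: U ++ [true]) :=
    ⟨List.getLast?_concat, List.getLast?_concat, by simp [h]⟩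
  rw [extend, if_pos ⟨rfl, rfl, this⟩]
  simp

theorem extend_of_not_endsWhite (c : List Bool → List Bool → k) {V U : List Bool}
    (h : ¬ EndsWhite V U) : extend c V U = 0 := if_neg fun h' => h h'.2.2

theorem extend_not_edge (c : List Bool → List Bool → k) (V U : List Bool) :
    extend c V (false :: U) = 0 := if_neg (by simp)

/-- Hanging a black vertex on an end is dual to contracting its edge to an auxiliary white vertex,
so both end terms become summands of `contr`. The interior signs agree because the edges other than
the contracted one number `d`, which converts a count on the right into one on the left, and the
auxiliary left edge accounts for the global minus sign. -/
theorem coef_twDiff {n : ℕ} {d e : ℤ} (h : d + 1 = e) (f : AdjObj (ncGerst k) n d)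
    {V U : List Bool} (hV : V.count true = n) (hl : V.length = U.length + 1)
    (hU : (U.count true : ℤ) = e) :
    coef k n e V U (twDiff k n h f) =
      contr (extend fun V U => coef k n d V U f) (true :: (V ++ [true])) (true :: (U ++ [true])) := by
  rw [coef_twDiff_eq_sum h f hV hl, contr_eq_sum _ (by simp [hl])]
  rw [List.length_cons, List.length_append, List.length_singleton, Finset.sum_range_succ',
    Finset.sum_range_succ]
  set G := extend fun V U => coef k n d V U f with hG
  -- This word extends the empty bamboo, which occurs when the only vertex is absorbed by an end; it
  -- has no coefficient since `ncGerst(0) = 0`.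
  have e0 : G [true, true] [true] = 0 := by
    rw [hG, extend]
    split_ifs
    · exact coef_eq_zero _ (by simp)
    · rfl
  have e1 : contrTerm G (true :: (V ++ [true])) (true :: (U ++ [true])) 0 =
      if V.head? = some false ∧ U.head? = some true then coef k n d V.tail U.tail f else 0 := by
    match V, U with
    | [], _ => simp at hl
    | true :: V, U =>
      have := contrTerm_append G (x := []) (y := []) (p := 0) rfl rfl true true true (V ++ [true])
        (U ++ [true])
      simp only [List.nil_append] at this
      rw [List.cons_append, this]
      simp
    | false :: V, U =>
      have := contrTerm_append G (x := []) (y := []) (p := 0) rfl rfl true false true (V ++ [true])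
        (U ++ [true])
      simp only [List.nil_append] at this
      rw [List.cons_append, this]
      match U with
      | [] =>
        obtain rfl : V = [] := by simpa using hl
        simp [e0]
      | false :: U => simp [hG, extend_not_edge]
      | true :: U =>
        have := extend_concat (fun V U => coef k n d V U f) (V := V) (U := U) (by simpa using hl)
        simp [hG, this]
  have e2 : contrTerm G (true :: (V ++ [true])) (true :: (U ++ [true])) (U.length + 1) =
      if V.getLast? = some false ∧ U.getLast? = some true then
        sgn k (U.dropLast.count true) * coef k n d V.dropLast U.dropLast f else 0 := by
    rcases List.eq_nil_or_concat' V with rfl | ⟨V, a, rfl⟩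
    · simp at hl
    have hl' : V.length = U.length := by simpa using hl
    have := contrTerm_append G (x := true :: V) (y := true :: U) (p := U.length + 1)
      (by simpa using hl') rfl a true true [] []
    rw [List.append_assoc, List.singleton_append, ← List.cons_append, ← List.cons_append, this]
    cases a
    · rcases List.eq_nil_or_concat' U with rfl | ⟨U, b, rfl⟩
      · obtain rfl : V = [] := by simpa using hl'
        simp [e0]
      · cases b
        · have : G (true :: (V ++ [true])) (true :: (U ++ [false])) = 0 := by
            refine extend_of_not_endsWhite _ fun h => ?_
            have := h.2.1
            rw [← List.cons_append, List.getLast?_concat] at this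
            simp at this
          simp [this]
        · have := extend_concat (fun V U => coef k n d V U f) (V := V) (U := U) (by simpa using hl')
          simp [hG, this, sgn_add]
    · simp
  rw [e1, e2, add_assoc, add_comm, add_comm (ite _ _ _) (ite _ _ _), add_comm, sub_eq_add_neg,
    add_comm]
  congr 1
  · rw [Finset.mul_sum, ← Finset.sum_neg_distrib]
    refine Finset.sum_congr rfl fun p hp => ?_
    have hp := Finset.mem_range.1 hp
    obtain ⟨x, b, z, rfl, rfl⟩ : ∃ x b z, U = x ++ b :: z ∧ x.length = p :=
      ⟨U.take p, U[p], U.drop (p + 1), by simp, by simp; omega⟩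
    obtain ⟨x', a, a', z', rfl, hx⟩ := exists_eq_append_cons_cons (V := V) (p := x.length) (by omega)
    have h1 := extend_concat (fun V U => coef k n d V U f) (V := x' ++ (a || a') :: z') (U := x ++ z)
      (by simp at hl ⊢; omega)
    have h2 := contrTerm_append G (x := true :: x') (y := true :: x) (p := x.length + 1)
      (by simpa using hx) rfl a a' b (z' ++ [true]) (z ++ [true])
    simp only [List.cons_append, List.append_assoc] at h1 h2 ⊢
    rw [h2, hG, h1, ← hx]
    have hdrop : (x' ++ a :: a' :: z').drop (x'.length + 2) = z' := by simp
    rw [hdrop]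
    cases b
    · simp [hx]
    -- `U` has `d + 1` edges, so the edges in `x` and `z` together number `d`.
    · have hs : sgn k d * sgn k (z.count true) = sgn k (x.count true) := by
        rw [← sgn_add]
        refine sgn_eq_of_even_sub ⟨z.count true, ?_⟩
        simp at hU
        omega
      cases a <;> cases a' <;> simp [hx, ← mul_assoc, hs, sgn_add]

end Coef

/-! ### Acyclicity away from the connected white bamboos and two black points -/

section Primitive

variable {k : Type u} [CommRing k]

theorem contr_of_white (G : List Bool → List Bool → k) {V : List Bool} (hV : false ∉ V)
    (U : List Bool) : contr G V U = 0 := by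
  induction U generalizing V G with
  | nil => simp
  | cons u U ih =>
    match V, u with
    | [], _ => simp
    | [_], _ => simp
    | false :: _, _ => simp at hV
    | _ :: false :: _, _ => simp at hV
    | true :: true :: V, true => rw [contr_cons_true, ih _ (by simpa using hV)]; simp
    | true :: true :: V, false => rw [contr_cons_false, ih _ (by simpa using hV)]

theorem eq_replicate_true {V : List Bool} (h : false ∉ V) : V = List.replicate V.length true :=
  List.eq_replicate_length.2 fun b hb => by
    cases b
    · exact absurd hb h
    · rfl

/-- The auxiliary ends are white too, so no edge is contractible. In particular the coefficient of
the connected white bamboo descends to cohomology. -/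
theorem coef_twDiff_white {n : ℕ} {d e : ℤ} (h : d + 1 = e) (f : AdjObj (ncGerst k) n d)
    {V : List Bool} (hV : false ∉ V) (U : List Bool) :
    coef k n e V U (twDiff k n h f) = 0 := by
  by_cases hc : V.count true = n ∧ V.length = U.length + 1 ∧ (U.count true : ℤ) = e
  · rw [coef_twDiff h f hc.1 hc.2.1 hc.2.2]
    exact contr_of_white _ (by simpa using hV) _
  · exact coef_eq_zero _ hc

/-- In the extended word the only edges are the auxiliary ones, and contracting either leaves an
auxiliary vertex next to the gap, hence detached. -/
theorem coef_twDiff_twoBlack {n : ℕ} {d e : ℤ} (h : d + 1 = e) (f : AdjObj (ncGerst k) n d) :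
    coef k n e [false, false] [false] (twDiff k n h f) = 0 := by
  by_cases hc : [false, false].count true = n ∧ [false, false].length = [false].length + 1 ∧
      ([false].count true : ℤ) = e
  · rw [coef_twDiff h f hc.1 hc.2.1 hc.2.2]
    have h1 : extend (fun V U => coef k n d V U f) [true, false, true] [true, false] = 0 :=
      extend_of_not_endsWhite _ (by simp [EndsWhite])
    simp [contr_cons_true, contr_cons_false, extend_not_edge, h1]
  · exact coef_eq_zero _ hc

theorem exists_of_endsWhite {V U : List Bool} (h : EndsWhite V U) (hV : V.head? = some true)
    (hU : U.head? = some true) : (V = [true, true] ∧ U = [true]) ∨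
      ∃ V' U', V = true :: (V' ++ [true]) ∧ U = true :: (U' ++ [true]) ∧
        V'.length = U'.length + 1 := by
  obtain ⟨h1, h2, h3⟩ := h
  obtain ⟨V, rfl⟩ := List.head?_eq_some_iff.1 hV
  obtain ⟨U, rfl⟩ := List.head?_eq_some_iff.1 hU
  rcases List.eq_nil_or_concat' V with rfl | ⟨V, a, rfl⟩
  · simp at h3
  obtain rfl : a = true := by
    rw [← List.cons_append, List.getLast?_concat] at h1
    simpa using h1
  rcases List.eq_nil_or_concat' U with rfl | ⟨U, a, rfl⟩
  · left
    simpa using h3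
  obtain rfl : a = true := by
    rw [← List.cons_append, List.getLast?_concat] at h2
    simpa using h2
  exact Or.inr ⟨V, U, rfl, rfl, by simpa using h3⟩

/-- The element whose coefficients are given by the contracting homotopy. -/
noncomputable def primitive {n : ℕ} {d : ℤ} (e : ℤ) (f : AdjObj (ncGerst k) n d) : AdjObj (ncGerst k) n e :=
  ofCoef n e fun V U => totHtpy (extend fun V U => coef k n d V U f) (true :: (V ++ [true]))
    (true :: (U ++ [true]))

/-- This confines the support of the homotopy to extended words: the inserted vertex is black, so
the arity is unchanged, and it brings one edge, so the degree drops by one. -/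
theorem totHtpy_extend_ne_zero {n : ℕ} {d e : ℤ} (h : e + 1 = d) {f : AdjObj (ncGerst k) n d}
    {V U : List Bool} (hVU : totHtpy (extend fun V U => coef k n d V U f) V U ≠ 0) :
    ∃ V' U', V = true :: (V' ++ [true]) ∧ U = true :: (U' ++ [true]) ∧ V'.count true = n ∧
      V'.length = U'.length + 1 ∧ (U'.count true : ℤ) = e := by
  obtain ⟨V₁, U₁, h1, h2, h3, h4, h5, h6, h7, h8, -⟩ := exists_of_totHtpy_ne_zero hVU
  have h9 : EndsWhite V₁ U₁ := by
    by_contra h9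
    exact h1 (extend_of_not_endsWhite _ h9)
  have h10 : extend (fun V U => coef k n d V U f) [true, true] [true] = 0 := by
    rw [extend]
    split_ifs
    · exact coef_eq_zero _ (by simp)
    · rfl
  rcases exists_of_endsWhite h9 h6 h7 with ⟨rfl, rfl⟩ | ⟨V₂, U₂, rfl, rfl, h11⟩
  · exact absurd h10 h1
  rw [extend_concat _ h11] at h1
  have h12 : V₂.count true = n ∧ V₂.length = U₂.length + 1 ∧ (U₂.count true : ℤ) = d := by
    by_contra h12
    exact h1 (coef_eq_zero _ h12)
  rcases exists_of_endsWhite (h8 h9) h4 h5 with ⟨rfl, rfl⟩ | ⟨V', U', rfl, rfl, h13⟩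
  -- The extension of the empty bamboo does not contribute: there the black vertex is inserted after
  -- the right end, so the new word does not end in white.
  · rw [totHtpy_white, htpy_edges_nil, extend_of_not_endsWhite _ (by simp [EndsWhite])] at hVU
    simp at hVU
  · refine ⟨V', U', rfl, rfl, ?_, h13, ?_⟩
    · simp at h2; omega
    · simp at h3; omega

/-- `ofCoef` discards values at words of the wrong size and `extend` those at words with wrong ends;
the support of the homotopy shows that nothing nonzero is lost. -/
theorem extend_coef_primitive {n : ℕ} {d e : ℤ} (h : e + 1 = d) (f : AdjObj (ncGerst k) n d) :
    (extend fun V U => coef k n e V U (primitive e f)) =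
      totHtpy (extend fun V U => coef k n d V U f) := by
  funext V U
  by_cases hVU : totHtpy (extend fun V U => coef k n d V U f) V U = 0
  · rw [hVU, extend]
    split_ifs with h1
    · rcases exists_of_endsWhite h1.2.2 h1.1 h1.2.1 with ⟨rfl, rfl⟩ | ⟨V, U, rfl, rfl, h2⟩
      · exact coef_eq_zero _ (by simp)
      · simp only [List.tail_cons, List.dropLast_concat]
        by_cases hc : V.count true = n ∧ V.length = U.length + 1 ∧ (U.count true : ℤ) = e
        · rw [primitive, coef_ofCoef _ hc.1 hc.2.1 hc.2.2, hVU]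
        · exact coef_eq_zero _ hc
    · rfl
  · obtain ⟨V, U, rfl, rfl, h1, h2, h3⟩ := totHtpy_extend_ne_zero h hVU
    rw [extend_concat _ h2, primitive, coef_ofCoef _ h1 h2 h3]

/-- The homotopy identity gives every coefficient outside the two exceptional kinds of bamboos; at
those, `f` vanishes by `h₁` and `h₂`, and a coboundary vanishes in any case. -/
theorem twDiff_primitive {n : ℕ} {d e d' : ℤ} (h : e + 1 = d) (h' : d + 1 = d')
    (f : AdjObj (ncGerst k) n d) (hf : twDiff k n h' f = 0)
    (h₁ : coef k n d (List.replicate n true) (List.replicate (n - 1) true) f = 0)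
    (h₂ : coef k n d [false, false] [false] f = 0) :
    twDiff k n h (primitive e f) = f := by
  refine coef_ext fun V U hV hl hU => ?_
  by_cases hw : false ∈ V ∨ false ∈ U
  swap
  · rw [coef_twDiff_white _ _ fun hw' => hw (Or.inl hw')]
    have hV' := eq_replicate_true fun hw' => hw (Or.inl hw')
    have hU' := eq_replicate_true fun hw' => hw (Or.inr hw')
    have hn : V.length = n := by
      rw [hV', List.count_replicate_self] at hV
      exact hV
    rw [hn] at hV'
    rw [show U.length = n - 1 by omega] at hU'
    rw [hV', hU', h₁]
  -- This is the word excluded from the homotopy identity.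
  by_cases hγ : V = [false, false] ∧ U = [false]
  · obtain ⟨rfl, rfl⟩ := hγ
    rw [h₂, coef_twDiff_twoBlack]
  rw [coef_twDiff h _ hV hl hU, extend_coef_primitive h]
  have key := contr_totHtpy_add_totHtpy_contr (extend fun V U => coef k n d V U f)
    (extend_not_edge _) (fun V U hVU => extend_of_not_endsWhite _ fun h => hVU h.2.2)
    (V := V ++ [true]) (U := true :: (U ++ [true])) (by simp [hl]) (by simp)
    (by rw [← List.cons_append, List.getLast?_concat]) rfl
    (by rcases hw with hw | hw <;> simp [hw]) (by
      rintro ⟨h1, h2⟩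
      refine hγ ⟨?_, ?_⟩
      · exact (List.append_left_inj [true]).1 h1
      · simp only [List.cons.injEq, true_and] at h2
        exact (List.append_left_inj [true]).1 h2)
  rw [extend_concat _ hl] at key
  rw [← key, left_eq_add]
  -- If the second composite were nonzero, `contr` of the extension of `f` would be nonzero at an
  -- extended word, which is a coefficient of the differential of the cocycle `f`.
  by_contra hne
  obtain ⟨V₁, U₁, h1, h2, h3, -, -, h6, h7, -, h8⟩ := exists_of_totHtpy_ne_zero hne
  have h9 := h8 (by rcases hw with hw | hw <;> simp [hw]) (by
    rw [← List.cons_append, ← List.cons_append]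
    exact ⟨List.getLast?_concat, List.getLast?_concat, by simp [hl]⟩)
  rcases exists_of_endsWhite h9 h6 h7 with ⟨rfl, rfl⟩ | ⟨V₂, U₂, rfl, rfl, h11⟩
  · simp at h3
  · rw [← coef_twDiff h' f (by simp at h2; omega) h11 (by simp at h3; omega), hf, map_zero] at h1
    exact h1 rfl

end Primitive

/-! ### Words with doubled black letters -/

section Words

/-- The colours of the coloured bamboo obtained by replacing each letter `false` of a word by two
black vertices. -/
def doubled : List Bool → List Bool
  | [] => []
  | true :: v => true :: doubled v
  | false :: v => false :: false :: doubled v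

/-- The edges of the coloured bamboo with vertices `doubled v`, each preceded by the edge on the left
of its vertices: the two black vertices are not joined. -/
def doubledEdges : List Bool → List Bool
  | [] => []
  | true :: v => true :: doubledEdges v
  | false :: v => true :: false :: doubledEdges v

/-- The inverse of `doubled`. -/
def halved : List Bool → List Bool
  | [] => []
  | true :: v => true :: halved v
  | [false] => []
  | false :: _ :: v => false :: halved v

@[simp] theorem halved_doubled (v : List Bool) : halved (doubled v) = v := by
  induction v with
  | nil => rfl
  | cons b v ih => cases b <;> simp [doubled, halved, ih]

theorem doubled_append (v w : List Bool) : doubled (v ++ w) = doubled v ++ doubled w := by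
  induction v with
  | nil => rfl
  | cons b v ih => cases b <;> simp [doubled, ih]

theorem doubledEdges_append (v w : List Bool) :
    doubledEdges (v ++ w) = doubledEdges v ++ doubledEdges w := by
  induction v with
  | nil => rfl
  | cons b v ih => cases b <;> simp [doubledEdges, ih]

@[simp] theorem count_true_doubled (v : List Bool) : (doubled v).count true = v.count true := by
  induction v with
  | nil => rfl
  | cons b v ih => cases b <;> simp [doubled, ih]

@[simp] theorem count_false_doubled (v : List Bool) :
    (doubled v).count false = 2 * v.count false := by
  induction v with
  | nil => rfl
  | cons b v ih => cases b <;> simp [doubled, ih]; ring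

@[simp] theorem length_doubledEdges (v : List Bool) :
    (doubledEdges v).length = (doubled v).length := by
  induction v with
  | nil => rfl
  | cons b v ih => cases b <;> simp [doubled, doubledEdges, ih]

@[simp] theorem count_true_doubledEdges (v : List Bool) :
    (doubledEdges v).count true = v.length := by
  induction v with
  | nil => rfl
  | cons b v ih => cases b <;> simp [doubledEdges, ih]

theorem doubledEdges_eq_cons {v : List Bool} (hv : v ≠ []) :
    doubledEdges v = true :: (doubledEdges v).tail := by
  match v, hv with
  | true :: v, _ => rfl
  | false :: v, _ => rfl

theorem length_tail_doubledEdges {v : List Bool} (hv : v ≠ []) :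
    (doubledEdges v).tail.length + 1 = (doubled v).length := by
  rw [← length_doubledEdges, doubledEdges_eq_cons hv]; simp

theorem count_tail_doubledEdges {v : List Bool} (hv : v ≠ []) :
    (doubledEdges v).tail.count true + 1 = v.length := by
  rw [← count_true_doubledEdges v, doubledEdges_eq_cons hv]; simp

/-- The edges of `doubled v`, each followed by the edge on the right of its vertices. -/
def doubledEdges' : List Bool → List Bool
  | [] => []
  | true :: v => true :: doubledEdges' v
  | false :: v => false :: true :: doubledEdges' v

theorem doubledEdges_concat (v : List Bool) :
    doubledEdges v ++ [true] = true :: doubledEdges' v := by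
  induction v with
  | nil => rfl
  | cons b v ih => cases b <;> simp [doubledEdges, doubledEdges', ih]

theorem length_doubledEdges' (v : List Bool) : (doubledEdges' v).length = (doubled v).length := by
  induction v with
  | nil => rfl
  | cons b v ih => cases b <;> simp [doubled, doubledEdges', ih]

/-- Around a distinguished letter, the edges before it belong to the letters on their left and those
after it to the letters on their right. This isolates the place where another bamboo is substituted,
and is why both edge conventions are needed. -/
theorem tail_doubledEdges_append (a b : List Bool) :
    (doubledEdges (a ++ true :: b)).tail = doubledEdges' a ++ doubledEdges b := by
  have := congrArg List.tail (congrArg (· ++ doubledEdges b) (doubledEdges_concat a))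
  rw [doubledEdges_append, doubledEdges]
  simpa using this

theorem tail_doubledEdges_append_append (a b : List Bool) {w : List Bool} (hw : w ≠ []) :
    (doubledEdges (a ++ (w ++ b))).tail =
      doubledEdges' a ++ ((doubledEdges w).tail ++ doubledEdges b) := by
  have := congrArg List.tail (congrArg (· ++ ((doubledEdges w).tail ++ doubledEdges b))
    (doubledEdges_concat a))
  rw [doubledEdges_append, doubledEdges_append, doubledEdges_eq_cons hw]
  simpa using this

/-- The binomial trivialises the bilinear form `a * b`, by which the composition signs of `S⁻¹As`
and of bamboos differ. -/
theorem choose_two_add (a b : ℕ) : (a + b).choose 2 = a.choose 2 + b.choose 2 + a * b := by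
  induction b with
  | zero => simp
  | succ b ih =>
    rw [← add_assoc, Nat.choose_succ_succ' (a + b), Nat.choose_succ_succ' b, ih, Nat.choose_one_right,
      Nat.choose_one_right]
    ring

end Words

/-! ### The basis of words in `S⁻¹As ∨̂ γ` and its generation -/

section SAsWords

variable {k : Type u} [CommRing k]

/-- The generator of arity `N` of `S⁻¹As`, zero unless the degree is `N - 1`. -/
def nu (k : Type u) [CommRing k] (N : ℕ) (d : ℤ) : (sAs k).obj N d :=
  show sAsModule k N d from ⟨open Classical in if 1 ≤ N ∧ (N : ℤ) = d + 1 then 1 else 0,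
    fun h => if_neg h⟩

theorem nu_val {N : ℕ} {d : ℤ} (h : 1 ≤ N) (h' : (N : ℤ) = d + 1) :
    Subtype.val (p := (· ∈ sAsModule k N d)) (nu k N d) = 1 := if_pos ⟨h, h'⟩

/-- The generator of `S⁻¹As` with `γ` plugged at the letters `false` of a word. -/
def wordElt (k : Type u) [CommRing k] (n : ℕ) (d : ℤ) (v : List Bool) : AdjObj (sAs k) n d :=
  mono (sAs k) v (nu k v.length d)

/-- The coefficient of a word. -/
def wordCoef (k : Type u) [CommRing k] (n : ℕ) (d : ℤ) (v : List Bool) :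
    AdjObj (sAs k) n d →ₗ[k] k where
  toFun f := if h : v.count true = n then (f ⟨v, h⟩).1 else 0
  map_add' f g := by
    split_ifs
    · rfl
    · simp
  map_smul' a f := by
    split_ifs
    · rfl
    · simp

theorem wordCoef_eq {n : ℕ} {d : ℤ} {v : List Bool} (h : v.count true = n)
    (f : AdjObj (sAs k) n d) : wordCoef k n d v f = (f ⟨v, h⟩).1 := dif_pos h

theorem wordCoef_eq_zero {n : ℕ} {d : ℤ} {v : List Bool} (f : AdjObj (sAs k) n d)
    (h : ¬ (v.count true = n ∧ v ≠ [] ∧ (v.length : ℤ) = d + 1)) : wordCoef k n d v f = 0 := by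
  by_cases hv : v.count true = n
  · rw [wordCoef_eq hv]
    refine (f ⟨v, hv⟩).2 fun h' => h ⟨hv, ?_, h'.2⟩
    rintro rfl
    exact absurd h'.1 (by simp)
  · exact dif_neg hv

theorem wordCoef_wordElt_self {n : ℕ} {d : ℤ} {v : List Bool} (h : v.count true = n) (h' : v ≠ [])
    (hd : (v.length : ℤ) = d + 1) : wordCoef k n d v (wordElt k n d v) = 1 := by
  rw [wordCoef_eq h, wordElt, mono_apply_self (P := sAs k) ⟨v, h⟩ rfl]
  exact nu_val (List.length_pos_of_ne_nil h') hd

theorem wordCoef_wordElt_ne {n : ℕ} {d : ℤ} {v w : List Bool} (h : v ≠ w) :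
    wordCoef k n d v (wordElt k n d w) = 0 := by
  by_cases hv : v.count true = n
  · rw [wordCoef_eq hv, wordElt, mono_apply_ne (P := sAs k) ⟨v, hv⟩ h]
    rfl
  · exact dif_neg hv

theorem adj_sAs_ext {n : ℕ} {d : ℤ} {f g : AdjObj (sAs k) n d}
    (h : ∀ v, v.count true = n → v ≠ [] → (v.length : ℤ) = d + 1 →
      wordCoef k n d v f = wordCoef k n d v g) : f = g := by
  funext ⟨v, hv⟩
  refine Subtype.ext ?_
  by_cases hv' : v ≠ [] ∧ (v.length : ℤ) = d + 1
  · have := h v hv hv'.1 hv'.2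
    rwa [wordCoef_eq hv, wordCoef_eq hv] at this
  · have h1 : ¬ (1 ≤ v.length ∧ (v.length : ℤ) = d + 1) := fun h =>
      hv' ⟨List.ne_nil_of_length_pos h.1, h.2⟩
    exact ((f ⟨v, hv⟩).2 h1).trans ((g ⟨v, hv⟩).2 h1).symm

/-- The degree fixes the number of inputs of an operation of `S⁻¹As`, hence the length of the word,
so no infinite sum occurs. For `d < 0` only the empty word remains, with coefficient zero. -/
theorem eq_sum_wordElt {n : ℕ} {d : ℤ} (f : AdjObj (sAs k) n d) :
    f = ∑ v ∈ (List.finite_length_eq Bool (d + 1).toNat).toFinset,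
      wordCoef k n d v f • wordElt k n d v := by
  refine adj_sAs_ext fun v h h' hd => ?_
  rw [map_sum, Finset.sum_eq_single v]
  · rw [map_smul, wordCoef_wordElt_self h h' hd, smul_eq_mul, mul_one]
  · intro w _ hw
    rw [map_smul, wordCoef_wordElt_ne hw.symm, smul_zero]
  · intro hv
    refine absurd ?_ hv
    simp [← hd]

theorem adj_sAs_induction {n : ℕ} {d : ℤ} (S : Submodule k (AdjObj (sAs k) n d))
    (f : AdjObj (sAs k) n d)
    (h : ∀ v, v.count true = n → v ≠ [] → (v.length : ℤ) = d + 1 → wordCoef k n d v f ≠ 0 →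
      wordElt k n d v ∈ S) : f ∈ S := by
  rw [eq_sum_wordElt f]
  refine Submodule.sum_mem _ fun v _ => ?_
  by_cases h0 : wordCoef k n d v f = 0
  · rw [h0, zero_smul]; exact S.zero_mem
  · have h1 : v.count true = n ∧ v ≠ [] ∧ (v.length : ℤ) = d + 1 := by
      by_contra h1
      exact h0 (wordCoef_eq_zero _ h1)
    exact S.smul_mem _ (h v h1.1 h1.2.1 h1.2.2 h0)

theorem adjComp_wordElt {m n l : ℕ} {d e c : ℤ} (hl : l + 1 = m + n) (hc : d + e = c) {i : ℕ}
    (a b w : List Bool) (hv : (a ++ true :: b).count true = m) (hw : w.count true = n)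
    (ha : a.count true = i) (hd : ((a ++ true :: b).length : ℤ) = d + 1) (hw' : w ≠ [])
    (he : (w.length : ℤ) = e + 1) :
    adjComp hl hc i (wordElt k m d (a ++ true :: b)) (wordElt k n e w) =
      sgn k (a.length * (w.length - 1)) • wordElt k l c (a ++ (w ++ b)) := by
  rw [wordElt, wordElt, adjComp_mono hl hc a b (a ++ (w ++ b)) rfl rfl
    (L := (a ++ (w ++ b)).length) (by simp; omega) rfl rfl hv hw ha rfl (by simp), wordElt,
    ← mono_smul]
  congr 1
  refine Subtype.ext ?_
  have h1 : 1 ≤ w.length := List.length_pos_of_ne_nil hw'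
  have e1 := nu_val (k := k) (N := (a ++ true :: b).length) (by simp; omega) hd
  have e2 := nu_val (k := k) h1 he
  have e3 := nu_val (k := k) (N := (a ++ (w ++ b)).length) (d := c) (by simp; omega)
    (by simp at hd ⊢; omega)
  exact congrArg₂ (· * ·) rfl ((congrArg₂ (· * ·) e1 e2).trans ((mul_one 1).trans e3.symm))

/-- Every word is built from its last letter by adding letters on the left: an input by `b(-, v)`
and a `γ` by `b(γ, v)`, up to sign. No closure of `S` is needed because words span algebraically. -/
theorem sAsFree_generated {w : ℕ} (S : ∀ n d, Submodule k ((sAsFree k w).obj n d))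
    (h_one : (sAsFree k w).one ∈ S 1 0) (h_b : sAsFree.b k w ∈ S 2 1) (h_γ : sAsFree.γ k w ∈ S 0 0)
    (h_comp : ∀ {m n l : ℕ} {d e f : ℤ} (hl : l + 1 = m + n) (hf : d + e = f) (i : ℕ) (hi : i < m)
      {x : (sAsFree k w).obj m d} {y : (sAsFree k w).obj n e}, x ∈ S m d → y ∈ S n e →
        (sAsFree k w).comp hl hf i hi x y ∈ S l f) (n : ℕ) (d : ℤ) (x : (sAsFree k w).obj n d) :
    x ∈ S n d := by
  have hone : nu k 1 0 = (sAs k).one := Subtype.ext (nu_val le_rfl rfl)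
  have hb : nu k 2 1 = sAs.b k := Subtype.ext (nu_val one_le_two rfl)
  have hw1 : wordElt k 1 0 [true] ∈ S 1 0 := by
    rw [wordElt]; erw [hone]; exact h_one
  have hw0 : wordElt k 0 0 [false] ∈ S 0 0 := by
    rw [wordElt]; erw [hone]; exact h_γ
  have hw2 : wordElt k 2 1 [true, true] ∈ S 2 1 := by
    rw [wordElt]; erw [hb]; exact h_b
  -- This is `b(γ, -)`, used to put a letter `γ` in front.
  have hw3 : wordElt k 1 1 [false, true] ∈ S 1 1 := by
    have h1 := h_comp (m := 2) (n := 0) (l := 1) rfl (add_zero 1) 0 Nat.two_pos hw2 hw0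
    have h2 := adjComp_wordElt (k := k) (m := 2) (n := 0) (l := 1) rfl (add_zero 1) (i := 0) []
      [true] [false] rfl rfl rfl rfl (by simp) rfl
    simp at h2
    exact h2 ▸ h1
  refine adj_sAs_induction (S n d) x fun v hv hv' hd h0 => ?_
  clear h0 x
  induction v generalizing n d with
  | nil => exact absurd rfl hv'
  | cons c v ih =>
    by_cases hv0 : v = []
    · subst hv0
      obtain rfl : d = 0 := by simpa using hd.symm
      subst hv
      cases c
      · exact hw0
      · exact hw1
    · have h1 := ih (v.count true) (d - 1) rfl hv0 (by simp at hd; omega)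
      cases c
      · have h2 := adjComp_wordElt (k := k) (m := 1) (l := n) (c := d) (e := d - 1) (d := 1)
          (by simp at hv; omega) (by omega) (i := 0) [false] [] v rfl rfl rfl rfl hv0
          (by simp at hd; omega)
        -- The composite is the desired word up to a sign, removed by multiplying by that sign
        -- again.
        have h3 := (S n d).smul_mem (sgn k (1 * (v.length - 1))) (h_comp (m := 1) (l := n) (f := d)
          (by simp at hv; omega) (by omega) 0 Nat.one_pos hw3 h1)
        have h4 := congrArg (sgn k (1 * (v.length - 1)) • ·) h2
        simp only [List.length_singleton, Nat.cast_one, smul_smul, sgn_mul_self, one_smul,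
          List.append_nil, List.singleton_append] at h4
        exact h4 ▸ h3
      · have h2 := adjComp_wordElt (k := k) (m := 2) (l := n) (c := d) (e := d - 1) (d := 1)
          (by simp at hv; omega) (by omega) (i := 1) [true] [] v rfl rfl rfl rfl hv0
          (by simp at hd; omega)
        have h3 := (S n d).smul_mem (sgn k (1 * (v.length - 1))) (h_comp (m := 2) (l := n) (f := d)
          (by simp at hv; omega) (by omega) 1 Nat.one_lt_two hw2 h1)
        have h4 := congrArg (sgn k (1 * (v.length - 1)) • ·) h2
        simp only [List.length_singleton, Nat.cast_one, smul_smul, sgn_mul_self, one_smul,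
          List.append_nil, List.singleton_append] at h4
        exact h4 ▸ h3

end SAsWords

/-! ### The comparison map and its signs -/

section Phi

variable {k : Type u} [CommRing k]

/-- The coefficients of `phi`. -/
def phiCoef {n : ℕ} {d : ℤ} (x : AdjObj (sAs k) n d) (V U : List Bool) : k :=
  if V = doubled (halved V) ∧ U = (doubledEdges (halved V)).tail then
    sgn k (((halved V).length - 1).choose 2) * wordCoef k n d (halved V) x else 0

/-- The map `S⁻¹As ∨̂ γ → Tw ncGerst`: up to sign, the `N`-ary generator of `S⁻¹As` is sent to the
connected white bamboo, and `γ` to the bamboo made of two disjoint black vertices. -/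
def phi (k : Type u) [CommRing k] (n : ℕ) (d : ℤ) :
    AdjObj (sAs k) n d →ₗ[k] AdjObj (ncGerst k) n d where
  toFun x := ofCoef n d (phiCoef x)
  map_add' x y := by
    refine coef_ext fun V U hV hl hU => ?_
    rw [map_add, coef_ofCoef _ hV hl hU, coef_ofCoef _ hV hl hU, coef_ofCoef _ hV hl hU,
      phiCoef, phiCoef, phiCoef]
    split_ifs
    · rw [map_add, mul_add]
    · rw [add_zero]
  map_smul' a x := by
    refine coef_ext fun V U hV hl hU => ?_
    rw [map_smul, coef_ofCoef _ hV hl hU, coef_ofCoef _ hV hl hU, phiCoef, phiCoef]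
    split_ifs
    · rw [map_smul, smul_eq_mul, smul_eq_mul, RingHom.id_apply, mul_left_comm]
    · rw [smul_zero]

theorem coef_phi {n : ℕ} {d : ℤ} (x : AdjObj (sAs k) n d) (v : List Bool) :
    coef k n d (doubled v) (doubledEdges v).tail (phi k n d x) =
      sgn k ((v.length - 1).choose 2) * wordCoef k n d v x := by
  by_cases h : v.count true = n ∧ v ≠ [] ∧ (v.length : ℤ) = d + 1
  · have h1 := count_tail_doubledEdges h.2.1
    refine (coef_ofCoef (phiCoef x) ((count_true_doubled v).trans h.1)
      (length_tail_doubledEdges h.2.1).symm (by omega)).trans ?_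
    simp [phiCoef]
  · rw [wordCoef_eq_zero _ h, mul_zero]
    by_cases hv : v = []
    · subst hv
      exact coef_eq_zero _ (by simp [doubled])
    · have h1 := count_tail_doubledEdges hv
      refine coef_eq_zero _ fun h' => h ⟨?_, hv, ?_⟩
      · simpa using h'.1
      · omega

theorem coef_phi_eq_zero {n : ℕ} {d : ℤ} (x : AdjObj (sAs k) n d) {V U : List Bool}
    (h : ¬ (V = doubled (halved V) ∧ U = (doubledEdges (halved V)).tail)) :
    coef k n d V U (phi k n d x) = 0 := by
  by_cases hc : V.count true = n ∧ V.length = U.length + 1 ∧ (U.count true : ℤ) = d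
  · exact (coef_ofCoef (phiCoef x) hc.1 hc.2.1 hc.2.2).trans (if_neg h)
  · exact coef_eq_zero _ hc

theorem phi_wordElt {n : ℕ} {d : ℤ} {v : List Bool} (h : v.count true = n) (h' : v ≠ [])
    (hd : (v.length : ℤ) = d + 1) {N : ℕ} (hN : (doubledEdges v).tail.length + 1 = N)
    (hd' : ((doubledEdges v).tail.count true : ℤ) = d) :
    phi k n d (wordElt k n d v) = sgn k ((v.length - 1).choose 2) •
      mono (ncGerst k) (doubled v) (show (ncGerst k).obj N d from
        bamboo k (doubledEdges v).tail hN hd') := by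
  refine coef_ext fun V U hV hl hU => ?_
  rw [map_smul]
  have e := coef_mono (V := V) (U := U) (bamboo k (doubledEdges v).tail hN hd')
    (hN.symm.trans (length_tail_doubledEdges h')) ((count_true_doubled v).trans h)
  rw [e]
  by_cases hVU : V = doubled (halved V) ∧ U = (doubledEdges (halved V)).tail
  · rw [hVU.2]
    set w := halved V with hw
    rw [hVU.1, coef_phi]
    by_cases hvw : v = w
    · subst hvw
      rw [wordCoef_wordElt_self h h' hd]
      simp [bamboo]
    · rw [wordCoef_wordElt_ne (Ne.symm hvw), if_neg]
      · simp
      · intro h1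
        have := congrArg halved h1
        simp at this
        exact hvw this.symm
  · rw [coef_phi_eq_zero _ hVU]
    split_ifs with h1
    · subst h1
      simp only [halved_doubled, true_and] at hVU
      have : (bamboo k (doubledEdges v).tail hN hd').1 U = 0 := Pi.single_eq_of_ne hVU 1
      rw [this, smul_zero]
    · simp

theorem bambooComp_bamboo {m n l : ℕ} {d e c : ℤ} (hl : l + 1 = m + n) (hc : d + e = c) {i : ℕ}
    {x y z u v : List Bool} (hi : x.length = i) (hu : u = x ++ z) (hv : v = x ++ (y ++ z))
    (hm : u.length + 1 = m) (hd : (u.count true : ℤ) = d) (hn : y.length + 1 = n)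
    (he : (y.count true : ℤ) = e) (hl' : v.length + 1 = l) (hc' : (v.count true : ℤ) = c) :
    bambooComp hl hc i (bamboo k u hm hd) (bamboo k y hn he) =
      sgn k (z.count true * y.count true) • bamboo k v hl' hc' := by
  subst hu hv hi
  refine bamboo_ext fun U hU => ?_
  obtain ⟨x', w, rfl, h1, hw⟩ := exists_append (u := U) (a := x.length)
    (b := y.length + z.length) (by simp at hm hl'; omega)
  obtain ⟨y', z', rfl, h2, h3⟩ := exists_append hw
  change bambooCoeff n x.length (Pi.single (x ++ z) 1) (Pi.single y 1) _ =
    sgn k _ * (Pi.single (x ++ (y ++ z)) 1 : List Bool → k) (x' ++ (y' ++ z'))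
  rw [bambooCoeff_append _ _ _ _ _ h1 (by omega)]
  by_cases h : x' ++ (y' ++ z') = x ++ (y ++ z)
  · obtain ⟨h3, h4⟩ := List.append_inj h h1
    obtain ⟨h5, h6⟩ := List.append_inj h4 h2
    subst h3 h5 h6
    simp
  · rw [Pi.single_eq_of_ne h]
    by_cases hxz : x' ++ z' = x ++ z
    · obtain ⟨rfl, rfl⟩ := List.append_inj hxz h1
      have hy : y' ≠ y := by rintro rfl; exact h rfl
      rw [Pi.single_eq_of_ne hy]; simp
    · rw [Pi.single_eq_of_ne hxz]; simp

/-- Both operads concatenate words; only the signs need care. In `S⁻¹As` the sign counts the letters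
to the left of the input, among bamboos the edges to its right. The discrepancy is the product of
the two degrees modulo `2`, which is what the binomial signs of `phi` absorb. By linearity and
finiteness, words suffice. -/
theorem phi_adjComp {m n l : ℕ} {d e c : ℤ} (hl : l + 1 = m + n) (hc : d + e = c) {i : ℕ}
    (hi : i < m) (x : AdjObj (sAs k) m d) (y : AdjObj (sAs k) n e) :
    phi k l c (adjComp hl hc i x y) = adjComp hl hc i (phi k m d x) (phi k n e y) := by
  have key : ∀ v w : List Bool, v.count true = m → v ≠ [] → (v.length : ℤ) = d + 1 →
      w.count true = n → w ≠ [] → (w.length : ℤ) = e + 1 →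
      phi k l c (adjComp hl hc i (wordElt k m d v) (wordElt k n e w)) =
        adjComp hl hc i (phi k m d (wordElt k m d v)) (phi k n e (wordElt k n e w)) := by
    intro v w hv hv' hd hw hw' he
    obtain ⟨a, b, rfl, ha⟩ := exists_split (hv ▸ hi)
    have hne : a ++ (w ++ b) ≠ [] := by simp [hw']
    have c1 := count_tail_doubledEdges hv'
    have c2 := count_tail_doubledEdges hw'
    have c3 := count_tail_doubledEdges hne
    have l1 := length_tail_doubledEdges hv'
    have l2 := length_tail_doubledEdges hw'
    have l3 := length_tail_doubledEdges hne
    have hlen : (a ++ (w ++ b)).length + 1 = (a ++ true :: b).length + w.length := by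
      simp; omega
    rw [adjComp_wordElt hl hc a b w hv hw ha hd hw' he, map_smul,
      phi_wordElt (by simp at hv ⊢; omega) hne (by omega) l3 (by omega),
      phi_wordElt hv hv' hd l1 (by omega), phi_wordElt hw hw' he l2 (by omega)]
    simp only [map_smul, LinearMap.smul_apply]
    have h1 := adjComp_mono (P := ncGerst k) hl hc (i := i) (doubled a) (doubled b)
      (v := doubled (a ++ true :: b)) (w := doubled w)
      (doubled (a ++ (w ++ b))) (by rw [doubled_append]; rfl)
      (by rw [doubled_append, doubled_append])
      (L := (doubled (a ++ (w ++ b))).length) (by simp [doubled_append, doubled]; omega) rfl rfl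
      (by simp [hv]) (by simp [hw]) (by simp [ha]) rfl (by simp [doubled_append, doubled])
      (bamboo k (doubledEdges (a ++ true :: b)).tail l1 (by omega))
      (bamboo k (doubledEdges w).tail l2 (by omega))
    have h2 := bambooComp_bamboo (k := k) (l := (doubled (a ++ (w ++ b))).length)
      (m := (doubled (a ++ true :: b)).length) (n := (doubled w).length)
      (by simp [doubled_append, doubled]; omega) hc (length_doubledEdges' a)
      (tail_doubledEdges_append a b) (tail_doubledEdges_append_append a b hw') l1 (by omega) l2
      (by omega) l3 (by omega)
    erw [h1]
    refine Eq.trans ?_ (congrArg (fun z : (ncGerst k).obj (doubled (a ++ (w ++ b))).length c =>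
      sgn k ((w.length - 1).choose 2) • sgn k (((a ++ true :: b).length - 1).choose 2) •
        (mono (ncGerst k) (doubled (a ++ (w ++ b))) z : AdjObj (ncGerst k) l c)) h2.symm)
    have h3 := mono_smul (P := ncGerst k) (n := l) (doubled (a ++ (w ++ b)))
      (sgn k ((doubledEdges b).count true * (doubledEdges w).tail.count true))
      (bamboo k (doubledEdges (a ++ (w ++ b))).tail l3 (by omega : _ = c))
    refine Eq.trans ?_ (congrArg (fun z =>
      sgn k ((w.length - 1).choose 2) • sgn k (((a ++ true :: b).length - 1).choose 2) • z) h3.symm)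
    rw [smul_smul, smul_smul, smul_smul]
    congr 1
    rw [← sgn_add, ← sgn_add, ← sgn_add]
    refine sgn_eq_of_even_sub ?_
    obtain ⟨W, hW⟩ : ∃ W, w.length = W + 1 := ⟨w.length - 1, by omega⟩
    have e1 : (a ++ (w ++ b)).length - 1 = (a.length + b.length) + W := by simp; omega
    have e2 : (a ++ true :: b).length - 1 = a.length + b.length := by simp
    have e3 : (doubledEdges w).tail.count true = W := by omega
    rw [e1, e2, e3, hW, count_true_doubledEdges, choose_two_add (a.length + b.length) W,
      Nat.add_sub_cancel]
    -- With `W = w.length - 1`, the exponents differ by `a.length * W + (a.length + b.length) * W -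
    -- b.length * W`, twice the witness.
    refine ⟨a.length * W, ?_⟩
    push_cast
    ring
  have s1 : ∀ v, v.count true = m → v ≠ [] → (v.length : ℤ) = d + 1 → ∀ y,
      phi k l c (adjComp hl hc i (wordElt k m d v) y) =
        adjComp hl hc i (phi k m d (wordElt k m d v)) (phi k n e y) := fun v hv hv' hd y =>
    adj_sAs_induction (LinearMap.eqLocus (phi k l c ∘ₗ adjComp hl hc i (wordElt k m d v))
      (adjComp hl hc i (phi k m d (wordElt k m d v)) ∘ₗ phi k n e)) y
      fun w hw hw' he _ => key v w hv hv' hd hw hw' he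
  exact adj_sAs_induction (LinearMap.eqLocus (phi k l c ∘ₗ (adjComp hl hc i).flip y)
      ((adjComp hl hc i).flip (phi k n e y) ∘ₗ phi k m d)) x
      fun v hv hv' hd _ => s1 v hv hv' hd y

end Phi

/-! ### Completeness criteria, maps out of presented operads and into cohomology -/

section General

variable {k : Type u} [CommRing k]

theorem sub_mem_of_forall_succ {M : Type*} [AddCommGroup M] [Module k M] {F : ℕ → Submodule k M}
    (hF : Antitone F) {s : ℕ → M} (hs : ∀ p, s (p + 1) - s p ∈ F p) {p q : ℕ} (h : p ≤ q) :
    s q - s p ∈ F p := by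
  induction q, h using Nat.le_induction with
  | base => simp
  | succ q h ih =>
    rw [← sub_add_sub_cancel]
    exact (F p).add_mem (hF h (hs q)) ih

/-- For a product of coordinates filtered by weight, a coordinate of weight `ω i` is constant along
a compatible sequence from index `ω i + 1` on. Coordinates can therefore be prescribed one at a
time, by `hglue`. -/
theorem complete_of_functionals {M ι : Type*} [AddCommGroup M] [Module k M] {F : ℕ → Submodule k M}
    (hF : Antitone F) (ℓ : ι → M →ₗ[k] k) (ω : ι → ℕ)
    (hmem : ∀ p x, x ∈ F p ↔ ∀ i, ω i < p → ℓ i x = 0) (hext : ∀ x, (∀ i, ℓ i x = 0) → x = 0)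
    (hglue : ∀ s : ι → M, ∃ x, ∀ i, ℓ i x = ℓ i (s i)) :
    (∀ x : M, (∀ p, x ∈ F p) → x = 0) ∧
    ∀ s : ℕ → M, (∀ p, s (p + 1) - s p ∈ F p) → ∃ x, ∀ p, x - s p ∈ F p := by
  refine ⟨fun x hx => hext x fun i => (hmem (ω i + 1) x).1 (hx _) i (Nat.lt_succ_self _), ?_⟩
  intro s hs
  obtain ⟨x, hx⟩ := hglue fun i => s (ω i + 1)
  refine ⟨x, fun p => (hmem _ _).2 fun i hi => ?_⟩
  have := (hmem _ _).1 (sub_mem_of_forall_succ hF hs (Nat.succ_le_of_lt hi)) i (Nat.lt_succ_self _)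
  rw [map_sub, sub_eq_zero] at this
  rw [map_sub, hx, this, sub_self]

/-- A compatible sequence is constant from index `N` on. -/
theorem isComplete_of_fil_eq_bot {P : FDGOperad k} (N : ℕ) (h : ∀ n d, P.fil n d N = ⊥) :
    P.IsComplete := by
  refine fun n d => ⟨fun x hx => by simpa [h] using hx N, fun s hs => ⟨s N, fun p => ?_⟩⟩
  rcases le_total p N with hp | hp
  · exact sub_mem_of_forall_succ (P.fil_anti n d) hs hp
  · have := sub_mem_of_forall_succ (P.fil_anti n d) hs hp
    rw [h, Submodule.mem_bot, sub_eq_zero] at this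
    rw [this, sub_self]
    exact Submodule.zero_mem _

theorem Hom.isIdeal_ker {P Q : FDGOperad k} (ψ : Hom P Q) :
    P.IsIdeal fun n d => LinearMap.ker (ψ.app n d) where
  comp_left hl hf i hi x y hx := by
    rw [LinearMap.mem_ker] at hx ⊢
    rw [ψ.map_comp, hx]; simp
  comp_right hl hf i hi x y hy := by
    rw [LinearMap.mem_ker] at hy ⊢
    rw [ψ.map_comp, hy]; simp
  diff_mem h x hx := by
    rw [LinearMap.mem_ker] at hx ⊢
    rw [ψ.map_diff, hx, map_zero]

/-- A filtered map is continuous, and the zero of a separated target is closed. -/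
theorem Hom.isClosedFamily_ker {P Q : FDGOperad k} (ψ : Hom P Q) (hQ : Q.IsComplete) :
    P.IsClosedFamily fun n d => LinearMap.ker (ψ.app n d) := by
  intro n d x hx
  refine (hQ n d).1 _ fun p => ?_
  obtain ⟨y, hy, hxy⟩ := hx p
  have := ψ.map_fil hxy
  rwa [map_sub, LinearMap.mem_ker.1 hy, sub_zero] at this

theorem Hom.closedIdeal_le_ker {P Q : FDGOperad k} (ψ : Hom P Q) (hQ : Q.IsComplete)
    {R : ∀ n d, Set (P.obj n d)} (hR : ∀ n d, ∀ x ∈ R n d, ψ.app n d x = 0) (n : ℕ) (d : ℤ) :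
    P.closedIdeal R n d ≤ LinearMap.ker (ψ.app n d) := fun _ hx =>
  mem_closedIdeal.1 hx _ ⟨ψ.isIdeal_ker, ψ.isClosedFamily_ker hQ, hR⟩

/-- A morphism to a complete operad which kills the relators induces a morphism from the presented
operad. -/
def Hom.liftPresented {P Q : FDGOperad k} (ψ : Hom P Q) (hQ : Q.IsComplete)
    (R : ∀ n d, Set (P.obj n d)) (hR : ∀ n d, ∀ x ∈ R n d, ψ.app n d x = 0) :
    Hom (P.presented R) Q where
  app n d := (P.closedIdeal R n d).liftQ (ψ.app n d) (ψ.closedIdeal_le_ker hQ hR n d)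
  map_fil := by
    rintro n d p _ ⟨x, hx, rfl⟩
    exact ψ.map_fil hx
  map_one := ψ.map_one
  map_comp := by
    intro m n l d e f hl hf i hi x y
    obtain ⟨x, rfl⟩ := Submodule.Quotient.mk_surjective _ x
    obtain ⟨y, rfl⟩ := Submodule.Quotient.mk_surjective _ y
    exact ψ.map_comp hl hf i hi x y
  map_diff := by
    intro n d e h x
    obtain ⟨x, rfl⟩ := Submodule.Quotient.mk_surjective _ x
    exact ψ.map_diff h x

/-- A morphism with values in cocycles, from an operad with zero differential, induces a morphism to
the cohomology. -/
def Hom.toCohomology {P Q : FDGOperad k} (ψ : Hom P Q)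
    (hψ : ∀ n d x, Q.diff n rfl (ψ.app n d x) = 0)
    (hP : ∀ {n d e} (h : d + 1 = e) (x : P.obj n d), P.diff n h x = 0) : Hom P Q.cohomology where
  app n d := (Q.boundaries n d).mkQ ∘ₗ (ψ.app n d).codRestrict (LinearMap.ker (Q.diff n rfl))
    (hψ n d)
  map_fil {n d p x} hx := ⟨⟨ψ.app n d x, hψ n d x⟩, ψ.map_fil hx, rfl⟩
  map_one := congrArg (Q.boundaries 1 0).mkQ (Subtype.ext ψ.map_one)
  map_comp {m n l d e f} hl hf i hi x y :=
    congrArg (Q.boundaries l f).mkQ (Subtype.ext (ψ.map_comp hl hf i hi x y))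
  map_diff {n d e} h x := by
    subst h
    rw [hP rfl, map_zero]
    have h0 : Q.cycles.diff n rfl ⟨ψ.app n d x, hψ n d x⟩ = 0 := Subtype.ext (hψ n d x)
    exact ((congrArg (Q.boundaries n (d + 1)).mkQ h0).trans (map_zero _)).symm

theorem Hom.isIso_of_bijective {P Q : FDGOperad k} (φ : Hom P Q)
    (hb : ∀ n d, Function.Bijective (φ.app n d))
    (hfil : ∀ n d p x, φ.app n d x ∈ Q.fil n d p → x ∈ P.fil n d p) : φ.IsIso := by
  let E := fun n d => LinearEquiv.ofBijective (φ.app n d) (hb n d)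
  have hE : ∀ n d y, φ.app n d ((E n d).symm y) = y := fun n d y => (E n d).apply_symm_apply y
  refine ⟨⟨fun n d => (E n d).symm, ?_, ?_, ?_, ?_⟩, fun n d x => (E n d).symm_apply_apply x, hE⟩
  · intro n d p y hy
    exact hfil n d p _ (by rw [LinearEquiv.coe_coe, hE]; exact hy)
  · exact (hb 1 0).1 ((hE _ _ _).trans φ.map_one.symm)
  · intro m n l d e f hl hf i hi x y
    refine (hb l f).1 ?_
    rw [φ.map_comp]
    simp only [LinearEquiv.coe_coe, hE]
  · intro n d e h x
    refine (hb n e).1 ?_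
    rw [φ.map_diff]
    simp only [LinearEquiv.coe_coe, hE]

end General

/-! ### The images of the generators are cocycles -/

section Cocycles

variable {k : Type u} [CommRing k]

theorem muBlack_eq : muBlack k = mono (ncGerst k) [false, true] (edge k) +
    mono (ncGerst k) [true, false] (edge k) := muAlpha_eq _ _

/-- There is no black vertex for `D` to act on. The black vertex added by `ad_μ` can stand before,
between or after the white ones; each position arises twice, and the two terms cancel by
anti-associativity of the edge. -/
theorem twDiff_whiteEdge : twDiff k 2 one_add_one_eq_two
    (mono (ncGerst k) [true, true] (edge k)) = 0 := by
  have b1 : bsplits [true, true] = ∅ := by decide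
  have c1 := adjComp_mono (P := ncGerst k) (m := 1) (n := 2) (l := 2) rfl
    (one_add_one_eq_two (R := ℤ)) (i := 0) [false] [] (v := [false, true]) (w := [true, true])
    [false, true, true] (N := 2) (N' := 2) (L := 3) rfl rfl rfl rfl rfl rfl rfl rfl rfl
    Nat.one_lt_two (edge k) (edge k)
  have c2 := adjComp_mono (P := ncGerst k) (m := 1) (n := 2) (l := 2) rfl
    (one_add_one_eq_two (R := ℤ)) (i := 0) [] [false] (v := [true, false]) (w := [true, true])
    [true, true, false] (N := 2) (N' := 2) (L := 3) rfl rfl rfl rfl rfl rfl rfl rfl rfl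
    Nat.two_pos (edge k) (edge k)
  have c3 := adjComp_mono (P := ncGerst k) (m := 2) (n := 1) (l := 2) rfl
    (one_add_one_eq_two (R := ℤ)) (i := 0) [] [true] (v := [true, true]) (w := [false, true])
    [false, true, true] (N := 2) (N' := 2) (L := 3) rfl rfl rfl rfl rfl rfl rfl rfl rfl
    Nat.two_pos (edge k) (edge k)
  have c4 := adjComp_mono (P := ncGerst k) (m := 2) (n := 1) (l := 2) rfl
    (one_add_one_eq_two (R := ℤ)) (i := 0) [] [true] (v := [true, true]) (w := [true, false])
    [true, false, true] (N := 2) (N' := 2) (L := 3) rfl rfl rfl rfl rfl rfl rfl rfl rfl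
    Nat.two_pos (edge k) (edge k)
  have c5 := adjComp_mono (P := ncGerst k) (m := 2) (n := 1) (l := 2) rfl
    (one_add_one_eq_two (R := ℤ)) (i := 1) [true] [] (v := [true, true]) (w := [false, true])
    [true, false, true] (N := 2) (N' := 2) (L := 3) rfl rfl rfl rfl rfl rfl rfl rfl rfl
    Nat.one_lt_two (edge k) (edge k)
  have c6 := adjComp_mono (P := ncGerst k) (m := 2) (n := 1) (l := 2) rfl
    (one_add_one_eq_two (R := ℤ)) (i := 1) [true] [] (v := [true, true]) (w := [true, false])
    [true, true, false] (N := 2) (N' := 2) (L := 3) rfl rfl rfl rfl rfl rfl rfl rfl rfl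
    Nat.one_lt_two (edge k) (edge k)
  have d1 := mcDer_mono (P := ncGerst k) (edge k) 2 (one_add_one_eq_two (R := ℤ)) [true, true]
    (N := 2) rfl rfl (edge k)
  rw [b1, Finset.sum_empty, smul_zero, neg_zero] at d1
  rw [twDiff_eq, d1, muBlack_eq, Finset.sum_range_succ, Finset.sum_range_one]
  simp only [map_add, LinearMap.add_apply, c1, c2, c3, c4, c5, c6, zero_add, sgn_one, neg_smul,
    one_smul, sub_neg_eq_add, List.length_nil, List.length_singleton]
  have hm := eq_neg_of_add_eq_zero_left (edge_assoc k)
  have e : ∀ w, (mono (ncGerst k) w ((ncGerst k).comp (m := 2) (n := 2) (l := 3) rfl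
      one_add_one_eq_two 0 Nat.two_pos (edge k) (edge k)) : AdjObj (ncGerst k) 2 2) =
        - mono (ncGerst k) w ((ncGerst k).comp (m := 2) (n := 2) (l := 3) rfl
          one_add_one_eq_two 1 Nat.one_lt_two (edge k) (edge k)) := fun w => by
    rw [hm, ← neg_one_smul k, mono_smul, neg_one_smul]
  simp only [e]
  abel

/-- There is no input to compose with `μ`. Doubling one of the two black points gives the same
bamboos as hanging a third one on an end, and `D(α) = -m(α, α)` makes the signs opposite. -/
theorem twDiff_twoBlackPoints : twDiff k 0 (zero_add 1)
    (mono (ncGerst k) [false, false] (twoPoints k)) = 0 := by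
  have b1 : bsplits [false, false] = {([], [false]), ([false], [])} := by decide
  have c1 := adjComp_mono (P := ncGerst k) (m := 1) (n := 0) (l := 0) rfl
    (add_zero (1 : ℤ)) (i := 0) [false] [] (v := [false, true]) (w := [false, false])
    [false, false, false] (N := 2) (N' := 2) (L := 3) rfl rfl rfl rfl rfl rfl rfl rfl rfl
    Nat.one_lt_two (edge k) (twoPoints k)
  have c2 := adjComp_mono (P := ncGerst k) (m := 1) (n := 0) (l := 0) rfl
    (add_zero (1 : ℤ)) (i := 0) [] [false] (v := [true, false]) (w := [false, false])
    [false, false, false] (N := 2) (N' := 2) (L := 3) rfl rfl rfl rfl rfl rfl rfl rfl rfl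
    Nat.two_pos (edge k) (twoPoints k)
  have d1 := mcDer_mono (P := ncGerst k) (edge k) 0 (zero_add (1 : ℤ)) [false, false]
    (N := 2) rfl rfl (twoPoints k)
  rw [b1, Finset.sum_pair (by decide), compz_pos _ _ _ _ (show ([] : List Bool).length < 2 from
    Nat.two_pos), compz_pos _ _ _ _ (show [false].length < 2 from Nat.one_lt_two)] at d1
  have e1 : (ncGerst k).comp (m := 2) (n := 2) (l := 3) rfl (add_zero (1 : ℤ)) 1 Nat.one_lt_two
      (edge k) (twoPoints k) = (ncGerst k).comp (m := 2) (n := 2) (l := 3) rfl (zero_add (1 : ℤ)) 0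
        Nat.two_pos (twoPoints k) (edge k) := by
    have h1 := bambooComp_bamboo (k := k) (m := 2) (n := 2) (l := 3) rfl (add_zero (1 : ℤ)) (i := 1)
      (x := [true]) (y := [false]) (z := []) rfl rfl rfl rfl rfl rfl rfl rfl rfl
    have h2 := bambooComp_bamboo (k := k) (m := 2) (n := 2) (l := 3) rfl (zero_add (1 : ℤ)) (i := 0)
      (x := []) (y := [true]) (z := [false]) rfl rfl rfl rfl rfl rfl rfl rfl rfl
    refine (h1.trans ?_).trans h2.symm
    simp
  have e2 : (ncGerst k).comp (m := 2) (n := 2) (l := 3) rfl (add_zero (1 : ℤ)) 0 Nat.two_pos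
      (edge k) (twoPoints k) = (ncGerst k).comp (m := 2) (n := 2) (l := 3) rfl (zero_add (1 : ℤ)) 1
        Nat.one_lt_two (twoPoints k) (edge k) := by
    have h1 := bambooComp_bamboo (k := k) (m := 2) (n := 2) (l := 3) rfl (add_zero (1 : ℤ)) (i := 0)
      (x := []) (y := [false]) (z := [true]) rfl rfl rfl rfl rfl rfl rfl rfl rfl
    have h2 := bambooComp_bamboo (k := k) (m := 2) (n := 2) (l := 3) rfl (zero_add (1 : ℤ)) (i := 1)
      (x := [false]) (y := [true]) (z := []) rfl rfl rfl rfl rfl rfl rfl rfl rfl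
    refine (h1.trans ?_).trans h2.symm
    simp
  rw [twDiff_eq, d1, muBlack_eq, Finset.sum_range_zero]
  simp only [map_add, LinearMap.add_apply, c1, c2, sgn_zero, one_smul, smul_zero, sub_zero,
    List.nil_append, List.cons_append, List.length_nil, List.length_singleton]
  rw [e1, e2]
  abel

end Cocycles

/-! ### Filtrations, completeness and the morphism `φ` -/

variable {k : Type u} [CommRing k]

theorem mem_disc {V : Type u} [AddCommGroup V] [Module k V] {p q : ℕ} {x : V} :
    x ∈ disc (k := k) V (p - q) ↔ (q < p → x = 0) := by
  unfold disc
  split_ifs with h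
  · simp; omega
  · simp; omega

/-- Since `ncGerst` is filtered trivially, the filtration only counts black vertices. -/
theorem mem_fil_TwNcGerst {n : ℕ} {d : ℤ} {p : ℕ} {f : (TwNcGerst k).obj n d} :
    f ∈ (TwNcGerst k).fil n d p ↔
      ∀ i : List Bool × List Bool, i.1.count false < p → coef k n d i.1 i.2 f = 0 := by
  constructor
  · rintro h ⟨V, U⟩ hV
    by_cases hn : V.count true = n
    · have h1 := mem_disc.1 (h ⟨V, hn⟩ trivial) ((one_mul _).trans_lt hV)
      exact (coef_eq hn U f).trans (congrFun (congrArg Subtype.val h1) U)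
    · exact coef_eq_zero_of_count hn _ _
  · intro h V _
    refine mem_disc.2 fun hV => Subtype.ext (funext fun U => ?_)
    exact (coef_eq V.2 U f).symm.trans (h (V.1, U) ((one_mul _).symm.trans_lt hV))

theorem mem_fil_sAsFree {w n : ℕ} {d : ℤ} {p : ℕ} {f : (sAsFree k w).obj n d} :
    f ∈ (sAsFree k w).fil n d p ↔
      ∀ v : List Bool, w * v.count false < p → wordCoef k n d v f = 0 := by
  constructor
  · intro h v hv
    by_cases hn : v.count true = n
    · exact (wordCoef_eq hn f).trans (congrArg Subtype.val (mem_disc.1 (h ⟨v, hn⟩ trivial) hv))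
    · exact wordCoef_eq_zero _ fun h => hn h.1
  · intro h v _
    refine mem_disc.2 fun hv => Subtype.ext ?_
    exact (wordCoef_eq v.2 f).symm.trans (h v.1 hv)

theorem isComplete_TwNcGerst (k : Type u) [CommRing k] : (TwNcGerst k).IsComplete := by
  intro n d
  refine complete_of_functionals ((TwNcGerst k).fil_anti n d)
    (fun i : List Bool × List Bool => coef k n d i.1 i.2) (fun i => i.1.count false)
    (fun _ _ => mem_fil_TwNcGerst)
    (fun x hx => coef_ext fun V U _ _ _ => (hx (V, U)).trans (map_zero _).symm) fun s => ?_
  refine ⟨ofCoef n d fun V U => coef k n d V U (s (V, U)), fun ⟨V, U⟩ => ?_⟩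
  by_cases h : V.count true = n ∧ V.length = U.length + 1 ∧ (U.count true : ℤ) = d
  · exact coef_ofCoef _ h.1 h.2.1 h.2.2
  · exact (coef_eq_zero _ h).trans (coef_eq_zero _ h).symm

theorem isComplete_sAsFree (k : Type u) [CommRing k] (w : ℕ) : (sAsFree k w).IsComplete := by
  intro n d
  refine complete_of_functionals ((sAsFree k w).fil_anti n d)
    (wordCoef k n d) (fun v => w * v.count false) (fun _ _ => mem_fil_sAsFree)
    (fun x hx => adj_sAs_ext fun v _ _ _ => (hx v).trans (map_zero _).symm) fun s => ?_
  refine ⟨fun v => s v.1 v, fun v => ?_⟩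
  by_cases h : v.count true = n
  · exact (wordCoef_eq h _).trans (wordCoef_eq h (s v)).symm
  · exact (wordCoef_eq_zero _ fun h' => h h'.1).trans (wordCoef_eq_zero (s v) fun h' => h h'.1).symm

/-- Only the filtration depends on the weight, so the unit in weight `0` is definitionally the unit
for every `w`. -/
theorem wordElt_one : wordElt k 1 0 [true] = (sAsFree k 0).one := by
  have : nu k 1 0 = (sAs k).one := Subtype.ext (nu_val le_rfl rfl)
  exact congrArg (mono (sAs k) [true]) this

theorem wordElt_b (w : ℕ) : wordElt k 2 1 [true, true] = sAsFree.b k w := by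
  have : nu k 2 1 = sAs.b k := Subtype.ext (nu_val one_le_two rfl)
  exact congrArg (mono (sAs k) [true, true]) this

theorem wordElt_γ (w : ℕ) : wordElt k 0 0 [false] = sAsFree.γ k w := by
  have : nu k 1 0 = (sAs k).one := Subtype.ext (nu_val le_rfl rfl)
  exact congrArg (mono (sAs k) [false]) this

theorem phi_one : phi k 1 0 (sAsFree k 0).one = (TwNcGerst k).one := by
  refine (congrArg (phi k 1 0) wordElt_one.symm).trans
    ((phi_wordElt (v := [true]) (N := 1) rfl (by simp) rfl rfl rfl).trans ?_)
  exact (congrArg₂ (· • ·) sgn_zero rfl).trans (one_smul k _)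

theorem phi_b (w : ℕ) : phi k 2 1 (sAsFree.b k w) = whiteEdge k := by
  refine (congrArg (phi k 2 1) (wordElt_b w).symm).trans
    ((phi_wordElt (v := [true, true]) (N := 2) rfl (by simp) rfl rfl rfl).trans ?_)
  exact (congrArg₂ (· • ·) sgn_zero rfl).trans (one_smul k _)

theorem phi_γ (w : ℕ) : phi k 0 0 (sAsFree.γ k w) = twoBlackPoints k := by
  refine (congrArg (phi k 0 0) (wordElt_γ w).symm).trans
    ((phi_wordElt (v := [false]) (N := 2) rfl (by simp) rfl rfl rfl).trans ?_)
  exact (congrArg₂ (· • ·) sgn_zero rfl).trans (one_smul k _)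

theorem diff_comp_eq_zero {P : FDGOperad k} {m n l : ℕ} {d e f : ℤ} (hl : l + 1 = m + n)
    (hf : d + e = f) (i : ℕ) (hi : i < m) {x : P.obj m d} {y : P.obj n e}
    (hx : P.diff m rfl x = 0) (hy : P.diff n rfl y = 0) :
    P.diff l rfl (P.comp hl hf i hi x y) = 0 := by
  rw [P.diff_comp hl hf rfl rfl rfl (by omega) (by omega) i hi, hx, hy]
  simp

/-- Cocycles contain the unit and are stable under composition, so the two generators decide. Any
weight serves for the generation argument. -/
theorem diff_phi (n : ℕ) (d : ℤ) (x : AdjObj (sAs k) n d) :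
    (TwNcGerst k).diff n rfl (phi k n d x) = 0 := by
  refine sAsFree_generated (w := 1)
    (fun n d => LinearMap.ker (((TwNcGerst k).diff n rfl).comp (phi k n d))) ?_ ?_ ?_ ?_ n d x
  · refine (congrArg ((TwNcGerst k).diff 1 rfl) phi_one).trans ((TwNcGerst k).diff_one rfl)
  · exact (congrArg ((TwNcGerst k).diff 2 rfl) (phi_b 1)).trans twDiff_whiteEdge
  · exact (congrArg ((TwNcGerst k).diff 0 rfl) (phi_γ 1)).trans twDiff_twoBlackPoints
  · intro m n l d e f hl hf i hi x y hx hy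
    subst hf
    have hx' : (TwNcGerst k).diff m rfl (phi k m d x) = 0 := hx
    have hy' : (TwNcGerst k).diff n rfl (phi k n e y) = 0 := hy
    refine (congrArg ((TwNcGerst k).diff l rfl) (phi_adjComp hl rfl hi x y)).trans ?_
    exact diff_comp_eq_zero hl rfl i hi hx' hy'

/-- The morphism `S⁻¹As ∨̂ γ → Tw ncGerst` which sends `b` to the white edge and `γ` to the two
disjoint black vertices. -/
def phiHom (k : Type u) [CommRing k] {w : ℕ} (hw : w ≤ 2) : Hom (sAsFree k w) (TwNcGerst k) where
  app n d := phi k n d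
  map_fil {n d p x} hx := by
    refine mem_fil_TwNcGerst.2 fun ⟨V, U⟩ hV => ?_
    by_cases h : V = doubled (halved V) ∧ U = (doubledEdges (halved V)).tail
    · have h1 := coef_phi x (halved V)
      rw [← h.1, ← h.2] at h1
      refine h1.trans ?_
      rw [mem_fil_sAsFree.1 hx, mul_zero]
      refine lt_of_le_of_lt ?_ hV
      simp only
      rw [h.1, count_false_doubled, halved_doubled]
      -- A word with `j` letters `γ` has weight `w * j` and its image has `2 * j` black vertices;
      -- this is where `w ≤ 2` enters.
      exact Nat.mul_le_mul_right _ hw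
    · exact coef_phi_eq_zero x h
  map_one := phi_one
  map_comp hl hf _ hi x y := phi_adjComp hl hf hi x y
  map_diff {n d e} h x := by
    subst h
    exact (map_zero (phi k n _)).trans (diff_phi n d x).symm

/-- Generation is algebraic, so uniqueness requires neither continuity nor a separated target. -/
theorem Hom.eq_of_generators {w : ℕ} {Q : FDGOperad k} {φ φ' : Hom (sAsFree k w) Q}
    (hb : φ'.app 2 1 (sAsFree.b k w) = φ.app 2 1 (sAsFree.b k w))
    (hγ : φ'.app 0 0 (sAsFree.γ k w) = φ.app 0 0 (sAsFree.γ k w)) : φ' = φ := by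
  have h : φ'.app = φ.app := by
    funext n d
    refine LinearMap.ext fun x => ?_
    refine sAsFree_generated (fun n d => LinearMap.eqLocus (φ'.app n d) (φ.app n d))
      (φ'.map_one.trans φ.map_one.symm) hb hγ ?_ n d x
    intro m n l d e f hl hf i hi x y hx hy
    rw [LinearMap.mem_eqLocus] at hx hy ⊢
    rw [φ'.map_comp, φ.map_comp, hx, hy]
  cases φ
  cases φ'
  cases h
  rfl

/-! ### Cohomology classes detected by two coefficients -/

/-- The coefficient of the connected white bamboo. -/
def whiteCoef (k : Type u) [CommRing k] (n : ℕ) (d : ℤ) : (TwNcGerst k).obj n d →ₗ[k] k :=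
  coef k n d (List.replicate n true) (List.replicate (n - 1) true)

/-- The coefficient of the bamboo made of two disjoint black vertices. -/
def twoBlackCoef (k : Type u) [CommRing k] (n : ℕ) (d : ℤ) : (TwNcGerst k).obj n d →ₗ[k] k :=
  coef k n d [false, false] [false]

/-- The cohomology embeds in `k × k` through these functionals: they kill coboundaries, and a
cocycle on which both vanish has the explicit primitive given by the homotopy. -/
theorem cls_eq_zero_iff {n : ℕ} {d : ℤ} {x : (TwNcGerst k).obj n d}
    (hx : (TwNcGerst k).diff n rfl x = 0) :
    (TwNcGerst k).cls x hx = 0 ↔ whiteCoef k n d x = 0 ∧ twoBlackCoef k n d x = 0 := by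
  refine (Submodule.Quotient.mk_eq_zero _).trans ⟨?_, fun h => ?_⟩
  · rintro ⟨y, rfl⟩
    exact ⟨coef_twDiff_white _ y (by simp) _, coef_twDiff_twoBlack _ y⟩
  · exact ⟨primitive (d - 1) x, twDiff_primitive _ rfl x hx h.1 h.2⟩

theorem exists_cls (P : FDGOperad k) {n : ℕ} {d : ℤ} (y : P.cohomology.obj n d) :
    ∃ x hx, y = P.cls (n := n) (d := d) x hx := by
  obtain ⟨⟨x, hx⟩, rfl⟩ := Submodule.Quotient.mk_surjective _ y
  exact ⟨x, hx, rfl⟩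

theorem exists_of_mem_fil_cohomology {P : FDGOperad k} {n : ℕ} {d : ℤ} {p : ℕ}
    {y : P.cohomology.obj n d} (hy : y ∈ P.cohomology.fil n d p) :
    ∃ x hx, x ∈ P.fil n d p ∧ y = P.cls (n := n) (d := d) x hx := by
  obtain ⟨⟨x, hx⟩, h, rfl⟩ := hy
  exact ⟨x, hx, h, rfl⟩

theorem whiteCoef_eq_zero {n : ℕ} {d : ℤ} {p : ℕ} (hp : 0 < p) {x : (TwNcGerst k).obj n d}
    (hx : x ∈ (TwNcGerst k).fil n d p) : whiteCoef k n d x = 0 :=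
  mem_fil_TwNcGerst.1 hx (_, _) (by simpa [List.count_replicate] using hp)

theorem twoBlackCoef_eq_zero {n : ℕ} {d : ℤ} {p : ℕ} (hp : 2 < p) {x : (TwNcGerst k).obj n d}
    (hx : x ∈ (TwNcGerst k).fil n d p) : twoBlackCoef k n d x = 0 :=
  mem_fil_TwNcGerst.1 hx (_, _) hp

/-- The two detecting bamboos have zero and two black vertices, so a representative in `F₃` has both
coefficients zero. -/
theorem fil_cohomology_TwNcGerst (n : ℕ) (d : ℤ) : (TwNcGerst k).cohomology.fil n d 3 = ⊥ := by
  refine (Submodule.eq_bot_iff _).2 fun y hy => ?_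
  obtain ⟨x, hx, h, rfl⟩ := exists_of_mem_fil_cohomology hy
  exact (cls_eq_zero_iff hx).2 ⟨whiteCoef_eq_zero (Nat.succ_pos _) h, twoBlackCoef_eq_zero (by simp) h⟩

theorem isComplete_cohomology_TwNcGerst (k : Type u) [CommRing k] :
    (TwNcGerst k).cohomology.IsComplete :=
  isComplete_of_fil_eq_bot 3 fil_cohomology_TwNcGerst

theorem doubled_replicate (n : ℕ) : doubled (List.replicate n true) = List.replicate n true := by
  induction n with
  | zero => rfl
  | succ n ih => simp [List.replicate_succ, doubled, ih]

theorem doubledEdges_replicate (n : ℕ) :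
    doubledEdges (List.replicate n true) = List.replicate n true := by
  induction n with
  | zero => rfl
  | succ n ih => simp [List.replicate_succ, doubledEdges, ih]

theorem whiteCoef_phi {n : ℕ} {d : ℤ} (x : AdjObj (sAs k) n d) :
    whiteCoef k n d (phi k n d x) =
      sgn k ((n - 1).choose 2) * wordCoef k n d (List.replicate n true) x := by
  have := coef_phi x (List.replicate n true)
  rwa [doubled_replicate, doubledEdges_replicate, List.tail_replicate, List.length_replicate] at this

theorem twoBlackCoef_phi {n : ℕ} {d : ℤ} (x : AdjObj (sAs k) n d) :
    twoBlackCoef k n d (phi k n d x) = wordCoef k n d [false] x := by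
  refine (coef_phi x [false]).trans ?_
  exact (congrArg (· * _) sgn_zero).trans (one_mul _)

/-! ### The ideal of relations -/

theorem relator_left (w : ℕ) : (sAsFree k w).comp (m := 2) (n := 0) rfl (add_zero 1) 0 Nat.two_pos
    (sAsFree.b k w) (sAsFree.γ k w) = wordElt k 1 1 [false, true] := by
  rw [← wordElt_b, ← wordElt_γ]
  refine (adjComp_wordElt (m := 2) (n := 0) rfl (add_zero 1) [] [true] [false] rfl rfl rfl rfl (by simp) rfl).trans ?_
  exact (congrArg₂ (· • ·) sgn_zero rfl).trans (one_smul k _)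

theorem relator_right (w : ℕ) : (sAsFree k w).comp (m := 2) (n := 0) rfl (add_zero 1) 1
    Nat.one_lt_two (sAsFree.b k w) (sAsFree.γ k w) = wordElt k 1 1 [true, false] := by
  rw [← wordElt_b, ← wordElt_γ]
  refine (adjComp_wordElt (m := 2) (n := 0) rfl (add_zero 1) [true] [] [false] rfl rfl rfl rfl (by simp) rfl).trans ?_
  exact (congrArg₂ (· • ·) sgn_zero rfl).trans (one_smul k _)

/-- The closed ideal generated by `b(γ, -)` and `b(-, γ)`. -/
def relIdeal (k : Type u) [CommRing k] (w n : ℕ) (d : ℤ) : Submodule k ((sAsFree k w).obj n d) :=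
  (sAsFree k w).closedIdeal (fun n d => {x | SAsPlusRel k w n d x}) n d

theorem isIdeal_relIdeal (w : ℕ) : (sAsFree k w).IsIdeal (relIdeal k w) :=
  (sAsFree k w).isIdeal_closedIdeal _

theorem relIdeal_of_rel {w n : ℕ} {d : ℤ} {x : (sAsFree k w).obj n d} (h : SAsPlusRel k w n d x) :
    x ∈ relIdeal k w n d :=
  mem_closedIdeal.2 fun _ hI => hI.2.2 n d h

theorem mem_of_sgn_smul_mem {M : Type*} [AddCommGroup M] [Module k M] {S : Submodule k M} {x : M}
    (a : ℤ) (h : sgn k a • x ∈ S) : x ∈ S := by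
  have := S.smul_mem (sgn k a) h
  rwa [smul_smul, sgn_mul_self, one_smul] at this

/-- Two of the cases are the relators; `b(γ, γ)` is obtained by plugging `γ` into `b(γ, -)`. -/
theorem wordElt_mem_relIdeal_two (w : ℕ) (p q : Bool) (h : false ∈ [p, q]) :
    wordElt k ([p, q].count true) 1 [p, q] ∈ relIdeal k w ([p, q].count true) 1 := by
  have hft : wordElt k 1 1 [false, true] ∈ relIdeal k w 1 1 :=
    relator_left (k := k) w ▸ relIdeal_of_rel SAsPlusRel.left
  match p, q with
  | false, true => exact hft
  | true, false => exact relator_right (k := k) w ▸ relIdeal_of_rel SAsPlusRel.right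
  | false, false =>
    have h1 := (isIdeal_relIdeal w).comp_left (m := 1) (n := 0) (l := 0) rfl (add_zero 1) 0 Nat.one_pos
      (sAsFree.γ k w) hft
    have h2 := adjComp_wordElt (k := k) (m := 1) (n := 0) (l := 0) rfl (add_zero 1) (i := 0) [false] []
      [false] rfl rfl rfl rfl (by simp) rfl
    rw [← wordElt_γ] at h1
    exact mem_of_sgn_smul_mem _ (h2 ▸ h1)

theorem exists_eq_append_of_false_mem {v : List Bool} (h : false ∈ v) (h' : v ≠ [false]) :
    ∃ a p q b, v = a ++ ([p, q] ++ b) ∧ false ∈ [p, q] := by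
  obtain ⟨x, z, rfl⟩ := List.append_of_mem h
  match z with
  | q :: b => exact ⟨x, false, q, b, rfl, by simp⟩
  | [] =>
    rcases List.eq_nil_or_concat' x with rfl | ⟨a, p, rfl⟩
    · exact absurd rfl h'
    · exact ⟨a, p, false, [], by simp, by simp⟩

/-- A letter `γ` in a word of length at least two has a neighbour; collapsing this adjacent pair to
one input writes the word, up to sign, as a composite with a two-letter element of the ideal. -/
theorem wordElt_mem_relIdeal (w : ℕ) {n : ℕ} {d : ℤ} {v : List Bool} (hn : v.count true = n)
    (hd : (v.length : ℤ) = d + 1) (h : false ∈ v) (h' : v ≠ [false]) :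
    wordElt k n d v ∈ relIdeal k w n d := by
  obtain ⟨a, p, q, b, rfl, hpq⟩ := exists_eq_append_of_false_mem h h'
  simp only [List.count_append, List.length_append, List.length_cons, List.length_nil] at hn hd
  have hl : n + 1 = (a ++ true :: b).count true + [p, q].count true := by
    rw [List.count_append, List.count_cons_self]; omega
  have hc : d - 1 + 1 = d := sub_add_cancel d 1
  have hi : a.count true < (a ++ true :: b).count true := by simp
  have h1 := (isIdeal_relIdeal w).comp_right hl hc (a.count true) hi
    (wordElt k _ _ (a ++ true :: b)) (wordElt_mem_relIdeal_two w p q hpq)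
  have h2 := adjComp_wordElt (k := k) hl hc a b [p, q] rfl rfl rfl
    (by simp only [List.length_append, List.length_cons]; omega) (by simp) rfl
  exact mem_of_sgn_smul_mem _ (h2 ▸ h1)

/-- Only the word without `γ` and the single letter `γ` survive in the quotient. No limit is needed
for membership since `x` is a finite sum of words. -/
theorem mem_relIdeal {w n : ℕ} {d : ℤ} {x : AdjObj (sAs k) n d}
    (h₁ : wordCoef k n d (List.replicate n true) x = 0) (h₂ : wordCoef k n d [false] x = 0) :
    x ∈ relIdeal k w n d := by
  refine adj_sAs_induction (relIdeal k w n d) x fun v hn _ hd hv => ?_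
  refine wordElt_mem_relIdeal w hn hd ?_ fun h => hv (h ▸ h₂)
  by_contra h
  have h3 := eq_replicate_true h
  have h4 : v.length = n := by rw [← hn, h3]; simp
  rw [h4] at h3
  exact hv (h3 ▸ h₁)

theorem mk_eq_zero {w n : ℕ} {d : ℤ} {x : AdjObj (sAs k) n d}
    (h₁ : wordCoef k n d (List.replicate n true) x = 0) (h₂ : wordCoef k n d [false] x = 0) :
    sAsPlus.mk k w (n := n) (d := d) x = 0 :=
  (Submodule.Quotient.mk_eq_zero _).2 (mem_relIdeal h₁ h₂)

/-- The surviving words have weights `0` and `w`, both less than `3`. -/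
theorem fil_sAsPlus {w : ℕ} (hw : w ≤ 2) (n : ℕ) (d : ℤ) : (sAsPlus k w).fil n d 3 = ⊥ := by
  refine (Submodule.eq_bot_iff _).2 ?_
  rintro _ ⟨x, hx, rfl⟩
  exact mk_eq_zero (mem_fil_sAsFree.1 hx _ (by simp [List.count_replicate]))
    (mem_fil_sAsFree.1 hx _ (by simp; omega))

theorem isComplete_sAsPlus (k : Type u) [CommRing k] {w : ℕ} (hw : w ≤ 2) :
    (sAsPlus k w).IsComplete :=
  isComplete_of_fil_eq_bot 3 (fil_sAsPlus hw)

/-- Along `phi`, the functionals detecting classes become the coefficients of the two surviving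
words, up to an invertible sign. -/
theorem cls_phi_eq_zero_iff {n : ℕ} {d : ℤ} {x : AdjObj (sAs k) n d} :
    (TwNcGerst k).cls (phi k n d x) (diff_phi n d x) = 0 ↔
      wordCoef k n d (List.replicate n true) x = 0 ∧ wordCoef k n d [false] x = 0 := by
  have e : ∀ c : k, sgn k ((n - 1).choose 2) * c = 0 ↔ c = 0 := fun c =>
    ⟨fun h => by simpa [← mul_assoc, sgn_mul_self] using congrArg (sgn k ((n - 1).choose 2) * ·) h,
      fun h => by rw [h, mul_zero]⟩
  refine (cls_eq_zero_iff _).trans (and_congr ?_ (Eq.congr_left (twoBlackCoef_phi x)))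
  exact (Eq.congr_left (whiteCoef_phi x)).trans (e _)

theorem cls_phi_relator {w n : ℕ} {d : ℤ} {x : (sAsFree k w).obj n d} (h : SAsPlusRel k w n d x) :
    (TwNcGerst k).cls (phi k n d x) (diff_phi n d x) = 0 := by
  refine cls_phi_eq_zero_iff.2 ?_
  cases h with
  | left =>
    exact ⟨(congrArg _ (relator_left w)).trans (wordCoef_wordElt_ne (by simp)),
      (congrArg _ (relator_left w)).trans (wordCoef_wordElt_ne (by simp))⟩
  | right =>
    exact ⟨(congrArg _ (relator_right w)).trans (wordCoef_wordElt_ne (by simp)),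
      (congrArg _ (relator_right w)).trans (wordCoef_wordElt_ne (by simp))⟩

/-! ### The induced isomorphism -/

/-- The morphism induced by `phiHom` from `S⁻¹As⁺` to the cohomology. -/
def plusHom (k : Type u) [CommRing k] {w : ℕ} (hw : w ≤ 2) :
    Hom (sAsPlus k w) (TwNcGerst k).cohomology :=
  ((phiHom k hw).toCohomology diff_phi fun _ _ => rfl).liftPresented
    (isComplete_cohomology_TwNcGerst k) _ fun _ _ _ h => cls_phi_relator h

theorem plusHom_mk {w : ℕ} (hw : w ≤ 2) (n : ℕ) (d : ℤ) (x : (sAsFree k w).obj n d) :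
    (plusHom k hw).app n d (sAsPlus.mk k w x) =
      (TwNcGerst k).cls (phi k n d x) (diff_phi n d x) := rfl

theorem plusHom_injective {w : ℕ} (hw : w ≤ 2) (n : ℕ) (d : ℤ) :
    Function.Injective ((plusHom k hw).app n d) := by
  refine (injective_iff_map_eq_zero _).2 fun y hy => ?_
  obtain ⟨x, rfl⟩ := Submodule.Quotient.mk_surjective _ y
  obtain ⟨h₁, h₂⟩ := cls_phi_eq_zero_iff.1 hy
  exact mk_eq_zero h₁ h₂

/-- The hypotheses allow a nonzero coefficient only in the arity and degree where the word exists.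
The last clause keeps the element free of other words, so that its filtration level can be read off.
-/
theorem exists_wordCoef_eq {n : ℕ} {d : ℤ} {a b : k} (ha : ¬ (n ≠ 0 ∧ (n : ℤ) = d + 1) → a = 0)
    (hb : ¬ (n = 0 ∧ d = 0) → b = 0) : ∃ z : AdjObj (sAs k) n d,
      wordCoef k n d (List.replicate n true) z = a ∧ wordCoef k n d [false] z = b ∧
        ∀ v, v ≠ [false] → (v = List.replicate n true → a = 0) → wordCoef k n d v z = 0 := by
  have hne : [false] ≠ List.replicate n true := fun h => by
    have : false ∈ List.replicate n true := h ▸ List.mem_singleton_self _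
    simp at this
  refine ⟨a • wordElt k n d (List.replicate n true) + b • wordElt k n d [false], ?_, ?_, ?_⟩
  · rw [map_add, map_smul, map_smul, wordCoef_wordElt_ne hne.symm, smul_zero, add_zero]
    by_cases h : n ≠ 0 ∧ (n : ℤ) = d + 1
    · rw [wordCoef_wordElt_self (by simp) (by simpa using h.1) (by simpa using h.2), smul_eq_mul,
        mul_one]
    · rw [ha h, zero_smul]
  · rw [map_add, map_smul, map_smul, wordCoef_wordElt_ne hne, smul_zero, zero_add]
    by_cases h : n = 0 ∧ d = 0
    · rw [wordCoef_wordElt_self (v := [false]) h.1.symm (by simp) (by simp [h.2]), smul_eq_mul, mul_one]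
    · rw [hb h, zero_smul]
  · intro v h1 h2
    rw [map_add, map_smul, map_smul, wordCoef_wordElt_ne h1, smul_zero, add_zero]
    by_cases h : v = List.replicate n true
    · rw [h2 h, zero_smul]
    · rw [wordCoef_wordElt_ne h, smul_zero]

theorem cls_eq_cls_iff {n : ℕ} {d : ℤ} {x y : (TwNcGerst k).obj n d}
    (hx : (TwNcGerst k).diff n rfl x = 0) (hy : (TwNcGerst k).diff n rfl y = 0) :
    (TwNcGerst k).cls x hx = (TwNcGerst k).cls y hy ↔
      whiteCoef k n d x = whiteCoef k n d y ∧ twoBlackCoef k n d x = twoBlackCoef k n d y := by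
  have hxy : (TwNcGerst k).diff n rfl (x - y) = 0 := by rw [map_sub, hx, hy, sub_zero]
  have h := cls_eq_zero_iff hxy
  rw [map_sub, map_sub, sub_eq_zero, sub_eq_zero] at h
  exact sub_eq_zero.symm.trans h

theorem plusHom_surjective {w : ℕ} (hw : w ≤ 2) (n : ℕ) (d : ℤ) :
    Function.Surjective ((plusHom k hw).app n d) := by
  intro y
  obtain ⟨x, hx, rfl⟩ := exists_cls _ y
  -- The sign in `a` undoes the one that `phi` puts on `ν n`.
  obtain ⟨z, h₁, h₂, -⟩ := exists_wordCoef_eq (n := n) (d := d)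
    (a := sgn k ((n - 1).choose 2) * whiteCoef k n d x) (b := twoBlackCoef k n d x)
    (fun h => by
      have : whiteCoef k n d x = 0 := coef_eq_zero _ (by simp; omega)
      rw [this, mul_zero])
    fun h => coef_eq_zero _ (by simp; omega)
  refine ⟨sAsPlus.mk k w z, (cls_eq_cls_iff _ hx).2 ⟨?_, ?_⟩⟩
  · refine (whiteCoef_phi z).trans ?_
    rw [h₁, ← mul_assoc, sgn_mul_self, one_mul]
  · exact (twoBlackCoef_phi z).trans h₂

/-- Since `F₃` of the target vanishes, its topology is discrete, and `q = 3` serves for every `p`.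
-/
theorem plusHom_isTopIso {w : ℕ} (hw : w ≤ 2) : (plusHom k hw).IsTopIso := by
  refine fun n d => ⟨⟨plusHom_injective hw n d, plusHom_surjective hw n d⟩,
    fun p => ⟨3, fun x hx => ?_⟩⟩
  rw [fil_cohomology_TwNcGerst, Submodule.mem_bot] at hx
  rw [(injective_iff_map_eq_zero _).1 (plusHom_injective hw n d) x hx]
  exact Submodule.zero_mem _

/-- What remains is that a class represented by a cocycle in `F_p` comes from an element of `F_p`.
Positive `p` kills the coefficient of `ν n`, and `p > 2` also that of `γ`, whose weight is exactly
`2` here. -/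
theorem plusHom_isIso : (plusHom k (le_refl 2)).IsIso := by
  refine Hom.isIso_of_bijective _
    (fun n d => ⟨plusHom_injective _ n d, plusHom_surjective _ n d⟩) fun n d p y hy => ?_
  rcases Nat.eq_zero_or_pos p with rfl | hp
  · rw [(sAsPlus k 2).fil_zero]; trivial
  obtain ⟨x, rfl⟩ : ∃ x : AdjObj (sAs k) n d, sAsPlus.mk k 2 x = y :=
    Submodule.Quotient.mk_surjective _ y
  obtain ⟨x', hx', h, he⟩ := exists_of_mem_fil_cohomology hy
  obtain ⟨h₁, h₂⟩ := (cls_eq_cls_iff (diff_phi n d x) hx').1 he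
  have h₁' : wordCoef k n d (List.replicate n true) x = 0 := by
    have h3 := ((whiteCoef_phi x).symm.trans h₁).trans (whiteCoef_eq_zero hp h)
    simpa [← mul_assoc, sgn_mul_self] using congrArg (sgn k ((n - 1).choose 2) * ·) h3
  have h₂' : 2 < p → wordCoef k n d [false] x = 0 := fun hp =>
    ((twoBlackCoef_phi x).symm.trans h₂).trans (twoBlackCoef_eq_zero hp h)
  -- The representative `x` may contain words of low weight that lie in the ideal; `z` is the
  -- representative of the same class that keeps only the multiple of `γ`.
  obtain ⟨z, hz₁, hz₂, hz⟩ := exists_wordCoef_eq (n := n) (d := d) (a := 0)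
    (b := wordCoef k n d [false] x) (fun _ => rfl) fun h => wordCoef_eq_zero x (by
      simp only [List.length_singleton]
      rintro ⟨h3, -, h4⟩
      exact h ⟨h3.symm, by simpa using h4.symm⟩)
  refine ⟨z, mem_fil_sAsFree.2 fun v hv => ?_, ?_⟩
  · by_cases h3 : v = [false]
    · subst h3
      exact hz₂.trans (h₂' hv)
    · exact hz v h3 fun _ => rfl
  · refine sub_eq_zero.1 (mk_eq_zero (x := z - (x : AdjObj (sAs k) n d)) ?_ ?_)
    · rw [map_sub, hz₁, h₁', sub_zero]
    · rw [map_sub, hz₂, sub_self]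

end FDGOperad
end NSOp

theorem mainTheorem10 (k : Type u) [CommRing k] :
    (NSOp.FDGOperad.TwNcGerst k).IsComplete ∧ (NSOp.FDGOperad.TwNcGerst k).cohomology.IsComplete ∧
    ∀ w : ℕ, (w = 1 ∨ w = 2) →
      (NSOp.FDGOperad.sAsFree k w).IsComplete ∧ (NSOp.FDGOperad.sAsPlus k w).IsComplete ∧
      ∃ φ : NSOp.FDGOperad.Hom (NSOp.FDGOperad.sAsFree k w) (NSOp.FDGOperad.TwNcGerst k),
        (φ.app 2 1 (NSOp.FDGOperad.sAsFree.b k w) = NSOp.FDGOperad.whiteEdge k ∧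
          φ.app 0 0 (NSOp.FDGOperad.sAsFree.γ k w) = NSOp.FDGOperad.twoBlackPoints k) ∧
        (∀ φ' : NSOp.FDGOperad.Hom (NSOp.FDGOperad.sAsFree k w) (NSOp.FDGOperad.TwNcGerst k),
          φ'.app 2 1 (NSOp.FDGOperad.sAsFree.b k w) = NSOp.FDGOperad.whiteEdge k →
          φ'.app 0 0 (NSOp.FDGOperad.sAsFree.γ k w) = NSOp.FDGOperad.twoBlackPoints k → φ' = φ) ∧
        ∃ Φ : NSOp.FDGOperad.Hom (NSOp.FDGOperad.sAsPlus k w)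
            (NSOp.FDGOperad.TwNcGerst k).cohomology,
          (∀ (n : ℕ) (d : ℤ) (x : (NSOp.FDGOperad.sAsFree k w).obj n d),
            ∃ hx : (NSOp.FDGOperad.TwNcGerst k).diff n rfl (φ.app n d x) = 0,
              Φ.app n d (NSOp.FDGOperad.sAsPlus.mk k w x) =
                (NSOp.FDGOperad.TwNcGerst k).cls (φ.app n d x) hx) ∧
          Φ.IsTopIso ∧ (w = 2 → Φ.IsIso) := by
  refine ⟨NSOp.FDGOperad.isComplete_TwNcGerst k, NSOp.FDGOperad.isComplete_cohomology_TwNcGerst k,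
    fun w hw => ?_⟩
  have hw' : w ≤ 2 := by omega
  refine ⟨NSOp.FDGOperad.isComplete_sAsFree k w, NSOp.FDGOperad.isComplete_sAsPlus k hw',
    NSOp.FDGOperad.phiHom k hw', ⟨NSOp.FDGOperad.phi_b w, NSOp.FDGOperad.phi_γ w⟩,
    fun φ' hb hγ => NSOp.FDGOperad.Hom.eq_of_generators
      (hb.trans (NSOp.FDGOperad.phi_b w).symm) (hγ.trans (NSOp.FDGOperad.phi_γ w).symm),
    NSOp.FDGOperad.plusHom k hw',
    fun n d x => ⟨NSOp.FDGOperad.diff_phi n d x, NSOp.FDGOperad.plusHom_mk hw' n d x⟩,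
    NSOp.FDGOperad.plusHom_isTopIso hw', ?_⟩
  rintro rfl
  exact NSOp.FDGOperad.plusHom_isIso
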